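/- Let $\pi\colon E\to\mathbb R$ be a smooth surjective submersion (for instance a smooth fibre bundle) with $\dim E=n+1$, $E$ Hausdorff, let $k\ge 1$, and let $J^m\pi$ be the manifold of $m$-jets of local sections of $\pi$, with natural coordinates $(t,q_0^A,\dots,q_m^A)$ and projections $\pi^s_r\colon J^s\pi\to J^r\pi$ for $r\le s$. Let $\mathcal L=L\,dt$ be a $k$-th order Lagrangian density, $L\in C^\infty(J^k\pi)$. Put $\mathcal W=J^{2k-1}\pi\times_{J^{k-1}\pi}T^*(J^{k-1}\pi)$, with projections $\rho_1\colon\mathcal W\to J^{2k-1}\pi$ and $\rho_2\colon\mathcal W\to T^*(J^{k-1}\pi)$, and let $\Omega=\rho_2^*\Omega_{k-1}$, where $\Omega_{k-1}=-d\Theta_{k-1}$ is the canonical symplectic form of $T^*(J^{k-1}\pi)$. Let $\hat C\colon\mathcal W\to\mathbb R$ be the coupling function: $\hat C(j^{2k-1}_t\phi,\alpha)=\langle\alpha,\tfrac{d}{dt}(j^{k-1}\phi)(t)\rangle$, that is, $\hat C=p+\sum_{i=0}^{k-1}p^i_A q^A_{i+1}$ in natural coordinates. Let $\mathcal W_o=\{\hat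 C=L\circ\pi^{2k-1}_k\circ\rho_1\}\subset\mathcal W$, and let $\Omega_o$, $\rho_1^o$ be the restrictions of $\Omega$, $\rho_1$ to $\mathcal W_o$. A (global, smooth) section $\psi$ of $J^m\pi\to\mathbb R$ is called holonomic if $\psi=j^m\phi$ for a section $\phi$ of $\pi$; a section $\psi_o$ of $\mathcal W_o\to\mathbb R$ is called holonomic if $\rho_1^o\circ\psi_o$ is holonomic. Let $\Omega_{\mathcal L}=\widetilde{\mathcal{FL}}{}^*\Omega_{k-1}=-d(\widetilde{\mathcal{FL}}{}^*\Theta_{k-1})$ be the Poincaré–Cartan $2$-form on $J^{2k-1}\pi$, where $\widetilde{\mathcal{FL}}\colon J^{2k-1}\pi\to T^*(J^{k-1}\pi)$ is the extended Legendre–Ostrogradsky map over $\pi^{2k-1}_{k-1}$, given in natural coordinates by $$p_A^{r-1}=\sum_{i=0}^{k-r}(-1)^i d_T^i\Big(\frac{\partial L}{\partial q^A_{r+i}}\Big)\quad(1\le r\le k),\qquad p=L-\sum_{r=1}^k q_r^A\,p_A^{r-1},$$ $d_T$ being the total time derivative. Let $\psi_o\colon\mathbb R\to\mathcal W_o$ be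 a holonomic section of $\mathcal W_o\to\mathbb R$ such that $\psi_o^*\,i(Y)\Omega_o=0$ for every vector field $Y\in\mathfrak X(\mathcal W_o)$. Then $\psi_{\mathcal L}=\rho_1^o\circ\psi_o$ is a holonomic section of $J^{2k-1}\pi\to\mathbb R$ and satisfies $\psi_{\mathcal L}^*\,i(Y)\Omega_{\mathcal L}=0$ for every vector field $Y\in\mathfrak X(J^{2k-1}\pi)$. -/

import Mathlib

open Set Filter
open scoped Manifold ContDiff Topology

noncomputable section
namespace HigherOrderMechanics

/-! ### Calculus of iterated derivatives -/

section Calculus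

theorem eventually_differentiableAt {X Y : Type*} [NormedAddCommGroup X] [NormedSpace ℝ X]
    [NormedAddCommGroup Y] [NormedSpace ℝ Y] {f : X → Y} {x : X} (hf : ContDiffAt ℝ ∞ f x) :
    ∀ᶠ y in 𝓝 x, DifferentiableAt ℝ f y :=
  ((hf.of_le (show (1 : ℕ∞ω) ≤ ∞ by norm_cast)).eventually (by simp)).mono
    fun _ h => h.differentiableAt one_ne_zero

theorem contDiffAt_deriv {Y : Type*} [NormedAddCommGroup Y] [NormedSpace ℝ Y] {f : ℝ → Y} {t : ℝ}
    (hf : ContDiffAt ℝ ∞ f t) : ContDiffAt ℝ ∞ (deriv f) t :=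
  hf.derivWithin (by simp)

theorem iteratedDeriv_prodMk_eq {X Y : Type*} [NormedAddCommGroup X] [NormedSpace ℝ X]
    [NormedAddCommGroup Y] [NormedSpace ℝ Y] {t : ℝ} (i : ℕ) :
    ∀ {a : ℝ → X} {b : ℝ → Y}, ContDiffAt ℝ ∞ a t → ContDiffAt ℝ ∞ b t →
      iteratedDeriv i (fun s => (a s, b s)) t = (iteratedDeriv i a t, iteratedDeriv i b t) := by
  induction i with
  | zero => intros; simp
  | succ i ih =>
    intro a b ha hb
    rw [iteratedDeriv_succ', iteratedDeriv_succ', iteratedDeriv_succ',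
      ← ih (contDiffAt_deriv ha) (contDiffAt_deriv hb)]
    apply Filter.EventuallyEq.iteratedDeriv_eq
    filter_upwards [eventually_differentiableAt ha, eventually_differentiableAt hb] with s h1 h2
    exact (h1.hasDerivAt.prodMk h2.hasDerivAt).deriv

/-- The derivatives of order at most `m` of `F ∘ c` at `t` depend only on those of `c`. -/
theorem iteratedDeriv_comp_congr {Y : Type*} [NormedAddCommGroup Y] [NormedSpace ℝ Y] {t : ℝ}
    (m : ℕ) : ∀ {X : Type*} [NormedAddCommGroup X] [NormedSpace ℝ X] {F : X → Y} {c d : ℝ → X},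
      ContDiffAt ℝ ∞ F (c t) → ContDiffAt ℝ ∞ c t → ContDiffAt ℝ ∞ d t →
      (∀ i ≤ m, iteratedDeriv i c t = iteratedDeriv i d t) →
      iteratedDeriv m (fun s => F (c s)) t = iteratedDeriv m (fun s => F (d s)) t := by
  induction m with
  | zero =>
    intro X _ _ F c d _ _ _ h
    have := h 0 le_rfl
    simp only [iteratedDeriv_zero] at this ⊢
    rw [this]
  | succ m ih =>
    intro X _ _ F c d hF hc hd h
    have h0 : c t = d t := by simpa using h 0 (Nat.zero_le _)
    have key : ∀ {c : ℝ → X}, ContDiffAt ℝ ∞ F (c t) → ContDiffAt ℝ ∞ c t →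
        deriv (fun s => F (c s)) =ᶠ[𝓝 t]
          fun s => (fun p : X × X => fderiv ℝ F p.1 p.2) (c s, deriv c s) := by
      intro c hF hc
      filter_upwards [eventually_differentiableAt hc,
        hc.continuousAt.eventually (eventually_differentiableAt hF)] with s h1 h2
      exact (h2.hasFDerivAt.comp_hasDerivAt s h1.hasDerivAt).deriv
    rw [iteratedDeriv_succ', iteratedDeriv_succ', (key hF hc).iteratedDeriv_eq,
      (key (h0 ▸ hF) hd).iteratedDeriv_eq]
    refine ih (F := fun p : X × X => fderiv ℝ F p.1 p.2) (c := fun s => (c s, deriv c s))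
      (d := fun s => (d s, deriv d s)) ?_
      (hc.prodMk (contDiffAt_deriv hc)) (hd.prodMk (contDiffAt_deriv hd)) ?_
    · refine ContDiffAt.clm_apply (f := fun p : X × X => fderiv ℝ F p.1) ?_ contDiffAt_snd
      exact ContDiffAt.comp (c t, deriv c t) (hF.fderiv_right (m := ∞) (by simp)) contDiffAt_fst
    · intro i hi
      rw [iteratedDeriv_prodMk_eq i hc (contDiffAt_deriv hc),
        iteratedDeriv_prodMk_eq i hd (contDiffAt_deriv hd), h i (by omega),
        ← iteratedDeriv_succ', ← iteratedDeriv_succ', h (i + 1) (by omega)]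

theorem contDiffOn_iteratedDeriv {Z Y : Type*} [NormedAddCommGroup Z] [NormedSpace ℝ Z]
    [NormedAddCommGroup Y] [NormedSpace ℝ Y] {U : Set (Z × ℝ)} (hU : IsOpen U) (i : ℕ) :
    ∀ {H : Z × ℝ → Y}, ContDiffOn ℝ ∞ H U →
      ContDiffOn ℝ ∞ (fun p : Z × ℝ => iteratedDeriv i (fun s => H (p.1, s)) p.2) U := by
  induction i with
  | zero => intro H hH; simpa using hH
  | succ i ih =>
    intro H hH
    have h1 : ContDiffOn ℝ ∞ (fun p => fderiv ℝ H p (0, 1)) U :=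
      (hH.fderiv_of_isOpen hU (by simp)).clm_apply contDiffOn_const
    refine (ih h1).congr ?_
    intro p hp
    rw [iteratedDeriv_succ']
    apply Filter.EventuallyEq.iteratedDeriv_eq
    have hc : ContinuousAt (fun s : ℝ => (p.1, s)) p.2 := by fun_prop
    filter_upwards [hc.eventually (hU.mem_nhds hp)] with s hs
    have h2 : HasFDerivAt H (fderiv ℝ H (p.1, s)) (p.1, s) :=
      ((hH.contDiffAt (hU.mem_nhds hs)).differentiableAt (by simp)).hasFDerivAt
    exact (h2.comp_hasDerivAt s ((hasDerivAt_const s p.1).prodMk (hasDerivAt_id s))).deriv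

theorem contDiffOn_iteratedDeriv_comp {Z Y : Type*} [NormedAddCommGroup Z] [NormedSpace ℝ Z]
    [NormedAddCommGroup Y] [NormedSpace ℝ Y] {U : Set (Z × ℝ)} (hU : IsOpen U) (i : ℕ)
    {H : Z × ℝ → Y} (hH : ContDiffOn ℝ ∞ H U) {τ : Z → ℝ} (hτ : ContDiff ℝ ∞ τ) {S : Set Z}
    (hS : ∀ z ∈ S, (z, τ z) ∈ U) :
    ContDiffOn ℝ ∞ (fun z => iteratedDeriv i (fun s => H (z, s)) (τ z)) S :=
  (contDiffOn_iteratedDeriv hU i hH).comp (contDiff_id.prodMk hτ).contDiffOn hS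

/-- The Taylor polynomial at `t` with prescribed derivatives `q 0, …, q m`. -/
def taylorCurve {V : Type*} [NormedAddCommGroup V] [NormedSpace ℝ V] {m : ℕ}
    (t : ℝ) (q : Fin (m + 1) → V) (s : ℝ) : V :=
  ∑ i : Fin (m + 1), (((i : ℕ).factorial : ℝ)⁻¹ * (s - t) ^ (i : ℕ)) • q i

theorem contDiff_taylorCurve {V : Type*} [NormedAddCommGroup V] [NormedSpace ℝ V] {m : ℕ} :
    ContDiff ℝ ∞ (fun p : (ℝ × (Fin (m + 1) → V)) × ℝ => taylorCurve p.1.1 p.1.2 p.2) := by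
  unfold taylorCurve
  fun_prop

theorem iteratedDeriv_taylorCurve {V : Type*} [NormedAddCommGroup V] [NormedSpace ℝ V] {m : ℕ}
    (t : ℝ) (q : Fin (m + 1) → V) (j : Fin (m + 1)) :
    iteratedDeriv j (taylorCurve t q) t = q j := by
  have hpow : ∀ i : ℕ, iteratedDeriv j (fun s : ℝ => (s - t) ^ i) t =
      if (j : ℕ) = i then ((i.factorial : ℕ) : ℝ) else 0 := by
    intro i
    rw [iteratedDeriv_comp_sub_const (j : ℕ) (fun s : ℝ => s ^ i) t]
    simp only [iteratedDeriv_pow, sub_self]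
    rcases lt_trichotomy (j : ℕ) i with h | h | h
    · rw [if_neg h.ne, zero_pow (by omega), mul_zero]
    · rw [if_pos h, h]; simp [Nat.descFactorial_self]
    · rw [if_neg h.ne', Nat.descFactorial_eq_zero_iff_lt.2 h]; simp
  unfold taylorCurve
  rw [iteratedDeriv_fun_sum (fun i _ => by fun_prop), Finset.sum_eq_single j]
  · rw [iteratedDeriv_smul_const (by fun_prop), iteratedDeriv_const_mul_field, hpow, if_pos rfl,
      inv_mul_cancel₀ (by positivity), one_smul]
  · intro i _ hij
    rw [iteratedDeriv_smul_const (by fun_prop), iteratedDeriv_const_mul_field, hpow,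
      if_neg (fun h => hij (Fin.ext h.symm)), mul_zero, zero_smul]
  · simp

theorem taylorCurve_self {V : Type*} [NormedAddCommGroup V] [NormedSpace ℝ V] {m : ℕ}
    (t : ℝ) (q : Fin (m + 1) → V) : taylorCurve t q t = q 0 := by
  simpa using iteratedDeriv_taylorCurve t q 0

end Calculus

/-! ### Fibred manifolds over the real line and their adapted charts -/

/-- The model space for the fibre coordinates `(q^1, …, q^n)`. -/
abbrev FibreModel (n : ℕ) : Type := EuclideanSpace ℝ (Fin n)

/-- A fibred manifold `π : E → ℝ` with `dim E = n + 1`, i.e. a smooth surjective submersion. Every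
smooth fibre bundle over `ℝ` is one. -/
structure FibredManifold (n : ℕ) (E : Type*) [TopologicalSpace E]
    [ChartedSpace (EuclideanSpace ℝ (Fin (n + 1))) E] where
  proj : E → ℝ
  surjective : Function.Surjective proj
  submersion : Manifold.IsSubmersion (𝓡 (n + 1)) 𝓘(ℝ, ℝ) ∞ proj

section Jets

variable {n : ℕ} {E : Type*} [TopologicalSpace E]
  [ChartedSpace (EuclideanSpace ℝ (Fin (n + 1))) E]

/-- A chart `(t, q^A)` of `E` adapted to the projection. -/
structure AdaptedChart (π : FibredManifold n E) where
  toChart : OpenPartialHomeomorph E (ℝ × FibreModel n)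
  smooth : ContMDiffOn (𝓡 (n + 1)) 𝓘(ℝ, ℝ × FibreModel n) ∞ toChart toChart.source
  smooth_symm :
    ContMDiffOn 𝓘(ℝ, ℝ × FibreModel n) (𝓡 (n + 1)) ∞ toChart.symm toChart.target
  fst_eq : ∀ x ∈ toChart.source, (toChart x).1 = π.proj x

/-- A local section of the projection, defined on an open set of times `dom`, with a marked time
`pt` in its domain. Only the values on `dom` matter. -/
structure PointedSection (π : FibredManifold n E) where
  toFun : ℝ → E
  dom : Set ℝ
  isOpen_dom : IsOpen dom
  smooth : ContMDiffOn 𝓘(ℝ, ℝ) (𝓡 (n + 1)) ∞ toFun dom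
  proj_apply : ∀ s ∈ dom, π.proj (toFun s) = s
  pt : ℝ
  pt_mem : pt ∈ dom

/-- Two local sections have the same `m`-jet at `t` if they have the same value `x` at `t` and, in
the preferred chart at `x`, the same derivatives at `t` up to order `m`. -/
def jetSetoid (π : FibredManifold n E) (m : ℕ) : Setoid (PointedSection π) where
  r σ τ := σ.pt = τ.pt ∧ σ.toFun σ.pt = τ.toFun τ.pt ∧ ∀ i ≤ m,
    iteratedDeriv i (fun s => extChartAt (𝓡 (n + 1)) (σ.toFun σ.pt) (σ.toFun s)) σ.pt =
      iteratedDeriv i (fun s => extChartAt (𝓡 (n + 1)) (σ.toFun σ.pt) (τ.toFun s)) τ.pt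
  iseqv := ⟨fun _ => ⟨rfl, rfl, fun _ _ => rfl⟩,
    fun h => ⟨h.1.symm, h.2.1.symm, fun i hi => by rw [← h.2.1]; exact (h.2.2 i hi).symm⟩,
    fun h h' => ⟨h.1.trans h'.1, h.2.1.trans h'.2.1,
      fun i hi => (h.2.2 i hi).trans (by rw [h.2.1]; exact h'.2.2 i hi)⟩⟩

/-- The jet space `J^m π`. -/
def Jet (π : FibredManifold n E) (m : ℕ) : Type _ := Quotient (jetSetoid π m)

variable {π : FibredManifold n E}

/-- The `m`-jet of a local section at its marked time. -/
def PointedSection.jet (σ : PointedSection π) (m : ℕ) : Jet π m :=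
  Quotient.mk (jetSetoid π m) σ

/-- The same local section with another marked time. -/
def PointedSection.moveTo (σ : PointedSection π) (s : ℝ) (hs : s ∈ σ.dom) : PointedSection π :=
  { σ with pt := s, pt_mem := hs }

open Classical in
/-- The jet prolongation `s ↦ j^m_s φ` of a local section (with a junk value off its domain). -/
def PointedSection.prolong (σ : PointedSection π) (m : ℕ) (s : ℝ) : Jet π m :=
  if hs : s ∈ σ.dom then (σ.moveTo s hs).jet m else σ.jet m

namespace Jet

variable {m : ℕ}

/-- A local section representing a jet. -/
def rep (j : Jet π m) : PointedSection π := Quotient.out j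

/-- The projection `J^m π → ℝ`. -/
def time (j : Jet π m) : ℝ := Quotient.lift (s := jetSetoid π m) PointedSection.pt (fun _ _ h => h.1) j

/-- The projection `J^m π → E`. -/
def base (j : Jet π m) : E := Quotient.lift (s := jetSetoid π m) (fun σ => σ.toFun σ.pt) (fun _ _ h => h.2.1) j

theorem jet_rep (j : Jet π m) : j.rep.jet m = j := Quotient.out_eq j

end Jet

theorem PointedSection.contMDiffAt (σ : PointedSection π) :
    ContMDiffAt 𝓘(ℝ, ℝ) (𝓡 (n + 1)) ∞ σ.toFun σ.pt :=
  σ.smooth.contMDiffAt (σ.isOpen_dom.mem_nhds σ.pt_mem)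

theorem PointedSection.proj_base (σ : PointedSection π) : π.proj (σ.toFun σ.pt) = σ.pt :=
  σ.proj_apply _ σ.pt_mem

theorem PointedSection.eventually_proj (σ : PointedSection π) :
    ∀ᶠ s in 𝓝 σ.pt, π.proj (σ.toFun s) = s := by
  filter_upwards [σ.isOpen_dom.mem_nhds σ.pt_mem] with s hs using σ.proj_apply s hs

theorem AdaptedChart.contDiffAt_comp (e : AdaptedChart π) (σ : PointedSection π)
    (h : σ.toFun σ.pt ∈ e.toChart.source) :
    ContDiffAt ℝ ∞ (fun s => e.toChart (σ.toFun s)) σ.pt :=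
  contMDiffAt_iff_contDiffAt.1
    ((e.smooth.contMDiffAt (e.toChart.open_source.mem_nhds h)).comp σ.pt σ.contMDiffAt)

theorem FibredManifold.exists_adaptedChart (π : FibredManifold n E) (x : E) :
    ∃ e : AdaptedChart π, x ∈ e.toChart.source := by
  have h := π.submersion.isSubmersionAt x
  obtain ⟨c⟩ : Nonempty (h.complement ≃L[ℝ] FibreModel n) := by
    have eq := h.equiv
    have : FiniteDimensional ℝ (ℝ × h.complement) := eq.toLinearEquiv.finiteDimensional
    have : FiniteDimensional ℝ h.complement :=
      FiniteDimensional.of_surjective (LinearMap.snd ℝ ℝ h.complement) LinearMap.snd_surjective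
    refine ⟨ContinuousLinearEquiv.ofFinrankEq ?_⟩
    have h1 := eq.toLinearEquiv.finrank_eq
    rw [Module.finrank_prod, finrank_euclideanSpace_fin, Module.finrank_self] at h1
    rw [finrank_euclideanSpace_fin]
    omega
  let A : EuclideanSpace ℝ (Fin (n + 1)) ≃L[ℝ] ℝ × FibreModel n :=
    h.equiv.trans ((ContinuousLinearEquiv.refl ℝ ℝ).prodCongr c)
  let χ := h.codChart
  let e : OpenPartialHomeomorph E (ℝ × FibreModel n) :=
    (h.domChart.trans A.toHomeomorph.toOpenPartialHomeomorph).trans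
      (χ.symm.prod (OpenPartialHomeomorph.refl (FibreModel n)))
  have hfst : ∀ y ∈ h.domChart.source, (A (h.domChart y)).1 = χ (π.proj y) := by
    intro y hy
    have := h.writtenInCharts (show h.domChart y ∈ (h.domChart.extend (𝓡 (n + 1))).target by
      simpa using h.domChart.map_source hy)
    simp only [Function.comp_apply, OpenPartialHomeomorph.extend_coe,
      OpenPartialHomeomorph.extend_coe_symm, modelWithCornersSelf_coe,
      modelWithCornersSelf_coe_symm, id, h.domChart.left_inv hy] at this
    exact this.symm
  have hsrc : ∀ y, y ∈ e.source ↔ y ∈ h.domChart.source := by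
    intro y
    constructor
    · intro hy
      simp [e] at hy
      exact hy.1
    · intro hy
      have h2 : χ (π.proj y) ∈ χ.target := χ.map_source (h.source_subset_preimage_source hy)
      have h3 := hfst y hy
      simp [e, hy]
      rw [h3]; exact h2
  have hχ := h.codChart_mem_maximalAtlas
  have hφ := h.domChart_mem_maximalAtlas
  refine ⟨⟨e, ?_, ?_, ?_⟩, (hsrc x).2 h.mem_domChart_source⟩
  · have h1 : ContMDiffOn (𝓡 (n + 1)) 𝓘(ℝ, ℝ × FibreModel n) ∞
        (fun y => A (h.domChart y)) e.source :=
      A.contDiff.contMDiff.comp_contMDiffOn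
        ((contMDiffOn_of_mem_maximalAtlas hφ).mono fun y hy => (hsrc y).1 hy)
    have h2 : ContDiffOn ℝ ∞ (χ.symm : ℝ → ℝ) χ.target :=
      contMDiffOn_iff_contDiffOn.1 (contMDiffOn_symm_of_mem_maximalAtlas hχ)
    have h3 : ContDiffOn ℝ ∞ (fun p : ℝ × FibreModel n => (χ.symm p.1, p.2))
        (Prod.fst ⁻¹' χ.target) :=
      (h2.comp contDiffOn_fst fun _ hp => hp).prodMk contDiffOn_snd
    refine h3.contMDiffOn.comp h1 ?_
    intro y hy
    have hy' := (hsrc y).1 hy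
    show (A (h.domChart y)).1 ∈ χ.target
    rw [hfst y hy']
    exact χ.map_source (h.source_subset_preimage_source hy')
  · have htgt : ∀ p ∈ e.target, p.1 ∈ χ.source ∧ A.symm (χ p.1, p.2) ∈ h.domChart.target := by
      intro p hp
      simpa [e] using hp
    have h2 : ContDiffOn ℝ ∞ (χ : ℝ → ℝ) χ.source :=
      contMDiffOn_iff_contDiffOn.1 (contMDiffOn_of_mem_maximalAtlas hχ)
    have h3 : ContDiffOn ℝ ∞ (fun p : ℝ × FibreModel n => A.symm (χ p.1, p.2)) e.target :=
      A.symm.contDiff.comp_contDiffOn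
        ((h2.comp contDiffOn_fst fun p hp => (htgt p hp).1).prodMk contDiffOn_snd)
    exact (contMDiffOn_symm_of_mem_maximalAtlas hφ).comp h3.contMDiffOn
      fun p hp => (htgt p hp).2
  · intro y hy
    have hy' := (hsrc y).1 hy
    show χ.symm (A (h.domChart y)).1 = π.proj y
    rw [hfst y hy']
    exact χ.left_inv (h.source_subset_preimage_source hy')

/-- A chosen adapted chart around a point of `E`. -/
def FibredManifold.adaptedChartAt (π : FibredManifold n E) (x : E) : AdaptedChart π :=
  (π.exists_adaptedChart x).choose

theorem FibredManifold.mem_adaptedChartAt (π : FibredManifold n E) (x : E) :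
    x ∈ (π.adaptedChartAt x).toChart.source :=
  (π.exists_adaptedChart x).choose_spec

/-- The derivative `d^i q / dt^i` at the marked time of a local section, in an adapted chart. -/
def AdaptedChart.sectionCoord (e : AdaptedChart π) (σ : PointedSection π) (i : ℕ) :
    FibreModel n :=
  iteratedDeriv i (fun s => (e.toChart (σ.toFun s)).2) σ.pt

theorem AdaptedChart.iteratedDeriv_comp (e : AdaptedChart π) (σ : PointedSection π)
    (h : σ.toFun σ.pt ∈ e.toChart.source) (i : ℕ) :
    iteratedDeriv i (fun s => e.toChart (σ.toFun s)) σ.pt =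
      (iteratedDeriv i (fun s : ℝ => s) σ.pt, e.sectionCoord σ i) := by
  have h2 : ContDiffAt ℝ ∞ (fun s => (e.toChart (σ.toFun s)).2) σ.pt :=
    contDiffAt_snd.comp σ.pt (e.contDiffAt_comp σ h)
  rw [AdaptedChart.sectionCoord, ← iteratedDeriv_prodMk_eq i (a := fun s => s) contDiffAt_id h2]
  apply Filter.EventuallyEq.iteratedDeriv_eq
  filter_upwards [σ.eventually_proj,
    σ.contMDiffAt.continuousAt.eventually (e.toChart.open_source.mem_nhds h)] with s h3 h4
  exact Prod.ext ((e.fst_eq _ h4).trans h3) rfl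

section Manifold

variable [IsManifold (𝓡 (n + 1)) ∞ E]

theorem AdaptedChart.sectionCoord_congr (e : AdaptedChart π) {m : ℕ} {σ τ : PointedSection π}
    (h : σ.toFun σ.pt ∈ e.toChart.source) (hr : (jetSetoid π m).r σ τ) {i : ℕ} (hi : i ≤ m) :
    e.sectionCoord σ i = e.sectionCoord τ i := by
  obtain ⟨h1, h2, h3⟩ := hr
  set x := σ.toFun σ.pt with hx
  have key : ∀ ρ : PointedSection π, ρ.toFun ρ.pt = x → e.sectionCoord ρ i =
      iteratedDeriv i (fun s => (fun z => (e.toChart ((extChartAt (𝓡 (n + 1)) x).symm z)).2)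
        (extChartAt (𝓡 (n + 1)) x (ρ.toFun s))) ρ.pt := by
    intro ρ hρ
    apply Filter.EventuallyEq.iteratedDeriv_eq
    filter_upwards [ρ.contMDiffAt.continuousAt.eventually
      ((isOpen_extChartAt_source (I := 𝓡 (n + 1)) x).mem_nhds
        (by rw [hρ]; exact mem_extChartAt_source x))] with s hs
    simp only [(extChartAt (𝓡 (n + 1)) x).left_inv hs]
  have hsm : ∀ ρ : PointedSection π, ρ.toFun ρ.pt = x →
      ContDiffAt ℝ ∞ (fun s => extChartAt (𝓡 (n + 1)) x (ρ.toFun s)) ρ.pt := by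
    intro ρ hρ
    refine contMDiffAt_iff_contDiffAt.1 (ContMDiffAt.comp ρ.pt ?_ ρ.contMDiffAt)
    exact contMDiffAt_extChartAt' (by rw [hρ]; exact mem_chart_source _ x)
  rw [key σ hx.symm, key τ h2.symm, ← h1]
  refine iteratedDeriv_comp_congr (t := σ.pt) i
    (F := fun z => (e.toChart ((extChartAt (𝓡 (n + 1)) x).symm z)).2) ?_
    (hsm σ hx.symm) (by rw [h1]; exact hsm τ h2.symm) ?_
  · refine contDiffAt_snd.comp _ (contMDiffAt_iff_contDiffAt.1 ?_)
    refine ContMDiffAt.comp (I' := 𝓡 (n + 1)) (g := e.toChart) _ ?_ ?_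
    · rw [extChartAt_to_inv]
      exact e.smooth.contMDiffAt (e.toChart.open_source.mem_nhds h)
    · exact (contMDiffOn_extChartAt_symm x).contMDiffAt (extChartAt_target_mem_nhds x)
  · intro l hl
    rw [h3 l (hl.trans hi), ← h1]

theorem AdaptedChart.jet_eq (e : AdaptedChart π) {m : ℕ} {σ τ : PointedSection π}
    (h : σ.toFun σ.pt ∈ e.toChart.source) (h' : τ.toFun τ.pt ∈ e.toChart.source)
    (hpt : σ.pt = τ.pt) (hc : ∀ i ≤ m, e.sectionCoord σ i = e.sectionCoord τ i) :
    σ.jet m = τ.jet m := by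
  have hder : ∀ i ≤ m, iteratedDeriv i (fun s => e.toChart (σ.toFun s)) σ.pt =
      iteratedDeriv i (fun s => e.toChart (τ.toFun s)) σ.pt := by
    intro i hi
    rw [e.iteratedDeriv_comp σ h, hc i hi, hpt, e.iteratedDeriv_comp τ h']
  have hval : σ.toFun σ.pt = τ.toFun τ.pt := by
    refine e.toChart.injOn h h' ?_
    have := hder 0 (Nat.zero_le _)
    simp only [iteratedDeriv_zero] at this
    rw [this, hpt]
  refine Quotient.sound ⟨hpt, hval, fun i hi => ?_⟩
  set x := σ.toFun σ.pt with hx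
  have key : ∀ ρ : PointedSection π, ρ.toFun ρ.pt = x →
      iteratedDeriv i (fun s => extChartAt (𝓡 (n + 1)) x (ρ.toFun s)) ρ.pt =
      iteratedDeriv i (fun s => (fun z => extChartAt (𝓡 (n + 1)) x (e.toChart.symm z))
        (e.toChart (ρ.toFun s))) ρ.pt := by
    intro ρ hρ
    apply Filter.EventuallyEq.iteratedDeriv_eq
    filter_upwards [ρ.contMDiffAt.continuousAt.eventually
      (e.toChart.open_source.mem_nhds (by rw [hρ]; exact h))] with s hs
    simp only [e.toChart.left_inv hs]
  rw [key σ hx.symm, key τ hval.symm, ← hpt]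
  refine iteratedDeriv_comp_congr (t := σ.pt) i
    (F := fun z => extChartAt (𝓡 (n + 1)) x (e.toChart.symm z)) ?_
    (e.contDiffAt_comp σ h) (by rw [hpt]; exact e.contDiffAt_comp τ h')
    (fun l hl => hder l (hl.trans hi))
  refine contMDiffAt_iff_contDiffAt.1 ?_
  refine ContMDiffAt.comp (I' := 𝓡 (n + 1)) (g := extChartAt (𝓡 (n + 1)) x) _ ?_ ?_
  · rw [e.toChart.left_inv h]
    exact contMDiffAt_extChartAt' (mem_chart_source _ x)
  · exact e.smooth_symm.contMDiffAt (e.toChart.open_target.mem_nhds (e.toChart.map_source h))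

end Manifold

/-- The projection `π^s_r : J^s π → J^r π`, as a map. -/
def Jet.truncate {r s : ℕ} (h : r ≤ s) : Jet π s → Jet π r :=
  Quotient.map' (s₁ := jetSetoid π s) (s₂ := jetSetoid π r) id
    fun _ _ h' => ⟨h'.1, h'.2.1, fun i hi => h'.2.2 i (hi.trans h)⟩

theorem Jet.truncate_jet {r s : ℕ} (h : r ≤ s) (σ : PointedSection π) :
    Jet.truncate h (σ.jet s) = σ.jet r := rfl

theorem Jet.base_truncate {r s : ℕ} (h : r ≤ s) (j : Jet π s) :
    (Jet.truncate h j).base = j.base := by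
  obtain ⟨σ, rfl⟩ : ∃ σ : PointedSection π, σ.jet s = j := ⟨j.rep, j.jet_rep⟩
  rfl

/-! ### The manifold structure of the jet spaces -/

/-- The model space of `J^m π`, with coordinates `(t, q_0^A, …, q_m^A)`. -/
abbrev JetModel (n m : ℕ) : Type := ℝ × (Fin (m + 1) → FibreModel n)

/-- The local section whose expression in an adapted chart is a Taylor polynomial. -/
def AdaptedChart.taylorSection (e : AdaptedChart π) {m : ℕ} (p : JetModel n m)
    (h : (p.1, p.2 0) ∈ e.toChart.target) : PointedSection π where
  toFun s := e.toChart.symm (s, taylorCurve p.1 p.2 s)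
  dom := {s | (s, taylorCurve p.1 p.2 s) ∈ e.toChart.target}
  isOpen_dom := e.toChart.open_target.preimage
    (continuous_id.prodMk (contDiff_taylorCurve.continuous.comp (by fun_prop :
      Continuous fun s : ℝ => (p, s))))
  smooth := e.smooth_symm.comp
    (contDiff_id.prodMk (contDiff_taylorCurve.comp (by fun_prop :
      ContDiff ℝ ∞ fun s : ℝ => (p, s)))).contMDiff.contMDiffOn fun _ h => h
  proj_apply s hs := by
    rw [← e.fst_eq _ (e.toChart.map_target hs), e.toChart.right_inv hs]
  pt := p.1
  pt_mem := by simpa [taylorCurve_self] using h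

instance (m : ℕ) : Nonempty (Jet π m) := by
  obtain ⟨x, -⟩ := π.surjective 0
  have h := π.mem_adaptedChartAt x
  exact ⟨((π.adaptedChartAt x).taylorSection (m := m)
    (((π.adaptedChartAt x).toChart x).1, fun _ => ((π.adaptedChartAt x).toChart x).2)
    ((π.adaptedChartAt x).toChart.map_source h)).jet m⟩

theorem AdaptedChart.taylorSection_base (e : AdaptedChart π) {m : ℕ} (p : JetModel n m)
    (h : (p.1, p.2 0) ∈ e.toChart.target) :
    (e.taylorSection p h).toFun (e.taylorSection p h).pt = e.toChart.symm (p.1, p.2 0) := by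
  simp only [AdaptedChart.taylorSection, taylorCurve_self]

theorem AdaptedChart.taylorSection_coord (e : AdaptedChart π) {m : ℕ} (p : JetModel n m)
    (h : (p.1, p.2 0) ∈ e.toChart.target) (i : Fin (m + 1)) :
    e.sectionCoord (e.taylorSection p h) i = p.2 i := by
  rw [← iteratedDeriv_taylorCurve p.1 p.2 i]
  apply Filter.EventuallyEq.iteratedDeriv_eq
  filter_upwards [(e.taylorSection p h).isOpen_dom.mem_nhds (e.taylorSection p h).pt_mem] with s hs
  have hs' : (s, taylorCurve p.1 p.2 s) ∈ e.toChart.target := hs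
  simp only [AdaptedChart.taylorSection, e.toChart.right_inv hs']

theorem Jet.base_rep {m : ℕ} (j : Jet π m) : j.rep.toFun j.rep.pt = j.base := by
  conv_rhs => rw [← j.jet_rep]
  rfl

theorem Jet.time_rep {m : ℕ} (j : Jet π m) : j.rep.pt = j.time := by
  conv_rhs => rw [← j.jet_rep]
  rfl

theorem Jet.proj_base {m : ℕ} (j : Jet π m) : π.proj j.base = j.time := by
  rw [← j.base_rep, ← j.time_rep, j.rep.proj_base]

section Manifold

variable [IsManifold (𝓡 (n + 1)) ∞ E]

theorem AdaptedChart.sectionCoord_rep (e : AdaptedChart π) {m : ℕ} (σ : PointedSection π)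
    (h : σ.toFun σ.pt ∈ e.toChart.source) {i : ℕ} (hi : i ≤ m) :
    e.sectionCoord (σ.jet m).rep i = e.sectionCoord σ i := by
  have hr : (jetSetoid π m).r (σ.jet m).rep σ := Quotient.exact (σ.jet m).jet_rep
  exact e.sectionCoord_congr (by rw [hr.2.1]; exact h) hr hi

open Classical in
/-- The natural coordinates `(t, q_0^A, …, q_m^A)` on `J^m π` induced by an adapted chart. -/
def AdaptedChart.jetChart (e : AdaptedChart π) (m : ℕ) : PartialEquiv (Jet π m) (JetModel n m) where
  toFun j := (j.time, fun i => e.sectionCoord j.rep i)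
  invFun p := if h : (p.1, p.2 0) ∈ e.toChart.target then (e.taylorSection p h).jet m
    else Classical.arbitrary _
  source := {j | j.base ∈ e.toChart.source}
  target := {p | (p.1, p.2 0) ∈ e.toChart.target}
  map_source' j hj := by
    have h : (j.time, e.sectionCoord j.rep 0) = e.toChart j.base :=
      Prod.ext ((j.proj_base.symm.trans (e.fst_eq _ hj).symm))
        (by simp [AdaptedChart.sectionCoord, j.base_rep])
    show (j.time, e.sectionCoord j.rep 0) ∈ e.toChart.target
    rw [h]
    exact e.toChart.map_source hj
  map_target' p hp := by
    rw [dif_pos (show (p.1, p.2 0) ∈ e.toChart.target from hp)]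
    show (e.taylorSection p hp).toFun (e.taylorSection p hp).pt ∈ e.toChart.source
    rw [e.taylorSection_base]
    exact e.toChart.map_target hp
  left_inv' j hj := by
    have h : (j.time, e.sectionCoord j.rep 0) = e.toChart j.base :=
      Prod.ext ((j.proj_base.symm.trans (e.fst_eq _ hj).symm))
        (by simp [AdaptedChart.sectionCoord, j.base_rep])
    have hp : (j.time, e.sectionCoord j.rep (0 : Fin (m + 1))) ∈ e.toChart.target := by
      show (j.time, e.sectionCoord j.rep 0) ∈ e.toChart.target
      rw [h]
      exact e.toChart.map_source hj
    rw [dif_pos hp]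
    conv_rhs => rw [← j.jet_rep]
    refine e.jet_eq ?_ (by rw [j.base_rep]; exact hj) j.time_rep.symm ?_
    · rw [e.taylorSection_base]
      exact e.toChart.map_target hp
    · intro i hi
      exact e.taylorSection_coord (j.time, fun i : Fin (m + 1) => e.sectionCoord j.rep i) hp
        ⟨i, Nat.lt_succ_of_le hi⟩
  right_inv' p hp := by
    rw [dif_pos (show (p.1, p.2 0) ∈ e.toChart.target from hp)]
    refine Prod.ext rfl (funext fun i => ?_)
    show e.sectionCoord ((e.taylorSection p hp).jet m).rep i = p.2 i
    rw [e.sectionCoord_rep _ (by rw [e.taylorSection_base]; exact e.toChart.map_target hp)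
      (Nat.le_of_lt_succ i.2), e.taylorSection_coord]

theorem AdaptedChart.jetChart_symm_apply (e : AdaptedChart π) {m : ℕ} (p : JetModel n m)
    (h : (p.1, p.2 0) ∈ e.toChart.target) :
    (e.jetChart m).symm p = (e.taylorSection p h).jet m := dif_pos h

theorem AdaptedChart.base_jetChart_symm (e : AdaptedChart π) {m : ℕ} (p : JetModel n m)
    (h : (p.1, p.2 0) ∈ e.toChart.target) :
    ((e.jetChart m).symm p).base = e.toChart.symm (p.1, p.2 0) := by
  rw [e.jetChart_symm_apply p h]
  exact e.taylorSection_base p h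

theorem AdaptedChart.jetTransition_source (e e' : AdaptedChart π) (m : ℕ) :
    ((e.jetChart m).symm.trans (e'.jetChart m)).source =
      (fun p : JetModel n m => (p.1, p.2 0)) ⁻¹' (e.toChart.symm.trans e'.toChart).source := by
  ext p
  simp only [PartialEquiv.trans_source, PartialEquiv.symm_source, mem_inter_iff, mem_preimage,
    OpenPartialHomeomorph.trans_source, OpenPartialHomeomorph.symm_source]
  refine and_congr_right fun hp => ?_
  show ((e.jetChart m).symm p).base ∈ e'.toChart.source ↔ _
  rw [e.base_jetChart_symm p hp]

theorem AdaptedChart.contDiffOn_jetTransition (e e' : AdaptedChart π) (m : ℕ) :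
    ContDiffOn ℝ ∞ ((e.jetChart m).symm.trans (e'.jetChart m))
      ((e.jetChart m).symm.trans (e'.jetChart m)).source := by
  have htr : ContDiffOn ℝ ∞ (fun z => e'.toChart (e.toChart.symm z))
      (e.toChart.symm.trans e'.toChart).source := by
    refine contMDiffOn_iff_contDiffOn.1 (ContMDiffOn.comp (I' := 𝓡 (n + 1)) (g := e'.toChart)
      e'.smooth (e.smooth_symm.mono ?_) ?_)
    · exact fun z hz => by simp at hz; exact hz.1
    · exact fun z hz => by simp at hz; exact hz.2
  have hg : ContDiff ℝ ∞ fun w : JetModel n m × ℝ => (w.2, taylorCurve w.1.1 w.1.2 w.2) :=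
    contDiff_snd.prodMk contDiff_taylorCurve
  set U : Set (JetModel n m × ℝ) := (fun w => (w.2, taylorCurve w.1.1 w.1.2 w.2)) ⁻¹'
    (e.toChart.symm.trans e'.toChart).source with hUdef
  have hU : IsOpen U :=
    (e.toChart.symm.trans e'.toChart).open_source.preimage hg.continuous
  have hH : ContDiffOn ℝ ∞ (fun w : JetModel n m × ℝ =>
      (e'.toChart (e.toChart.symm (w.2, taylorCurve w.1.1 w.1.2 w.2))).2) U :=
    contDiff_snd.comp_contDiffOn (htr.comp hg.contDiffOn fun _ h => h)
  rw [e.jetTransition_source e' m]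
  have hmaps : MapsTo (fun p : JetModel n m => (p, p.1))
      ((fun p : JetModel n m => (p.1, p.2 0)) ⁻¹' (e.toChart.symm.trans e'.toChart).source) U := by
    intro p hp
    show (p.1, taylorCurve p.1 p.2 p.1) ∈ (e.toChart.symm.trans e'.toChart).source
    rw [taylorCurve_self]
    exact hp
  have hmain : ContDiffOn ℝ ∞ (fun p : JetModel n m => ((p.1, fun i : Fin (m + 1) =>
      iteratedDeriv i (fun s => (e'.toChart (e.toChart.symm (s, taylorCurve p.1 p.2 s))).2) p.1) :
        JetModel n m))
      ((fun p : JetModel n m => (p.1, p.2 0)) ⁻¹' (e.toChart.symm.trans e'.toChart).source) := by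
    refine contDiffOn_fst.prodMk (contDiffOn_pi.2 fun i => ?_)
    exact contDiffOn_iteratedDeriv_comp (τ := Prod.fst) hU i hH contDiff_fst hmaps
  refine hmain.congr fun p hp => ?_
  have hp1 : (p.1, p.2 0) ∈ e.toChart.target := by
    have := hp; simp at this; exact this.1
  have hp2 : e.toChart.symm (p.1, p.2 0) ∈ e'.toChart.source := by
    have := hp; simp at this; exact this.2
  rw [PartialEquiv.coe_trans, Function.comp_apply, e.jetChart_symm_apply p hp1]
  refine Prod.ext rfl (funext fun i => ?_)
  exact e'.sectionCoord_rep _ (by rw [e.taylorSection_base]; exact hp2) (Nat.le_of_lt_succ i.2)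

theorem AdaptedChart.isOpen_jetTransition_source (e e' : AdaptedChart π) (m : ℕ) :
    IsOpen ((e.jetChart m).symm.trans (e'.jetChart m)).source := by
  rw [e.jetTransition_source e' m]
  exact (e.toChart.symm.trans e'.toChart).open_source.preimage (by fun_prop)

/-- The natural atlas of `J^m π`, given by all adapted charts. -/
def jetCore (π : FibredManifold n E) (m : ℕ) : ChartedSpaceCore (JetModel n m) (Jet π m) where
  atlas := range fun e : AdaptedChart π => e.jetChart m
  chartAt j := (π.adaptedChartAt j.base).jetChart m
  mem_chart_source j := π.mem_adaptedChartAt j.base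
  chart_mem_atlas j := ⟨_, rfl⟩
  open_source := by
    rintro _ _ ⟨e, rfl⟩ ⟨e', rfl⟩
    exact e.isOpen_jetTransition_source e' m
  continuousOn_toFun := by
    rintro _ _ ⟨e, rfl⟩ ⟨e', rfl⟩
    exact (e.contDiffOn_jetTransition e' m).continuousOn

instance (m : ℕ) : TopologicalSpace (Jet π m) := (jetCore π m).toTopologicalSpace

instance (m : ℕ) : ChartedSpace (JetModel n m) (Jet π m) := (jetCore π m).toChartedSpace

instance (m : ℕ) : IsManifold 𝓘(ℝ, JetModel n m) ∞ (Jet π m) := by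
  refine isManifold_of_contDiffOn _ _ _ fun f f' hf hf' => ?_
  simp only [atlas, ChartedSpace.atlas, mem_iUnion, mem_singleton_iff] at hf hf'
  obtain ⟨_, ⟨e, rfl⟩, rfl⟩ := hf
  obtain ⟨_, ⟨e', rfl⟩, rfl⟩ := hf'
  simp only [modelWithCornersSelf_coe, modelWithCornersSelf_coe_symm, Function.comp_id,
    Function.id_comp, preimage_id, range_id, inter_univ]
  exact e.contDiffOn_jetTransition e' m

/-- The natural coordinates of an adapted chart as a chart of the manifold `J^m π`. -/
def AdaptedChart.jetHomeo (e : AdaptedChart π) (m : ℕ) :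
    OpenPartialHomeomorph (Jet π m) (JetModel n m) :=
  (jetCore π m).openPartialHomeomorph (e.jetChart m) ⟨e, rfl⟩

theorem AdaptedChart.jetHomeo_mem (e : AdaptedChart π) (m : ℕ) :
    e.jetHomeo m ∈ IsManifold.maximalAtlas 𝓘(ℝ, JetModel n m) ∞ (Jet π m) := by
  refine IsManifold.subset_maximalAtlas ?_
  simp only [atlas, ChartedSpace.atlas, mem_iUnion, mem_singleton_iff]
  exact ⟨_, ⟨e, rfl⟩, rfl⟩

theorem AdaptedChart.jetChart_truncate (e : AdaptedChart π) {r s : ℕ} (h : r ≤ s) (j : Jet π s)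
    (hj : j.base ∈ e.toChart.source) :
    e.jetChart r (Jet.truncate h j) =
      ((e.jetChart s j).1, fun i => (e.jetChart s j).2 (Fin.castLE (by omega) i)) := by
  obtain ⟨σ, rfl⟩ : ∃ σ : PointedSection π, σ.jet s = j := ⟨j.rep, j.jet_rep⟩
  refine Prod.ext rfl (funext fun i => ?_)
  show e.sectionCoord (σ.jet r).rep i = e.sectionCoord (σ.jet s).rep i
  rw [e.sectionCoord_rep σ hj (Nat.le_of_lt_succ i.2), e.sectionCoord_rep σ hj (by omega)]

theorem Jet.contMDiff_truncate {r s : ℕ} (h : r ≤ s) :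
    ContMDiff 𝓘(ℝ, JetModel n s) 𝓘(ℝ, JetModel n r) ∞ (Jet.truncate h : Jet π s → Jet π r) := by
  intro j
  let e := π.adaptedChartAt j.base
  have hj : j.base ∈ e.toChart.source := π.mem_adaptedChartAt j.base
  let T : JetModel n s → JetModel n r := fun p => (p.1, fun i => p.2 (Fin.castLE (by omega) i))
  have hT : ContDiff ℝ ∞ T := by
    show ContDiff ℝ ∞ fun p : JetModel n s =>
      ((p.1, fun i => p.2 (Fin.castLE (by omega) i)) : JetModel n r)
    fun_prop
  have h1 : ContMDiffOn 𝓘(ℝ, JetModel n s) 𝓘(ℝ, JetModel n s) ∞ (e.jetHomeo s)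
      (e.jetHomeo s).source := contMDiffOn_of_mem_maximalAtlas (e.jetHomeo_mem s)
  have h2 : ContMDiffOn 𝓘(ℝ, JetModel n r) 𝓘(ℝ, JetModel n r) ∞ (e.jetHomeo r).symm
      (e.jetHomeo r).target := contMDiffOn_symm_of_mem_maximalAtlas (e.jetHomeo_mem r)
  have htr : ∀ y ∈ (e.jetHomeo s).source, T (e.jetHomeo s y) = e.jetHomeo r (Jet.truncate h y) :=
    fun y hy => (e.jetChart_truncate h y hy).symm
  have hsrc : ∀ y ∈ (e.jetHomeo s).source, Jet.truncate h y ∈ (e.jetHomeo r).source := by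
    intro y hy
    show (Jet.truncate h y).base ∈ e.toChart.source
    rw [Jet.base_truncate]
    exact hy
  have h3 := h2.comp (hT.contMDiff.comp_contMDiffOn h1) fun y hy => by
    show T (e.jetHomeo s y) ∈ (e.jetHomeo r).target
    rw [htr y hy]
    exact (e.jetHomeo r).map_source (hsrc y hy)
  refine (h3.congr fun y hy => ?_).contMDiffAt ((e.jetHomeo s).open_source.mem_nhds hj)
  show Jet.truncate h y = (e.jetHomeo r).symm (T (e.jetHomeo s y))
  rw [htr y hy, (e.jetHomeo r).left_inv (hsrc y hy)]

/-- The projection `π^s_r : J^s π → J^r π`. -/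
def jetProj (π : FibredManifold n E) {r s : ℕ} (h : r ≤ s) :
    C^∞⟮𝓘(ℝ, JetModel n s), Jet π s; 𝓘(ℝ, JetModel n r), Jet π r⟯ :=
  ⟨Jet.truncate h, Jet.contMDiff_truncate h⟩

end Manifold

end Jets

/-! ### Differential forms on manifolds -/

section Forms

variable {F : Type*} [NormedAddCommGroup F] [NormedSpace ℝ F] {H : Type*} [TopologicalSpace H]
  {F' : Type*} [NormedAddCommGroup F'] [NormedSpace ℝ F'] {H' : Type*} [TopologicalSpace H']

/-- Fields of linear forms on the tangent spaces (differential `1`-forms when smooth). -/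
abbrev OneForm (I : ModelWithCorners ℝ F H) (M : Type*) [TopologicalSpace M]
    [ChartedSpace H M] : Type _ :=
  ∀ x : M, TangentSpace I x →L[ℝ] ℝ

/-- Fields of bilinear forms on the tangent spaces (differential `2`-forms when smooth and
alternating). -/
abbrev TwoForm (I : ModelWithCorners ℝ F H) (M : Type*) [TopologicalSpace M]
    [ChartedSpace H M] : Type _ :=
  ∀ x : M, TangentSpace I x →L[ℝ] TangentSpace I x →L[ℝ] ℝ

variable {I : ModelWithCorners ℝ F H} {I' : ModelWithCorners ℝ F' H'}
  {M : Type*} [TopologicalSpace M] [ChartedSpace H M]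
  {M' : Type*} [TopologicalSpace M'] [ChartedSpace H' M']

/-- The expression of a `1`-form in the preferred chart at `x`, as a form on the model space. -/
def OneForm.inChart (θ : OneForm I M) (x : M) (z : F) : F →L[ℝ] ℝ :=
  (θ ((extChartAt I x).symm z)).comp (mfderiv 𝓘(ℝ, F) I (extChartAt I x).symm z)

/-- The exterior derivative of a `1`-form on a manifold without boundary: in the preferred chart at
`x` it is `dθ (u, v) = (D_u θ) v - (D_v θ) u`. -/
def OneForm.extDeriv (θ : OneForm I M) : TwoForm I M := fun x =>
  let A : F →L[ℝ] F := mfderiv I 𝓘(ℝ, F) (extChartAt I x) x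
  let D : F →L[ℝ] F →L[ℝ] ℝ := fderiv ℝ (θ.inChart x) (extChartAt I x x)
  show F →L[ℝ] F →L[ℝ] ℝ from (D - D.flip).bilinearComp A A

/-- The pullback `f^* θ` of a `1`-form. -/
def OneForm.pullback (f : M → M') (θ : OneForm I' M') : OneForm I M := fun x =>
  (θ (f x)).comp (mfderiv I I' f x)

/-- The pullback `f^* Ω` of a `2`-form. -/
def TwoForm.pullback (f : M → M') (Ω : TwoForm I' M') : TwoForm I M := fun x =>
  let A : F →L[ℝ] F' := mfderiv I I' f x
  let B : F' →L[ℝ] F' →L[ℝ] ℝ := Ω (f x)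
  show F →L[ℝ] F →L[ℝ] ℝ from B.bilinearComp A A

/-- The contraction `i(Y) Ω`. -/
def TwoForm.interior (Y : ∀ x : M, TangentSpace I x) (Ω : TwoForm I M) : OneForm I M :=
  fun x => Ω x (Y x)

end Forms

/-! ### The unified bundle -/

section Unified

variable {n : ℕ} {E : Type*} [TopologicalSpace E]
  [ChartedSpace (EuclideanSpace ℝ (Fin (n + 1))) E] [IsManifold (𝓡 (n + 1)) ∞ E]

/-- The cotangent space of `J^m π` at `j`. -/
abbrev JetCotangentSpace (π : FibredManifold n E) (m : ℕ) (j : Jet π m) : Type :=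
  TangentSpace 𝓘(ℝ, JetModel n m) j →L[ℝ] Bundle.Trivial (Jet π m) ℝ j

/-- The cotangent bundle `T^*(J^m π)`. -/
abbrev JetCotangent (π : FibredManifold n E) (m : ℕ) : Type _ :=
  Bundle.TotalSpace (JetModel n m →L[ℝ] ℝ) (JetCotangentSpace π m)

/-- The model with corners of `T^*(J^m π)`. -/
abbrev cotangentModel (n m : ℕ) :
    ModelWithCorners ℝ (JetModel n m × (JetModel n m →L[ℝ] ℝ))
      (ModelProd (JetModel n m) (JetModel n m →L[ℝ] ℝ)) :=
  𝓘(ℝ, JetModel n m).prod 𝓘(ℝ, JetModel n m →L[ℝ] ℝ)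

/-- The extended jet-momentum bundle `W = J^{2k-1} π ×_{J^{k-1} π} T^*(J^{k-1} π)`, as the pullback
of the cotangent bundle along the projection. -/
abbrev Unified (π : FibredManifold n E) (k : ℕ) : Type _ :=
  Bundle.TotalSpace (JetModel n (k - 1) →L[ℝ] ℝ)
    (Bundle.Pullback (jetProj π (show k - 1 ≤ 2 * k - 1 by omega)) (JetCotangentSpace π (k - 1)))

/-- The model with corners of `W`. -/
abbrev unifiedModel (n k : ℕ) :
    ModelWithCorners ℝ (JetModel n (2 * k - 1) × (JetModel n (k - 1) →L[ℝ] ℝ))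
      (ModelProd (JetModel n (2 * k - 1)) (JetModel n (k - 1) →L[ℝ] ℝ)) :=
  𝓘(ℝ, JetModel n (2 * k - 1)).prod 𝓘(ℝ, JetModel n (k - 1) →L[ℝ] ℝ)

variable {π : FibredManifold n E} {k : ℕ}

/-- The projection `ρ_1 : W → J^{2k-1} π`. -/
def Unified.rho₁ (w : Unified π k) : Jet π (2 * k - 1) := w.proj

/-- The projection `ρ_2 : W → T^*(J^{k-1} π)`. -/
def Unified.rho₂ (w : Unified π k) : JetCotangent π (k - 1) :=
  Bundle.Pullback.lift (jetProj π (show k - 1 ≤ 2 * k - 1 by omega)) w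

/-- The tautological `1`-form `Θ_m` of `T^*(J^m π)`. -/
def tautologicalForm (π : FibredManifold n E) (m : ℕ) :
    OneForm (cotangentModel n m) (JetCotangent π m) := fun a =>
  let α : TangentSpace 𝓘(ℝ, JetModel n m) a.proj →L[ℝ] ℝ := a.snd
  α.comp (mfderiv (cotangentModel n m) 𝓘(ℝ, JetModel n m)
    (Bundle.TotalSpace.proj : JetCotangent π m → Jet π m) a)

/-- The canonical symplectic form `Ω_m = -dΘ_m` of `T^*(J^m π)`. -/
def symplecticForm (π : FibredManifold n E) (m : ℕ) :
    TwoForm (cotangentModel n m) (JetCotangent π m) := fun a =>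
  -(tautologicalForm π m).extDeriv a

/-- The presymplectic form `Ω = ρ_2^* Ω_{k-1}` of `W`. -/
def unifiedForm (π : FibredManifold n E) (k : ℕ) : TwoForm (unifiedModel n k) (Unified π k) :=
  (symplecticForm π (k - 1)).pullback Unified.rho₂

/-- The coupling function `Ĉ`: at `(y, α)`, with `y = j^{2k-1}_t φ`, it is `α` applied to the
velocity at `t` of the curve `j^{k-1} φ`; the coupling form is `Ĉ dt`. -/
def couplingFunction (w : Unified π k) : ℝ :=
  let α : JetModel n (k - 1) →L[ℝ] ℝ := w.snd
  α (mfderiv 𝓘(ℝ, ℝ) 𝓘(ℝ, JetModel n (k - 1)) (w.rho₁.rep.prolong (k - 1)) w.rho₁.time (1 : ℝ))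

/-- The constraint function `Ĉ - L̂`, where `L̂` is the pullback of `L` to `W`. -/
def constraint (hk : 1 ≤ k) (L : Jet π k → ℝ) (w : Unified π k) : ℝ :=
  couplingFunction w - L (jetProj π (show k ≤ 2 * k - 1 by omega) w.rho₁)

/-- The Hamiltonian submanifold `W_o ⊆ W`. -/
def hamiltonianSubmanifold (hk : 1 ≤ k) (L : Jet π k → ℝ) : Set (Unified π k) :=
  {w | constraint hk L w = 0}

/-- Smooth vector fields on `W_o`: smooth on `W_o` and tangent to it, i.e. annihilated at every point
of `W_o` by the differential of the constraint function. The values off `W_o` are irrelevant. -/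
def IsVectorFieldOnHamiltonian (hk : 1 ≤ k) (L : Jet π k → ℝ)
    (Y : ∀ w : Unified π k, TangentSpace (unifiedModel n k) w) : Prop :=
  ContMDiffOn (unifiedModel n k) (unifiedModel n k).tangent ∞
      (fun w => (⟨w, Y w⟩ : TangentBundle (unifiedModel n k) (Unified π k)))
      (hamiltonianSubmanifold hk L) ∧
    ∀ w ∈ hamiltonianSubmanifold hk L,
      mfderiv (unifiedModel n k) 𝓘(ℝ, ℝ) (constraint hk L) w (Y w) = 0

/-- Smooth vector fields on `J^m π`. -/
def IsJetVectorField {m : ℕ} (Y : ∀ y : Jet π m, TangentSpace 𝓘(ℝ, JetModel n m) y) : Prop :=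
  ContMDiff 𝓘(ℝ, JetModel n m) 𝓘(ℝ, JetModel n m).tangent ∞
    (fun y => (⟨y, Y y⟩ : TangentBundle 𝓘(ℝ, JetModel n m) (Jet π m)))

/-- Sections of `J^m π → ℝ`. -/
def IsJetSection {m : ℕ} (ψ : ℝ → Jet π m) : Prop :=
  ContMDiff 𝓘(ℝ, ℝ) 𝓘(ℝ, JetModel n m) ∞ ψ ∧ ∀ t, (ψ t).time = t

/-- A section of `J^m π → ℝ` is holonomic if it is the prolongation `j^m φ` of the (global) section
`φ` of `π` under it. -/
def IsHolonomic {m : ℕ} (ψ : ℝ → Jet π m) : Prop :=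
  ∃ φ : PointedSection π, φ.dom = univ ∧ (∀ t, φ.toFun t = (ψ t).base) ∧
    ∀ t, φ.prolong m t = ψ t

/-- Sections of `W_o → ℝ`. -/
def IsHamiltonianSection (hk : 1 ≤ k) (L : Jet π k → ℝ) (ψ : ℝ → Unified π k) : Prop :=
  ContMDiff 𝓘(ℝ, ℝ) (unifiedModel n k) ∞ ψ ∧ (∀ t, ψ t ∈ hamiltonianSubmanifold hk L) ∧
    ∀ t, (ψ t).rho₁.time = t

/-- A section of `W_o → ℝ` is holonomic if its image in `J^{2k-1} π` is holonomic. -/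
def IsHolonomicInUnified (ψ : ℝ → Unified π k) : Prop :=
  IsHolonomic fun t => (ψ t).rho₁

/-- The unified equation for sections, `ψ^* i(Y) Ω_o = 0` for every vector field `Y` on `W_o`, where
`Ω_o` is the restriction of `Ω` to `W_o`. -/
def SolvesUnifiedEquation (hk : 1 ≤ k) (L : Jet π k → ℝ) (ψ : ℝ → Unified π k) : Prop :=
  ∀ Y : ∀ w : Unified π k, TangentSpace (unifiedModel n k) w,
    IsVectorFieldOnHamiltonian hk L Y →
      (((unifiedForm π k).interior Y).pullback ψ : OneForm 𝓘(ℝ, ℝ) ℝ) = fun _ => 0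

/-! ### The Legendre-Ostrogradsky map and the Poincaré-Cartan form -/

/-- The partial derivative `∂L/∂q_r` in the natural coordinates of an adapted chart, as a linear form
on the fibre model: its components are the `∂L/∂q_r^A`. -/
def AdaptedChart.partialDeriv (e : AdaptedChart π) {m : ℕ} (L : Jet π m → ℝ) (r : Fin (m + 1))
    (j : Jet π m) : FibreModel n →L[ℝ] ℝ :=
  ((fderiv ℝ (fun p => L ((e.jetChart m).symm p)) (e.jetChart m j)).comp
    (ContinuousLinearMap.inr ℝ ℝ (Fin (m + 1) → FibreModel n))).comp
      (ContinuousLinearMap.single ℝ (fun _ : Fin (m + 1) => FibreModel n) r)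

/-- The iterated total time derivative `d_T^i f` of a function `f` on `J^m π`, at
`y = j^s_t φ` with `m + i ≤ s`: the `i`-th derivative at `t` of `f ∘ j^m φ`. -/
def totalTimeDeriv {G : Type*} [NormedAddCommGroup G] [NormedSpace ℝ G] {m s : ℕ} (i : ℕ)
    (f : Jet π m → G) (y : Jet π s) : G :=
  iteratedDeriv i (fun τ => f (y.rep.prolong m τ)) y.time

/-- The momenta `p^r = ∑_{i = 0}^{k - 1 - r} (-1)^i d_T^i (∂L/∂q_{r + 1 + i})`, for
`0 ≤ r ≤ k - 1`, on `J^{2k-1} π`. -/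
def AdaptedChart.momentum (e : AdaptedChart π) (L : Jet π k → ℝ)
    (r : Fin (k - 1 + 1)) (y : Jet π (2 * k - 1)) : FibreModel n →L[ℝ] ℝ :=
  ∑ i : Fin (k - r), (-1 : ℝ) ^ (i : ℕ) •
    totalTimeDeriv i (e.partialDeriv L ⟨r + 1 + i, by omega⟩) y

/-- The component `p = L - ∑_r p^r(q_{r + 1})` of the extended Legendre-Ostrogradsky map. -/
def AdaptedChart.energyMomentum (e : AdaptedChart π) (hk : 1 ≤ k) (L : Jet π k → ℝ)
    (y : Jet π (2 * k - 1)) : ℝ :=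
  L (jetProj π (show k ≤ 2 * k - 1 by omega) y) -
    ∑ r : Fin (k - 1 + 1), e.momentum L r y
      ((e.jetChart (2 * k - 1) y).2 ⟨r + 1, by omega⟩)

/-- The covector `p dt + ∑_r p^r dq_r` on the model space of `J^{k-1} π`. -/
def AdaptedChart.legendreCovector (e : AdaptedChart π) (hk : 1 ≤ k) (L : Jet π k → ℝ)
    (y : Jet π (2 * k - 1)) : JetModel n (k - 1) →L[ℝ] ℝ :=
  e.energyMomentum hk L y •
      ContinuousLinearMap.fst ℝ ℝ (Fin (k - 1 + 1) → FibreModel n) +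
    ∑ r : Fin (k - 1 + 1), (e.momentum L r y).comp
      ((ContinuousLinearMap.proj (R := ℝ) (φ := fun _ : Fin (k - 1 + 1) => FibreModel n) r).comp
        (ContinuousLinearMap.snd ℝ ℝ (Fin (k - 1 + 1) → FibreModel n)))

/-- The extended Legendre-Ostrogradsky map `J^{2k-1} π → T^*(J^{k-1} π)`. At each point its
coordinate expression is used in an adapted chart around that point; the resulting covector does not
depend on the adapted chart. -/
def extendedLegendre (hk : 1 ≤ k) (L : Jet π k → ℝ) (y : Jet π (2 * k - 1)) :
    JetCotangent π (k - 1) :=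
  ⟨jetProj π (show k - 1 ≤ 2 * k - 1 by omega) y,
    ((π.adaptedChartAt y.base).legendreCovector hk L y).comp
      (mfderiv 𝓘(ℝ, JetModel n (k - 1)) 𝓘(ℝ, JetModel n (k - 1))
        ((π.adaptedChartAt y.base).jetChart (k - 1))
        (jetProj π (show k - 1 ≤ 2 * k - 1 by omega) y))⟩

/-- The Poincaré-Cartan `2`-form `Ω_L`, the pullback of the canonical symplectic form
`Ω_{k-1} = -dΘ_{k-1}` by the extended Legendre-Ostrogradsky map. -/
def poincareCartanForm (hk : 1 ≤ k) (L : Jet π k → ℝ) :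
    TwoForm 𝓘(ℝ, JetModel n (2 * k - 1)) (Jet π (2 * k - 1)) :=
  (symplecticForm π (k - 1)).pullback (extendedLegendre hk L)

/-- The Lagrangian equation for sections, `ψ^* i(Y) Ω_L = 0` for every vector field `Y` on
`J^{2k-1} π`. -/
def SolvesLagrangianEquation (hk : 1 ≤ k) (L : Jet π k → ℝ) (ψ : ℝ → Jet π (2 * k - 1)) : Prop :=
  ∀ Y : ∀ y : Jet π (2 * k - 1), TangentSpace 𝓘(ℝ, JetModel n (2 * k - 1)) y,
    IsJetVectorField Y →
      (((poincareCartanForm hk L).interior Y).pullback ψ : OneForm 𝓘(ℝ, ℝ) ℝ) = fun _ => 0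

end Unified

end HigherOrderMechanics

end

open HigherOrderMechanics

/-! In natural coordinates let `c = p + ∑ p^i q_{i+1} - L` be the constraint. Since `∂c/∂p = 1`, any
tangent vector `X` of `W` becomes tangent to `W_o` after subtracting `dc(X) ∂/∂p`. Along a holonomic
section `Ω(∂/∂p, ψ') = -1`, so the equation on `W_o`, tested only on tangent fields, yields
Hamilton's equations `dc(X) = -Ω(X, ψ')` for every `X`
(`SolvesUnifiedEquation.fderiv_localConstraint`).

Applied to prolonged vertical variations `v`, they say that `∑_{r<k} p^r v^{(r)}` has time
derivative `∑_{r≤k} (∂L/∂q_r) v^{(r)}`. By integration by parts the Ostrogradsky momenta satisfy the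
same identity up to the Euler-Lagrange term, which involves `v` but none of its derivatives
(`hasDerivAt_ostrogradsky_pairing`). The difference of the two families is a differential operator
of order below `k` whose total derivative has order zero; comparing coefficients from the top order
down, it vanishes (`eventually_eq_zero_of_deriv_pairing`). Hence the `p^r` are the Ostrogradsky
momenta, and the constraint fixes `p`: the solution lies in the graph of the extended Legendre map
(`SolvesUnifiedEquation.momentumAlong_eq_legendreCovector`).

That graph is contained in `W_o`, so `dc` kills its tangent vectors
(`HasFDerivAt.fderiv_graph_eq_zero`). Hamilton's equations on such vectors reduce to `Ω(X, ψ') = 0`,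
and `Ω` restricted to the graph is the Poincaré-Cartan form; this is the Lagrangian equation.

Two global points need care. Hamilton's equations are obtained at each time in the preferred chart
there, whereas comparing coefficients requires one chart on an interval of times. The prolongation
of a vertical variation transforms naturally (`AdaptedChart.fderiv_jetTransition_verticalJet`),
which makes the first variation formula independent of the chart; with the same uniqueness argument
it shows that the coordinate Legendre covectors agree
(`AdaptedChart.legendreCovector_jetTransition`), so the extended Legendre map is smooth. Secondly, a
tangent vector of `W_o` must extend to a global field; a bump function on the Hausdorff manifold
`E`, pulled back to `W`, does this. -/

noncomputable section

namespace HigherOrderMechanics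

/-! ### Iterated derivatives and Ostrogradsky momenta along a curve -/

section Ostrogradsky

section IteratedDerivatives

variable {X Y : Type*} [NormedAddCommGroup X] [NormedSpace ℝ X]
  [NormedAddCommGroup Y] [NormedSpace ℝ Y]

theorem contDiffAt_iteratedDeriv (i : ℕ) {f : ℝ → Y} {t : ℝ} (hf : ContDiffAt ℝ ∞ f t) :
    ContDiffAt ℝ ∞ (iteratedDeriv i f) t := by
  induction i with
  | zero => simpa using hf
  | succ i ih => rw [iteratedDeriv_succ]; exact contDiffAt_deriv ih

theorem iteratedDeriv_iteratedDeriv (i j : ℕ) (f : ℝ → Y) :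
    iteratedDeriv i (iteratedDeriv j f) = iteratedDeriv (i + j) f := by
  simp only [iteratedDeriv_eq_iterate, Function.iterate_add_apply]

theorem hasDerivAt_iteratedDeriv (i : ℕ) {f : ℝ → Y} {t : ℝ} (hf : ContDiffAt ℝ ∞ f t) :
    HasDerivAt (iteratedDeriv i f) (iteratedDeriv (i + 1) f t) t := by
  rw [iteratedDeriv_succ]
  exact ((contDiffAt_iteratedDeriv i hf).differentiableAt (by simp)).hasDerivAt

theorem iteratedDeriv_pi_eq {ι : Type*} [Fintype ι] {t : ℝ} (i : ℕ) :
    ∀ {f : ι → ℝ → Y}, (∀ a, ContDiffAt ℝ ∞ (f a) t) →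
      iteratedDeriv i (fun s a => f a s) t = fun a => iteratedDeriv i (f a) t := by
  induction i with
  | zero => intros; simp
  | succ i ih =>
    intro f hf
    have h : deriv (fun s a => f a s) =ᶠ[𝓝 t] fun s a => deriv (f a) s := by
      filter_upwards [eventually_all.2 fun a => eventually_differentiableAt (hf a)] with s hs
      exact (hasDerivAt_pi.2 fun a => (hs a).hasDerivAt).deriv
    rw [iteratedDeriv_succ', h.iteratedDeriv_eq, ih fun a => contDiffAt_deriv (hf a)]
    simp only [iteratedDeriv_succ']

/-- Differentiation with respect to a parameter commutes with iterated derivatives. -/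
theorem fderiv_iteratedDeriv_swap {U : Set (X × ℝ)} (hU : IsOpen U) (i : ℕ) :
    ∀ {H : X × ℝ → Y}, ContDiffOn ℝ ∞ H U → ∀ {z : X} {s : ℝ}, (z, s) ∈ U → ∀ w : X,
      fderiv ℝ (fun p : X × ℝ => iteratedDeriv i (fun σ => H (p.1, σ)) p.2) (z, s) (w, 0) =
        iteratedDeriv i (fun σ => fderiv ℝ H (z, σ) (w, 0)) s := by
  induction i with
  | zero => intro H _ z s _ w; simp
  | succ i ih =>
    intro H hH z s hz w
    have h1 : ContDiffOn ℝ ∞ (fun p => fderiv ℝ H p (0, 1)) U :=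
      (hH.fderiv_of_isOpen hU (by simp)).clm_apply contDiffOn_const
    have hline : ∀ (G : X × ℝ → Y) (p : X × ℝ), DifferentiableAt ℝ G p →
        deriv (fun σ => G (p.1, σ)) p.2 = fderiv ℝ G p (0, 1) := fun G p hG =>
      (hG.hasFDerivAt.comp_hasDerivAt p.2
        ((hasDerivAt_const p.2 p.1).prodMk (hasDerivAt_id p.2))).deriv
    have hcurve : ∀ {q : X × ℝ}, q ∈ U → ∀ᶠ σ in 𝓝 q.2, (q.1, σ) ∈ U := fun {q} hq =>
      (show ContinuousAt (fun s : ℝ => (q.1, s)) q.2 by fun_prop).eventually (hU.mem_nhds hq)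
    have e1 : (fun p : X × ℝ => iteratedDeriv (i + 1) (fun σ => H (p.1, σ)) p.2) =ᶠ[𝓝 (z, s)]
        fun p => iteratedDeriv i (fun σ => fderiv ℝ H (p.1, σ) (0, 1)) p.2 := by
      filter_upwards [hU.mem_nhds hz] with p hp
      rw [iteratedDeriv_succ']
      apply Filter.EventuallyEq.iteratedDeriv_eq
      filter_upwards [hcurve hp] with σ hσ
      exact hline H (p.1, σ) ((hH.contDiffAt (hU.mem_nhds hσ)).differentiableAt (by simp))
    rw [e1.fderiv_eq, ih h1 hz w, iteratedDeriv_succ']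
    apply Filter.EventuallyEq.iteratedDeriv_eq
    filter_upwards [hcurve hz] with σ hσ
    have hc : ContDiffAt ℝ ∞ H (z, σ) := hH.contDiffAt (hU.mem_nhds hσ)
    have hd : DifferentiableAt ℝ (fderiv ℝ H) (z, σ) :=
      (hc.fderiv_right (m := ∞) (by simp)).differentiableAt (by simp)
    -- After the induction hypothesis for `∂H/∂s`, only the equality of the mixed second derivatives
    -- of `H` remains.
    have hsym : IsSymmSndFDerivAt ℝ H (z, σ) :=
      hc.isSymmSndFDerivAt (by simp; norm_cast)
    rw [hline (fun p => fderiv ℝ H p (w, 0)) (z, σ) (hd.clm_apply (differentiableAt_const _)),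
      fderiv_clm_apply hd (differentiableAt_const _), fderiv_clm_apply hd (differentiableAt_const _)]
    simpa using hsym.eq (w, 0) (0, 1)

end IteratedDerivatives

section Ostrogradsky

variable {V : Type*} [NormedAddCommGroup V] [NormedSpace ℝ V]

/-- The Ostrogradsky momenta `∑_{i < k - r} (-1)^i (d/dt)^i A_{r+1+i}` of a family of covector
curves. -/
def ostrogradskySum {G : Type*} [NormedAddCommGroup G] [NormedSpace ℝ G]
    (A : ℕ → ℝ → G) (k r : ℕ) (s : ℝ) : G :=
  ∑ i ∈ Finset.range (k - r), (-1 : ℝ) ^ i • iteratedDeriv i (A (r + 1 + i)) s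

variable {G : Type*} [NormedAddCommGroup G] [NormedSpace ℝ G]

theorem contDiffAt_ostrogradskySum {A : ℕ → ℝ → G} {k : ℕ} {t : ℝ}
    (hA : ∀ j ≤ k, ContDiffAt ℝ ∞ (A j) t) (r : ℕ) : ContDiffAt ℝ ∞ (ostrogradskySum A k r) t := by
  unfold ostrogradskySum
  refine ContDiffAt.sum fun i hi => ContDiffAt.const_smul _ (contDiffAt_iteratedDeriv i (hA _ ?_))
  have := Finset.mem_range.1 hi
  omega

/-- This is the recursion `P_r = A_{r+1} - P_{r+1}'`: differentiating `P_{r+1}` raises each order by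
one and so reproduces, with opposite sign, the terms of `P_r` of positive index. -/
theorem hasDerivAt_ostrogradskySum {A : ℕ → ℝ → G} {k : ℕ} {t : ℝ}
    (hA : ∀ j ≤ k, ContDiffAt ℝ ∞ (A j) t) {r : ℕ} (hr : r + 1 ≤ k) :
    HasDerivAt (ostrogradskySum A k (r + 1)) (A (r + 1) t - ostrogradskySum A k r t) t := by
  have h : HasDerivAt (ostrogradskySum A k (r + 1))
      (∑ i ∈ Finset.range (k - (r + 1)), (-1 : ℝ) ^ i • iteratedDeriv (i + 1) (A (r + 1 + 1 + i)) t)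
      t := by
    refine HasDerivAt.fun_sum fun i hi => HasDerivAt.const_smul _ (hasDerivAt_iteratedDeriv i (hA _ ?_))
    have := Finset.mem_range.1 hi
    omega
  convert h using 1
  -- The term `i = 0` of `P_r` is `A_{r+1}` and cancels; the others match after the shift `i ↦ i +
  -- 1`.
  rw [ostrogradskySum, show k - r = k - (r + 1) + 1 by omega, Finset.sum_range_succ']
  simp only [pow_zero, iteratedDeriv_zero, one_smul, add_zero, pow_succ, mul_neg, mul_one, neg_smul,
    Finset.sum_neg_distrib, sub_add_cancel_right, neg_neg]
  exact Finset.sum_congr rfl fun i _ => by rw [add_right_comm (r + 1) 1 i, add_assoc (r + 1) i 1]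

/-- The first variation formula: integration by parts along a curve. -/
theorem hasDerivAt_ostrogradsky_pairing {A : ℕ → ℝ → V →L[ℝ] ℝ} {k : ℕ} {t : ℝ} {v : ℝ → V}
    (hA : ∀ j ≤ k, ContDiffAt ℝ ∞ (A j) t) (hv : ContDiffAt ℝ ∞ v t) :
    HasDerivAt (fun s => ∑ r ∈ Finset.range k, ostrogradskySum A k r s (iteratedDeriv r v s))
      (∑ r ∈ Finset.range (k + 1), A r t (iteratedDeriv r v t) -
        (A 0 t - deriv (ostrogradskySum A k 0) t) (v t)) t := by
  have h : HasDerivAt (fun s => ∑ r ∈ Finset.range k, ostrogradskySum A k r s (iteratedDeriv r v s))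
      (∑ r ∈ Finset.range k, (deriv (ostrogradskySum A k r) t (iteratedDeriv r v t) +
        ostrogradskySum A k r t (iteratedDeriv (r + 1) v t))) t :=
    HasDerivAt.fun_sum fun r _ =>
      ((contDiffAt_ostrogradskySum hA r).differentiableAt (by simp)).hasDerivAt.clm_apply
        (hasDerivAt_iteratedDeriv r hv)
  convert h using 1
  -- The recursion closes at the top order because `P_k` is an empty sum.
  have hk : ostrogradskySum A k k = 0 := by
    ext; simp [ostrogradskySum]
  have hP : ∀ r ∈ Finset.range k, ostrogradskySum A k r t (iteratedDeriv (r + 1) v t) =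
      A (r + 1) t (iteratedDeriv (r + 1) v t) -
        deriv (ostrogradskySum A k (r + 1)) t (iteratedDeriv (r + 1) v t) := by
    intro r hr
    rw [(hasDerivAt_ostrogradskySum hA (Finset.mem_range.1 hr)).deriv]
    simp
  have hz : deriv (ostrogradskySum A k k) t (iteratedDeriv k v t) = 0 := by
    rw [hk]; simp
  -- The terms `P_r' v^{(r)}` telescope between `r = 0` and `r = k`, leaving only `P_0' v`.
  have htel := Finset.sum_range_sub
    (fun r => deriv (ostrogradskySum A k r) t (iteratedDeriv r v t)) k
  rw [Finset.sum_add_distrib, Finset.sum_congr rfl hP, Finset.sum_range_succ', Finset.sum_sub_distrib]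
  rw [Finset.sum_sub_distrib] at htel
  simp only [iteratedDeriv_zero, sub_apply] at *
  linarith

theorem iteratedDeriv_taylorCurve_of_le {m : ℕ} (t : ℝ) (q : Fin (m + 1) → V) {j : ℕ} (hj : j ≤ m) :
    iteratedDeriv j (taylorCurve t q) t = q ⟨j, Nat.lt_succ_of_le hj⟩ :=
  iteratedDeriv_taylorCurve t q ⟨j, Nat.lt_succ_of_le hj⟩

theorem contDiff_taylorCurve_right {m : ℕ} (t : ℝ) (q : Fin (m + 1) → V) :
    ContDiff ℝ ∞ (taylorCurve t q) :=
  contDiff_taylorCurve.comp (contDiff_prodMk_right (t, q))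

/-- A linear differential operator of order `< k` whose total derivative has order `0`
vanishes. -/
theorem eventually_eq_zero_of_deriv_pairing {D : ℕ → ℝ → V →L[ℝ] ℝ} {k : ℕ} {t : ℝ}
    (hD : ∀ r < k, ContDiffAt ℝ ∞ (D r) t) (F : ℝ → V →L[ℝ] ℝ)
    (h : ∀ᶠ s in 𝓝 t, ∀ v : Fin (k + 1) → V,
      deriv (fun σ => ∑ r ∈ Finset.range k, D r σ (iteratedDeriv r (taylorCurve s v) σ)) s =
        F s (v 0)) {r : ℕ} (hr : r < k) :
    ∀ᶠ s in 𝓝 t, D r s = 0 := by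
  have hd : ∀ᶠ s in 𝓝 t, ∀ r : Fin k, DifferentiableAt ℝ (D r) s :=
    eventually_all.2 fun r => eventually_differentiableAt (hD r r.2)
  -- A Taylor polynomial centred at `s` itself has arbitrary derivatives `v 0, …, v k` at `s`, so
  -- the Leibniz rule turns the hypothesis into an identity in free vectors.
  have key : ∀ᶠ s in 𝓝 t, ∀ v : Fin (k + 1) → V,
      ∑ r : Fin k, (deriv (D r) s (v r.castSucc) + D r s (v r.succ)) = F s (v 0) := by
    filter_upwards [h, hd] with s hs hds v
    rw [← hs v]
    simp_rw [Finset.sum_range]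
    refine (HasDerivAt.deriv ?_).symm
    refine HasDerivAt.fun_sum fun r _ => ?_
    have h1 := (hds r).hasDerivAt.clm_apply
      (hasDerivAt_iteratedDeriv r (contDiff_taylorCurve_right s v).contDiffAt)
    rwa [iteratedDeriv_taylorCurve_of_le s v r.2.le, iteratedDeriv_taylorCurve_of_le s v r.2] at h1
  -- Descending induction on `r`, written as induction on the distance `d` to the top index `k - 1`.
  obtain ⟨d, hd'⟩ : ∃ d, r + 1 + d = k := ⟨k - (r + 1), by omega⟩
  induction d using Nat.strong_induction_on generalizing r with
  | _ d ih =>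
    -- Vanishing on a neighbourhood, rather than at a point, is what makes the derivative of `D (r +
    -- 1)` vanish too.
    have hnext : ∀ᶠ s in 𝓝 t, ∀ hlt : r + 1 < k, deriv (D (r + 1)) s = 0 := by
      by_cases hlt : r + 1 < k
      · have := ih (d - 1) (by omega) hlt (by omega)
        filter_upwards [this.eventually_nhds] with s hs _
        have hz : D (r + 1) =ᶠ[𝓝 s] fun _ => 0 := hs
        rw [hz.deriv_eq]
        simp
      · exact Eventually.of_forall fun _ hh => absurd hh hlt
    filter_upwards [key, hnext] with s hs hn
    ext x
    -- Reads off the coefficient of `v^{(r+1)}`, which is `D_r + D_{r+1}'`. The right-hand side sees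
    -- only `v 0`, which is zero for this choice.
    have h1 := hs (Pi.single (⟨r, hr⟩ : Fin k).succ x)
    rw [Finset.sum_add_distrib, Finset.sum_eq_zero, zero_add, Finset.sum_eq_single ⟨r, hr⟩,
      Pi.single_eq_same, Pi.single_eq_of_ne (Fin.succ_ne_zero _).symm, map_zero] at h1
    · exact h1
    · intro c _ hc
      rw [Pi.single_eq_of_ne (fun h => hc (Fin.succ_injective _ h)), map_zero]
    · simp
    · intro c _
      by_cases hc : c.castSucc = Fin.succ ⟨r, hr⟩
      · have hcr : (c : ℕ) = r + 1 := by simpa [Fin.ext_iff] using hc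
        rw [hcr, hn (hcr ▸ c.2)]
        rfl
      · rw [Pi.single_eq_of_ne hc, map_zero]

end Ostrogradsky

end Ostrogradsky

/-! ### Prolongations of sections in natural coordinates and total time derivatives -/

section CurvesOfJets

section CurveJets

variable {n : ℕ}

/-- The curve `s ↦ (s, q(s), q'(s), …, q^{(m)}(s))` of jets of a curve in the fibre model. -/
def curveJet (m : ℕ) (q : ℝ → FibreModel n) (s : ℝ) : JetModel n m :=
  (s, fun i => iteratedDeriv i q s)

theorem contDiffAt_curveJet (m : ℕ) {q : ℝ → FibreModel n} {t : ℝ} (hq : ContDiffAt ℝ ∞ q t) :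
    ContDiffAt ℝ ∞ (curveJet m q) t :=
  contDiffAt_id.prodMk (contDiffAt_pi.2 fun i => contDiffAt_iteratedDeriv i hq)

/-- The velocity `(1, q'(s), …, q^{(m+1)}(s))` of the curve of jets of a curve in the fibre
model. -/
def velocityJet (m : ℕ) (q : ℝ → FibreModel n) (s : ℝ) : JetModel n m :=
  (1, fun i => iteratedDeriv (i + 1) q s)

theorem hasDerivAt_curveJet (m : ℕ) {q : ℝ → FibreModel n} {t : ℝ} (hq : ContDiffAt ℝ ∞ q t) :
    HasDerivAt (curveJet m q) (velocityJet m q t) t :=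
  (hasDerivAt_id t).prodMk (hasDerivAt_pi.2 fun i => hasDerivAt_iteratedDeriv i hq)

/-- The `i`-th derivative of a curve of `m`-jets consists of the derivatives of `q` of orders `i, …,
i + m`, besides the time component. -/
theorem iteratedDeriv_curveJet_congr {m i : ℕ} {q r : ℝ → FibreModel n} {t : ℝ}
    (hq : ContDiffAt ℝ ∞ q t) (hr : ContDiffAt ℝ ∞ r t)
    (h : ∀ j ≤ m + i, iteratedDeriv j q t = iteratedDeriv j r t) :
    iteratedDeriv i (curveJet m q) t = iteratedDeriv i (curveJet m r) t := by
  have key : ∀ {q : ℝ → FibreModel n}, ContDiffAt ℝ ∞ q t → iteratedDeriv i (curveJet m q) t =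
      (iteratedDeriv i (fun s : ℝ => s) t, fun a : Fin (m + 1) => iteratedDeriv (i + a) q t) := by
    intro q hq
    unfold curveJet
    rw [iteratedDeriv_prodMk_eq i (a := fun s : ℝ => s) contDiffAt_id
      (contDiffAt_pi.2 fun a : Fin (m + 1) => contDiffAt_iteratedDeriv a hq),
      iteratedDeriv_pi_eq i fun a : Fin (m + 1) => contDiffAt_iteratedDeriv a hq]
    simp only [iteratedDeriv_iteratedDeriv]
  rw [key hq, key hr]
  exact Prod.ext rfl (funext fun a => h _ (by omega))

end CurveJets

variable {n : ℕ} {E : Type*} [TopologicalSpace E]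
  [ChartedSpace (EuclideanSpace ℝ (Fin (n + 1))) E] {π : FibredManifold n E}

section Sections

theorem PointedSection.prolong_of_mem (φ : PointedSection π) (m : ℕ) {s : ℝ} (hs : s ∈ φ.dom) :
    φ.prolong m s = (φ.moveTo s hs).jet m := dif_pos hs

theorem PointedSection.prolong_pt (φ : PointedSection π) (m : ℕ) : φ.prolong m φ.pt = φ.jet m :=
  φ.prolong_of_mem m φ.pt_mem

theorem PointedSection.base_prolong (φ : PointedSection π) (m : ℕ) {s : ℝ} (hs : s ∈ φ.dom) :
    (φ.prolong m s).base = φ.toFun s := by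
  rw [φ.prolong_of_mem m hs]; rfl

theorem PointedSection.time_prolong (φ : PointedSection π) (m : ℕ) {s : ℝ} (hs : s ∈ φ.dom) :
    (φ.prolong m s).time = s := by
  rw [φ.prolong_of_mem m hs]; rfl

theorem PointedSection.truncate_prolong (φ : PointedSection π) {r m : ℕ} (h : r ≤ m) {s : ℝ}
    (hs : s ∈ φ.dom) : Jet.truncate h (φ.prolong m s) = φ.prolong r s := by
  rw [φ.prolong_of_mem m hs, φ.prolong_of_mem r hs]; rfl

/-- The fibre coordinates of a local section in an adapted chart. -/
def AdaptedChart.curve (e : AdaptedChart π) (φ : PointedSection π) (s : ℝ) : FibreModel n :=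
  (e.toChart (φ.toFun s)).2

/-- The times at which a local section is defined and lies in the domain of an adapted chart. -/
def AdaptedChart.times (e : AdaptedChart π) (φ : PointedSection π) : Set ℝ :=
  φ.dom ∩ φ.toFun ⁻¹' e.toChart.source

theorem AdaptedChart.isOpen_times (e : AdaptedChart π) (φ : PointedSection π) :
    IsOpen (e.times φ) :=
  φ.smooth.continuousOn.isOpen_inter_preimage φ.isOpen_dom e.toChart.open_source

variable {e : AdaptedChart π} {φ : PointedSection π} {s : ℝ}

theorem AdaptedChart.contDiffAt_curve (hs : s ∈ e.times φ) : ContDiffAt ℝ ∞ (e.curve φ) s :=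
  contDiffAt_snd.comp s (e.contDiffAt_comp (φ.moveTo s hs.1) hs.2)

theorem AdaptedChart.toChart_section (hs : s ∈ e.times φ) :
    e.toChart (φ.toFun s) = (s, e.curve φ s) :=
  Prod.ext ((e.fst_eq _ hs.2).trans (φ.proj_apply s hs.1)) rfl

theorem AdaptedChart.mem_times_rep {N : ℕ} {y : Jet π N} (hy : y.base ∈ e.toChart.source) :
    y.time ∈ e.times y.rep := by
  rw [← y.time_rep]
  exact ⟨y.rep.pt_mem, show y.rep.toFun y.rep.pt ∈ _ by rwa [y.base_rep]⟩

end Sections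

section Manifold

variable [IsManifold (𝓡 (n + 1)) ∞ E]

variable {e : AdaptedChart π} {φ : PointedSection π} {s : ℝ}

theorem AdaptedChart.jetChart_prolong (m : ℕ) (hs : s ∈ e.times φ) :
    e.jetChart m (φ.prolong m s) = curveJet m (e.curve φ) s := by
  rw [φ.prolong_of_mem m hs.1]
  exact Prod.ext rfl (funext fun i =>
    e.sectionCoord_rep (φ.moveTo s hs.1) hs.2 (Nat.le_of_lt_succ i.2))

theorem AdaptedChart.prolong_mem_source (m : ℕ) (hs : s ∈ e.times φ) :
    φ.prolong m s ∈ (e.jetChart m).source := by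
  show (φ.prolong m s).base ∈ e.toChart.source
  rw [φ.base_prolong m hs.1]
  exact hs.2

theorem AdaptedChart.jetChart_symm_curveJet (m : ℕ) (hs : s ∈ e.times φ) :
    (e.jetChart m).symm (curveJet m (e.curve φ) s) = φ.prolong m s := by
  rw [← e.jetChart_prolong m hs, (e.jetChart m).left_inv (e.prolong_mem_source m hs)]

theorem AdaptedChart.curveJet_mem_target (m : ℕ) (hs : s ∈ e.times φ) :
    curveJet m (e.curve φ) s ∈ (e.jetChart m).target := by
  rw [← e.jetChart_prolong m hs]
  exact (e.jetChart m).map_source (e.prolong_mem_source m hs)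

theorem AdaptedChart.isOpen_jetChart_target (e : AdaptedChart π) (m : ℕ) :
    IsOpen (e.jetChart m).target :=
  (e.jetHomeo m).open_target

/-- The representative chosen for `j^N_s φ` need not be `φ`, but it has the same derivatives at `s`
up to order `N`. This removes the choice from total time derivatives. -/
theorem AdaptedChart.iteratedDeriv_curve_rep_prolong {N j : ℕ} (hj : j ≤ N) (hs : s ∈ e.times φ) :
    iteratedDeriv j (e.curve (φ.prolong N s).rep) s = iteratedDeriv j (e.curve φ) s := by
  have h := e.sectionCoord_rep (m := N) (φ.moveTo s hs.1) hs.2 hj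
  rw [← φ.prolong_of_mem N hs.1] at h
  have hpt : (φ.prolong N s).rep.pt = s := by rw [Jet.time_rep, φ.time_prolong N hs.1]
  rw [AdaptedChart.sectionCoord, hpt] at h
  exact h

theorem AdaptedChart.eventually_apply_prolong {G : Type*} {m : ℕ} (f : Jet π m → G)
    (hs : s ∈ e.times φ) : (fun τ => f (φ.prolong m τ)) =ᶠ[𝓝 s]
      fun τ => (fun p => f ((e.jetChart m).symm p)) (curveJet m (e.curve φ) τ) := by
  filter_upwards [(e.isOpen_times φ).mem_nhds hs] with τ hτ
  simp only [e.jetChart_symm_curveJet m hτ]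

variable {G : Type*} [NormedAddCommGroup G] [NormedSpace ℝ G]

theorem AdaptedChart.contDiffAt_apply_prolong {m : ℕ} {f : Jet π m → G}
    (hf : ContDiffOn ℝ ∞ (fun p => f ((e.jetChart m).symm p)) (e.jetChart m).target)
    (hs : s ∈ e.times φ) : ContDiffAt ℝ ∞ (fun τ => f (φ.prolong m τ)) s := by
  refine ContDiffAt.congr_of_eventuallyEq ?_ (e.eventually_apply_prolong f hs)
  exact ContDiffAt.comp s (g := fun p => f ((e.jetChart m).symm p)) (hf.contDiffAt ((e.isOpen_jetChart_target m).mem_nhds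
    (e.curveJet_mem_target m hs))) (contDiffAt_curveJet m (e.contDiffAt_curve hs))

/-- The iterated total time derivatives along a prolongation are the time derivatives. -/
theorem AdaptedChart.totalTimeDeriv_prolong {m N i : ℕ} (hN : m + i ≤ N) {f : Jet π m → G}
    (hf : ContDiffOn ℝ ∞ (fun p => f ((e.jetChart m).symm p)) (e.jetChart m).target)
    (hs : s ∈ e.times φ) :
    totalTimeDeriv i f (φ.prolong N s) = iteratedDeriv i (fun τ => f (φ.prolong m τ)) s := by
  have hs' : s ∈ e.times (φ.prolong N s).rep := by
    have h := e.mem_times_rep (y := φ.prolong N s) (e.prolong_mem_source N hs)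
    rwa [φ.time_prolong N hs.1] at h
  have hj : ∀ j ≤ N, iteratedDeriv j (e.curve (φ.prolong N s).rep) s =
      iteratedDeriv j (e.curve φ) s := fun j hj => e.iteratedDeriv_curve_rep_prolong hj hs
  rw [totalTimeDeriv, φ.time_prolong N hs.1, (e.eventually_apply_prolong f hs').iteratedDeriv_eq,
    (e.eventually_apply_prolong f hs).iteratedDeriv_eq]
  -- The `i`-th derivative of `f` along the `m`-jets uses derivatives of the section up to order `m
  -- + i ≤ N`, on which the representative and `φ` agree.
  refine iteratedDeriv_comp_congr i (F := fun p => f ((e.jetChart m).symm p)) ?_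
    (contDiffAt_curveJet m (e.contDiffAt_curve hs'))
    (contDiffAt_curveJet m (e.contDiffAt_curve hs)) fun l hl =>
      iteratedDeriv_curveJet_congr (e.contDiffAt_curve hs') (e.contDiffAt_curve hs)
        fun j hjl => hj j (by omega)
  exact hf.contDiffAt ((e.isOpen_jetChart_target m).mem_nhds (e.curveJet_mem_target m hs'))

/-- A jet with coordinates `p` is represented by the Taylor section of `p`, which depends smoothly
on `p`. The total derivative is thus a time derivative of a smooth family, evaluated at the time
coordinate of `p`. -/
theorem AdaptedChart.contDiffOn_totalTimeDeriv {m N i : ℕ} (hN : m + i ≤ N) {f : Jet π m → G}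
    (hf : ContDiffOn ℝ ∞ (fun p => f ((e.jetChart m).symm p)) (e.jetChart m).target) :
    ContDiffOn ℝ ∞ (fun p => totalTimeDeriv i f ((e.jetChart N).symm p)) (e.jetChart N).target := by
  have hc : ContDiff ℝ ∞ fun w : JetModel n N × ℝ => curveJet m (taylorCurve w.1.1 w.1.2) w.2 := by
    refine contDiff_snd.prodMk (contDiff_pi.2 fun j => ?_)
    exact contDiffOn_univ.1 (contDiffOn_iteratedDeriv isOpen_univ j contDiff_taylorCurve.contDiffOn)
  have hcoord : ∀ p ∈ (e.jetChart N).target,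
      totalTimeDeriv i f ((e.jetChart N).symm p) = iteratedDeriv i
        (fun τ => f ((e.jetChart m).symm (curveJet m (taylorCurve p.1 p.2) τ))) p.1 := by
    intro p hp
    have hp' : (p.1, p.2 0) ∈ e.toChart.target := hp
    set φ := e.taylorSection p hp' with hφ
    have ht : p.1 ∈ e.times φ := by
      refine ⟨φ.pt_mem, ?_⟩
      show φ.toFun φ.pt ∈ e.toChart.source
      rw [hφ, e.taylorSection_base]
      exact e.toChart.map_target hp'
    have hcurve : ∀ᶠ τ in 𝓝 p.1, e.curve φ τ = taylorCurve p.1 p.2 τ := by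
      filter_upwards [φ.isOpen_dom.mem_nhds φ.pt_mem] with τ hτ
      have hτ' : (τ, taylorCurve p.1 p.2 τ) ∈ e.toChart.target := hτ
      simp only [AdaptedChart.curve, hφ, AdaptedChart.taylorSection, e.toChart.right_inv hτ']
    rw [e.jetChart_symm_apply p hp', ← hφ, ← φ.prolong_pt N]
    rw [show φ.pt = p.1 from rfl, e.totalTimeDeriv_prolong hN hf ht,
      (e.eventually_apply_prolong f ht).iteratedDeriv_eq]
    apply Filter.EventuallyEq.iteratedDeriv_eq
    filter_upwards [hcurve.eventually_nhds] with τ hτ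
    have hq : curveJet m (e.curve φ) τ = curveJet m (taylorCurve p.1 p.2) τ :=
      Prod.ext rfl (funext fun j => Filter.EventuallyEq.iteratedDeriv_eq _ hτ)
    simp only [hq]
  refine ContDiffOn.congr ?_ hcoord
  refine contDiffOn_iteratedDeriv_comp (τ := Prod.fst)
    ((e.isOpen_jetChart_target m).preimage hc.continuous) i
    (H := fun w : JetModel n N × ℝ =>
      f ((e.jetChart m).symm (curveJet m (taylorCurve w.1.1 w.1.2) w.2)))
    (hf.comp hc.contDiffOn fun _ h => h) contDiff_fst ?_
  -- At the centre of expansion the Taylor curve passes through `p.2 0`, so its jet lies in the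
  -- chart target.
  intro p hp
  show ((p.1, iteratedDeriv ((0 : Fin (m + 1)) : ℕ) (taylorCurve p.1 p.2) p.1)) ∈ e.toChart.target
  simp only [Fin.val_zero, iteratedDeriv_zero, taylorCurve_self]
  exact hp

section Lagrangian

variable {k : ℕ} {L : Jet π k → ℝ}

theorem AdaptedChart.contDiffOn_lagrangian (e : AdaptedChart π)
    (hL : ContMDiff 𝓘(ℝ, JetModel n k) 𝓘(ℝ, ℝ) ∞ L) :
    ContDiffOn ℝ ∞ (fun p => L ((e.jetChart k).symm p)) (e.jetChart k).target :=
  contMDiffOn_iff_contDiffOn.1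
    (hL.comp_contMDiffOn (contMDiffOn_symm_of_mem_maximalAtlas (e.jetHomeo_mem k)))

theorem AdaptedChart.contDiffOn_partialDeriv (e : AdaptedChart π)
    (hL : ContMDiff 𝓘(ℝ, JetModel n k) 𝓘(ℝ, ℝ) ∞ L) (r : Fin (k + 1)) :
    ContDiffOn ℝ ∞ (fun p => e.partialDeriv L r ((e.jetChart k).symm p)) (e.jetChart k).target := by
  have h := (e.contDiffOn_lagrangian hL).fderiv_of_isOpen (m := ∞) (e.isOpen_jetChart_target k)
    (by simp)
  refine ((h.clm_comp (contDiffOn_const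
    (c := ContinuousLinearMap.inr ℝ ℝ (Fin (k + 1) → FibreModel n)))).clm_comp (contDiffOn_const
      (c := ContinuousLinearMap.single ℝ (fun _ : Fin (k + 1) => FibreModel n) r))).congr
        fun p hp => ?_
  rw [AdaptedChart.partialDeriv, (e.jetChart k).right_inv hp]

/-- The partial derivatives of a Lagrangian along the prolongation of a section. -/
def AdaptedChart.partialAlong (e : AdaptedChart π) (L : Jet π k → ℝ) (φ : PointedSection π)
    (j : ℕ) (s : ℝ) : FibreModel n →L[ℝ] ℝ :=
  if h : j ≤ k then e.partialDeriv L ⟨j, Nat.lt_succ_of_le h⟩ (φ.prolong k s) else 0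

theorem AdaptedChart.contDiffAt_partialAlong (hL : ContMDiff 𝓘(ℝ, JetModel n k) 𝓘(ℝ, ℝ) ∞ L)
    (hs : s ∈ e.times φ) (j : ℕ) : ContDiffAt ℝ ∞ (e.partialAlong L φ j) s := by
  unfold AdaptedChart.partialAlong
  by_cases h : j ≤ k
  · simp only [h, dif_pos]
    exact e.contDiffAt_apply_prolong (e.contDiffOn_partialDeriv hL _) hs
  · simp only [h, dif_neg, not_false_eq_true]
    exact contDiffAt_const

/-- Each summand differentiates a function of `k`-jets at most `k - 1` times, so it is determined by
the `(2k-1)`-jet. -/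
theorem AdaptedChart.momentum_prolong (hk : 1 ≤ k) (hL : ContMDiff 𝓘(ℝ, JetModel n k) 𝓘(ℝ, ℝ) ∞ L)
    (hs : s ∈ e.times φ) (r : Fin (k - 1 + 1)) :
    e.momentum L r (φ.prolong (2 * k - 1) s) = ostrogradskySum (e.partialAlong L φ) k r s := by
  rw [AdaptedChart.momentum, ostrogradskySum, Finset.sum_range]
  refine Finset.sum_congr rfl fun i _ => ?_
  rw [e.totalTimeDeriv_prolong (by omega) (e.contDiffOn_partialDeriv hL _) hs]
  congr 2
  funext τ
  rw [AdaptedChart.partialAlong, dif_pos (show (r : ℕ) + 1 + i ≤ k by omega)]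

theorem AdaptedChart.contDiffOn_momentum (hL : ContMDiff 𝓘(ℝ, JetModel n k) 𝓘(ℝ, ℝ) ∞ L)
    (r : Fin (k - 1 + 1)) :
    ContDiffOn ℝ ∞ (fun p => e.momentum L r ((e.jetChart (2 * k - 1)).symm p))
      (e.jetChart (2 * k - 1)).target := by
  unfold AdaptedChart.momentum
  refine ContDiffOn.sum fun i _ => ContDiffOn.const_smul _ ?_
  exact e.contDiffOn_totalTimeDeriv (by omega) (e.contDiffOn_partialDeriv hL _)

/-- The differential of the Lagrangian on vertical vectors, in terms of the partial derivatives. -/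
theorem AdaptedChart.fderiv_lagrangian_vertical (hs : s ∈ e.times φ)
    (w : ℕ → FibreModel n) :
    fderiv ℝ (fun p => L ((e.jetChart k).symm p)) (curveJet k (e.curve φ) s) (0, fun i => w i) =
      ∑ r ∈ Finset.range (k + 1), e.partialAlong L φ r s (w r) := by
  have hsum : ((0, fun i : Fin (k + 1) => w i) : JetModel n k) =
      ∑ r : Fin (k + 1), ContinuousLinearMap.inr ℝ ℝ (Fin (k + 1) → FibreModel n)
        (ContinuousLinearMap.single ℝ (fun _ : Fin (k + 1) => FibreModel n) r (w r)) := by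
    rw [← map_sum]
    refine Prod.ext rfl ?_
    simp only [ContinuousLinearMap.inr_apply, ContinuousLinearMap.single_apply]
    exact (Finset.univ_sum_single _).symm
  rw [hsum, map_sum, Finset.sum_range]
  refine Finset.sum_congr rfl fun r _ => ?_
  rw [AdaptedChart.partialAlong, dif_pos (Nat.le_of_lt_succ r.2), AdaptedChart.partialDeriv,
    e.jetChart_prolong k hs]
  rfl

end Lagrangian

end Manifold

end CurvesOfJets

/-! ### Vertical variations and their behaviour under change of adapted chart -/

section VerticalVariations

variable {n : ℕ} {E : Type*} [TopologicalSpace E]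
  [ChartedSpace (EuclideanSpace ℝ (Fin (n + 1))) E] {π : FibredManifold n E}

/-- The vertical tangent vector `(0, v(s), v'(s), …, v^{(m)}(s))` of a curve of jets defined by a
variation `v` of the fibre coordinates. -/
def verticalJet (m : ℕ) (v : ℝ → FibreModel n) (s : ℝ) : JetModel n m :=
  (0, fun i => iteratedDeriv i v s)

theorem contDiffAt_verticalJet (m : ℕ) {v : ℝ → FibreModel n} {t : ℝ} (hv : ContDiffAt ℝ ∞ v t) :
    ContDiffAt ℝ ∞ (verticalJet m v) t :=
  contDiffAt_const.prodMk (contDiffAt_pi.2 fun i => contDiffAt_iteratedDeriv i hv)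

section Transition

/-- The local section with prescribed fibre coordinates in an adapted chart. -/
def AdaptedChart.sectionOfCurve (e : AdaptedChart π) (q : ℝ → FibreModel n) {U : Set ℝ}
    (hU : IsOpen U) (hq : ContDiffOn ℝ ∞ q U) (t : ℝ) (ht : t ∈ U)
    (h : (t, q t) ∈ e.toChart.target) : PointedSection π where
  toFun s := e.toChart.symm (s, q s)
  dom := U ∩ (fun s => (s, q s)) ⁻¹' e.toChart.target
  isOpen_dom := (continuousOn_id.prodMk hq.continuousOn).isOpen_inter_preimage hU
    e.toChart.open_target
  smooth := e.smooth_symm.comp ((contDiffOn_id.prodMk hq).contMDiffOn.mono inter_subset_left)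
    fun _ h => h.2
  proj_apply s hs := by
    rw [← e.fst_eq _ (e.toChart.map_target hs.2), e.toChart.right_inv hs.2]
  pt := t
  pt_mem := ⟨ht, h⟩

/-- The fibre component of the transition map between two adapted charts. -/
def AdaptedChart.fibreTransition (e e' : AdaptedChart π) (z : ℝ × FibreModel n) : FibreModel n :=
  (e'.toChart (e.toChart.symm z)).2

variable {e e' : AdaptedChart π} {φ : PointedSection π} {s : ℝ}

theorem AdaptedChart.contDiffOn_fibreTransition (e e' : AdaptedChart π) :
    ContDiffOn ℝ ∞ (e.fibreTransition e') (e.toChart.symm.trans e'.toChart).source := by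
  refine contDiff_snd.comp_contDiffOn (contMDiffOn_iff_contDiffOn.1
    (ContMDiffOn.comp (I' := 𝓡 (n + 1)) (g := e'.toChart)
      e'.smooth (e.smooth_symm.mono ?_) ?_))
  · exact fun z hz => by simp at hz; exact hz.1
  · exact fun z hz => by simp at hz; exact hz.2

theorem AdaptedChart.mk_curve_mem_transition (h : s ∈ e.times φ) (h' : s ∈ e'.times φ) :
    (s, e.curve φ s) ∈ (e.toChart.symm.trans e'.toChart).source := by
  rw [← e.toChart_section h]
  simpa [e.toChart.left_inv h.2, e.toChart.map_source h.2] using h'.2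

/-- The image in another adapted chart of a variation of the fibre coordinates of a section. -/
def AdaptedChart.transportVariation (e e' : AdaptedChart π) (φ : PointedSection π)
    (v : ℝ → FibreModel n) (s : ℝ) : FibreModel n :=
  fderiv ℝ (e.fibreTransition e') (s, e.curve φ s) (0, v s)

theorem AdaptedChart.contDiffAt_transportVariation {v : ℝ → FibreModel n}
    (hv : ContDiffAt ℝ ∞ v s) (h : s ∈ e.times φ) (h' : s ∈ e'.times φ) :
    ContDiffAt ℝ ∞ (e.transportVariation e' φ v) s := by
  refine ContDiffAt.clm_apply (f := fun s => fderiv ℝ (e.fibreTransition e') (s, e.curve φ s)) ?_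
    (contDiffAt_const.prodMk hv)
  have hF := (e.contDiffOn_fibreTransition e').contDiffAt
    ((e.toChart.symm.trans e'.toChart).open_source.mem_nhds (e.mk_curve_mem_transition h h'))
  exact ContDiffAt.comp s (hF.fderiv_right (m := ∞) (by simp))
    (contDiffAt_id.prodMk (e.contDiffAt_curve h))

variable [IsManifold (𝓡 (n + 1)) ∞ E]

/-- The transition map between the natural coordinates of two adapted charts. -/
def AdaptedChart.jetTransition (e e' : AdaptedChart π) (m : ℕ) (p : JetModel n m) : JetModel n m :=
  e'.jetChart m ((e.jetChart m).symm p)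

theorem AdaptedChart.curveJet_mem_jetTransition (m : ℕ) (h : s ∈ e.times φ) (h' : s ∈ e'.times φ) :
    curveJet m (e.curve φ) s ∈ ((e.jetChart m).symm.trans (e'.jetChart m)).source := by
  rw [e.jetTransition_source e' m]
  simpa [curveJet] using e.mk_curve_mem_transition h h'

theorem AdaptedChart.contDiffAt_jetTransition (m : ℕ) (h : s ∈ e.times φ) (h' : s ∈ e'.times φ) :
    ContDiffAt ℝ ∞ (e.jetTransition e' m) (curveJet m (e.curve φ) s) :=
  (e.contDiffOn_jetTransition e' m).contDiffAt ((e.isOpen_jetTransition_source e' m).mem_nhds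
    (e.curveJet_mem_jetTransition m h h'))

theorem AdaptedChart.jetTransition_curveJet (m : ℕ) (h : s ∈ e.times φ) (h' : s ∈ e'.times φ) :
    e.jetTransition e' m (curveJet m (e.curve φ) s) = curveJet m (e'.curve φ) s := by
  rw [AdaptedChart.jetTransition, e.jetChart_symm_curveJet m h, e'.jetChart_prolong m h']

/-- Obtained by differentiating in time the fact that the transition map carries the jet curve of
one chart to that of the other. -/
theorem AdaptedChart.fderiv_jetTransition_velocity (m : ℕ) (h : s ∈ e.times φ)
    (h' : s ∈ e'.times φ) :
    fderiv ℝ (e.jetTransition e' m) (curveJet m (e.curve φ) s)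
      (velocityJet m (e.curve φ) s) = velocityJet m (e'.curve φ) s := by
  have h1 := ((e.contDiffAt_jetTransition m h h').differentiableAt (by simp)).hasFDerivAt.comp_hasDerivAt
    s (hasDerivAt_curveJet m (e.contDiffAt_curve h))
  refine h1.unique ((hasDerivAt_curveJet m (e'.contDiffAt_curve h')).congr_of_eventuallyEq ?_)
  filter_upwards [(e.isOpen_times φ).mem_nhds h, (e'.isOpen_times φ).mem_nhds h'] with τ hτ hτ'
  exact e.jetTransition_curveJet m hτ hτ'

/-- The prolongation of a vertical variation transforms naturally under changes of adapted
charts. -/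
theorem AdaptedChart.fderiv_jetTransition_verticalJet (m : ℕ) {v : ℝ → FibreModel n}
    (hv : ContDiff ℝ ∞ v) (h : s ∈ e.times φ) (h' : s ∈ e'.times φ) :
    fderiv ℝ (e.jetTransition e' m) (curveJet m (e.curve φ) s) (verticalJet m v s) =
      verticalJet m (e.transportVariation e' φ v) s := by
  set q := e.curve φ with hq_def
  have hq : ContDiffOn ℝ ∞ q (e.times φ) := fun τ hτ => (e.contDiffAt_curve hτ).contDiffWithinAt
  set T := (e.toChart.symm.trans e'.toChart).source with hT
  have hTo : IsOpen T := (e.toChart.symm.trans e'.toChart).open_source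
  -- The variation is realised by the deformation `q + ε v`. Transforming the deformed curves and
  -- then differentiating in `ε` computes the left-hand side, because the transition map commutes
  -- with taking jets.
  let g : ℝ × ℝ → ℝ × FibreModel n := fun w => (w.2, q w.2 + w.1 • v w.2)
  have hg : ContDiffOn ℝ ∞ g (univ ×ˢ e.times φ) := by
    refine contDiffOn_snd.prodMk (ContDiffOn.add ?_ ?_)
    · exact hq.comp contDiffOn_snd fun w hw => hw.2
    · exact contDiffOn_fst.smul (hv.comp contDiff_snd).contDiffOn
  set U : Set (ℝ × ℝ) := (univ ×ˢ e.times φ) ∩ g ⁻¹' T with hUdef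
  have hU : IsOpen U :=
    hg.continuousOn.isOpen_inter_preimage (isOpen_univ.prod (e.isOpen_times φ)) hTo
  let H : ℝ × ℝ → FibreModel n := fun w => e.fibreTransition e' (g w)
  have hH : ContDiffOn ℝ ∞ H U :=
    (e.contDiffOn_fibreTransition e').comp (hg.mono inter_subset_left) fun _ hw => hw.2
  have hU0 : ∀ {σ}, σ ∈ e.times φ → σ ∈ e'.times φ → ((0 : ℝ), σ) ∈ U := fun {σ} h1 h2 =>
    ⟨⟨mem_univ _, h1⟩, by simpa only [mem_preimage, g, zero_smul, add_zero] using e.mk_curve_mem_transition h1 h2⟩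
  have hUs : ((0 : ℝ), s) ∈ U := hU0 h h'
  have hlin : ∀ ε : ℝ, curveJet m (fun σ => q σ + ε • v σ) s =
      curveJet m q s + ε • verticalJet m v s := by
    intro ε
    refine Prod.ext (by simp [curveJet, verticalJet]) (funext fun i => ?_)
    show iteratedDeriv i (q + ε • v) s = _
    have h1 : ContDiffAt ℝ (i : ℕ) q s :=
      (e.contDiffAt_curve h).of_le (by exact_mod_cast le_top)
    have h2 : ContDiffAt ℝ (i : ℕ) (ε • v) s :=
      (ContDiffAt.const_smul ε hv.contDiffAt).of_le (by exact_mod_cast le_top)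
    rw [iteratedDeriv_add h1 h2, iteratedDeriv_const_smul_field]
    rfl
  have hfam : ∀ᶠ ε : ℝ in 𝓝 0, e.jetTransition e' m (curveJet m q s + ε • verticalJet m v s) =
      (s, fun i : Fin (m + 1) => iteratedDeriv i (fun σ => H (ε, σ)) s) := by
    have hc : ContinuousAt (fun ε : ℝ => (ε, s)) 0 := by fun_prop
    filter_upwards [hc.eventually (hU.mem_nhds hUs)] with ε hε
    have hεT : g (ε, s) ∈ T := hε.2
    have hmem : (s, q s + ε • v s) ∈ e.toChart.target ∧
        e.toChart.symm (s, q s + ε • v s) ∈ e'.toChart.source := by simpa [hT, g] using hεT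
    -- The deformed curve has to be a genuine local section of `π` for the transition formula for
    -- jet curves to apply to it.
    set χ := e.sectionOfCurve (fun σ => q σ + ε • v σ) (e.isOpen_times φ)
      (hq.add (ContDiffOn.const_smul ε hv.contDiffOn)) s h hmem.1 with hχ
    have hχs : s ∈ e.times χ := ⟨χ.pt_mem, e.toChart.map_target hmem.1⟩
    have hχs' : s ∈ e'.times χ := ⟨χ.pt_mem, hmem.2⟩
    have hcurve : e.curve χ =ᶠ[𝓝 s] fun σ => q σ + ε • v σ := by
      filter_upwards [χ.isOpen_dom.mem_nhds χ.pt_mem] with σ hσ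
      simp only [AdaptedChart.curve, hχ, AdaptedChart.sectionOfCurve, e.toChart.right_inv hσ.2]
    have hJ : curveJet m (e.curve χ) s = curveJet m q s + ε • verticalJet m v s := by
      rw [← hlin]
      exact Prod.ext rfl (funext fun i => hcurve.iteratedDeriv_eq _)
    rw [← hJ, e.jetTransition_curveJet m hχs hχs']
    rfl
  have hd1 : HasDerivAt (fun ε : ℝ => e.jetTransition e' m (curveJet m q s + ε • verticalJet m v s))
      (fderiv ℝ (e.jetTransition e' m) (curveJet m q s) (verticalJet m v s)) 0 := by
    have hl : HasDerivAt (fun ε : ℝ => curveJet m q s + ε • verticalJet m v s)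
        (verticalJet m v s) 0 := by
      simpa using ((hasDerivAt_id (0 : ℝ)).smul_const (verticalJet m v s)).const_add
        (curveJet m q s)
    have hF : HasFDerivAt (e.jetTransition e' m)
        (fderiv ℝ (e.jetTransition e' m) (curveJet m q s))
        (curveJet m q s + (0 : ℝ) • verticalJet m v s) := by
      rw [zero_smul, add_zero]
      exact ((e.contDiffAt_jetTransition m h h').differentiableAt (by simp)).hasFDerivAt
    exact hF.comp_hasDerivAt 0 hl
  have hd2 : HasDerivAt (fun ε : ℝ => ((s, fun i : Fin (m + 1) =>
      iteratedDeriv i (fun σ => H (ε, σ)) s) : JetModel n m))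
      (verticalJet m (e.transportVariation e' φ v) s) 0 := by
    refine (hasDerivAt_const _ _).prodMk (hasDerivAt_pi.2 fun i => ?_)
    have hD : DifferentiableAt ℝ (fun p : ℝ × ℝ => iteratedDeriv i (fun σ => H (p.1, σ)) p.2)
        (0, s) := ((contDiffOn_iteratedDeriv hU i hH).contDiffAt (hU.mem_nhds hUs)).differentiableAt
          (by simp)
    have h3 := hD.hasFDerivAt.comp_hasDerivAt (0 : ℝ)
      ((hasDerivAt_id (0 : ℝ)).prodMk (hasDerivAt_const (0 : ℝ) s))
    -- The `ε`-derivative passes inside the time derivatives, so only the order-zero variation has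
    -- to be computed, at all times near `s`.
    rw [fderiv_iteratedDeriv_swap hU i hH hUs] at h3
    refine h3.congr_deriv (Filter.EventuallyEq.iteratedDeriv_eq _ ?_)
    filter_upwards [(e.isOpen_times φ).mem_nhds h, (e'.isOpen_times φ).mem_nhds h'] with σ hσ hσ'
    have h4 : HasDerivAt (fun ε : ℝ => g (ε, σ)) (0, v σ) 0 := by
      refine (hasDerivAt_const _ _).prodMk ?_
      simpa using ((hasDerivAt_id (0 : ℝ)).smul_const (v σ)).const_add (q σ)
    have h5 : HasFDerivAt (e.fibreTransition e') (fderiv ℝ (e.fibreTransition e') (σ, q σ))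
        (g (0, σ)) := by
      have : g (0, σ) = (σ, q σ) := by simp [g]
      rw [this]
      exact (((e.contDiffOn_fibreTransition e').contDiffAt
        (hTo.mem_nhds (e.mk_curve_mem_transition hσ hσ'))).differentiableAt (by simp)).hasFDerivAt
    have h6 := ((hH.contDiffAt (hU.mem_nhds (hU0 hσ hσ'))).differentiableAt
      (by simp)).hasFDerivAt.comp_hasDerivAt (0 : ℝ)
        ((hasDerivAt_id (0 : ℝ)).prodMk (hasDerivAt_const (0 : ℝ) σ))
    exact h6.unique (h5.comp_hasDerivAt 0 h4)
  exact hd1.unique (hd2.congr_of_eventuallyEq hfam)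

end Transition

end VerticalVariations

/-! ### Uniqueness of the momenta and chart independence of the Legendre covector -/

section LegendreCovectors

variable {n : ℕ} {E : Type*} [TopologicalSpace E]
  [ChartedSpace (EuclideanSpace ℝ (Fin (n + 1))) E] {π : FibredManifold n E}

/-- The inclusion of the `r`-th fibre coordinate into the model space of `J^m π`. -/
def verticalInclusion (n : ℕ) {m : ℕ} (r : Fin (m + 1)) : FibreModel n →L[ℝ] JetModel n m :=
  (ContinuousLinearMap.inr ℝ ℝ (Fin (m + 1) → FibreModel n)).comp
    (ContinuousLinearMap.single ℝ (fun _ : Fin (m + 1) => FibreModel n) r)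

theorem apply_vertical_eq_sum {m : ℕ} (p : JetModel n m →L[ℝ] ℝ) (w : Fin (m + 1) → FibreModel n) :
    p (0, w) = ∑ r, p (verticalInclusion n r (w r)) := by
  have hsum : ((0, w) : JetModel n m) = ∑ r, verticalInclusion n r (w r) := by
    simp only [verticalInclusion, ContinuousLinearMap.comp_apply]
    rw [← map_sum]
    refine Prod.ext rfl ?_
    simp only [ContinuousLinearMap.inr_apply, ContinuousLinearMap.single_apply]
    exact (Finset.univ_sum_single _).symm
  rw [hsum, map_sum]

/-- A covector is determined by its values on a velocity and on vertical vectors. -/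
theorem covector_ext {m : ℕ} {p p' : JetModel n m →L[ℝ] ℝ} {q : ℝ → FibreModel n} {t : ℝ}
    (hvel : p (velocityJet m q t) = p' (velocityJet m q t))
    (hvert : ∀ r, p.comp (verticalInclusion n r) = p'.comp (verticalInclusion n r)) : p = p' := by
  refine ContinuousLinearMap.ext fun u => ?_
  -- The velocity has time component `1`, so it spans a complement of the vertical vectors.
  have hu : u = u.1 • velocityJet m q t + (0, u.2 - u.1 • (velocityJet m q t).2) := by
    refine Prod.ext ?_ ?_ <;> simp [velocityJet]
  rw [hu, map_add, map_add, map_smul, map_smul, hvel, apply_vertical_eq_sum,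
    apply_vertical_eq_sum p']
  congr 1
  exact Finset.sum_congr rfl fun r _ => DFunLike.congr_fun (hvert r) _

variable [IsManifold (𝓡 (n + 1)) ∞ E] {e e' : AdaptedChart π} {φ : PointedSection π} {t s : ℝ}
  {k : ℕ} {L : Jet π k → ℝ}

/-- A curve of covectors along the prolongation of a section which satisfies the first variation
formula up to a term of order zero has the Ostrogradsky momenta as vertical components. -/
theorem AdaptedChart.verticalInclusion_eq_ostrogradskySum (hk : 1 ≤ k)
    (hL : ContMDiff 𝓘(ℝ, JetModel n k) 𝓘(ℝ, ℝ) ∞ L) (ht : t ∈ e.times φ)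
    {p : ℝ → JetModel n (k - 1) →L[ℝ] ℝ} (hp : ContDiffAt ℝ ∞ p t)
    (F : ℝ → FibreModel n →L[ℝ] ℝ)
    (h : ∀ᶠ s in 𝓝 t, ∀ v : Fin (k + 1) → FibreModel n,
      deriv (fun σ => p σ (verticalJet (k - 1) (taylorCurve s v) σ)) s =
        ∑ r ∈ Finset.range (k + 1), e.partialAlong L φ r s (iteratedDeriv r (taylorCurve s v) s) -
          F s (v 0)) (r : Fin (k - 1 + 1)) :
    (p t).comp (verticalInclusion n r) = ostrogradskySum (e.partialAlong L φ) k r t := by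
  set A := e.partialAlong L φ
  -- The defect between the given covectors and the Ostrogradsky momenta, extended by zero to
  -- indices `r ≥ k`.
  let D : ℕ → ℝ → FibreModel n →L[ℝ] ℝ := fun r s =>
    if hr : r < k then (p s).comp (verticalInclusion n (⟨r, by omega⟩ : Fin (k - 1 + 1))) -
      ostrogradskySum A k r s else 0
  have hA : ∀ {s}, s ∈ e.times φ → ∀ j ≤ k, ContDiffAt ℝ ∞ (A j) s := fun hs j _ =>
    e.contDiffAt_partialAlong hL hs j
  have hD : ∀ r < k, ContDiffAt ℝ ∞ (D r) t := by
    intro r hr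
    simp only [D, hr, dif_pos]
    exact (hp.clm_comp contDiffAt_const).sub (contDiffAt_ostrogradskySum (hA ht) r)
  have hpair : ∀ (σ : ℝ) (v : ℝ → FibreModel n),
      ∑ r ∈ Finset.range k, D r σ (iteratedDeriv r v σ) = p σ (verticalJet (k - 1) v σ) -
        ∑ r ∈ Finset.range k, ostrogradskySum A k r σ (iteratedDeriv r v σ) := by
    intro σ v
    obtain ⟨l, rfl⟩ : ∃ l, k = l + 1 := ⟨k - 1, by omega⟩
    rw [verticalJet, apply_vertical_eq_sum, Finset.sum_range, Finset.sum_range]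
    refine Eq.trans (Finset.sum_congr rfl fun (i : Fin (l + 1)) _ => ?_)
      (Finset.sum_sub_distrib (ι := Fin (l + 1)) _ _)
    simp only [D, i.2, dif_pos]
    rfl
  -- Subtracting the two first variation formulas cancels all the terms `A_r v^{(r)}`; what remains
  -- is the Euler-Lagrange covector minus `F`, of order zero in `v`.
  have hzero := eventually_eq_zero_of_deriv_pairing (r := r) hD
    (fun s => (A 0 s - deriv (ostrogradskySum A k 0) s) - F s) ?_ (by omega)
  · have h0 := hzero.self_of_nhds
    simp only [D, show (r : ℕ) < k by omega, dif_pos] at h0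
    exact sub_eq_zero.1 h0
  · filter_upwards [h, (e.isOpen_times φ).mem_nhds ht, eventually_differentiableAt hp]
      with s hs hst hps v
    have hv : ContDiffAt ℝ ∞ (taylorCurve s v) s := (contDiff_taylorCurve_right s v).contDiffAt
    simp only [hpair]
    have h1 : DifferentiableAt ℝ (fun σ => p σ (verticalJet (k - 1) (taylorCurve s v) σ)) s :=
      hps.clm_apply ((contDiffAt_verticalJet (k - 1) hv).differentiableAt (by simp))
    have h2 := hasDerivAt_ostrogradsky_pairing (hA hst) hv
    rw [deriv_fun_sub h1 h2.differentiableAt, hs v, h2.deriv, taylorCurve_self]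
    simp only [sub_apply]
    ring

theorem AdaptedChart.legendreCovector_apply (e : AdaptedChart π) (hk : 1 ≤ k) (L : Jet π k → ℝ)
    (y : Jet π (2 * k - 1)) (u : JetModel n (k - 1)) :
    e.legendreCovector hk L y u =
      e.energyMomentum hk L y * u.1 + ∑ r, e.momentum L r y (u.2 r) := by
  simp [AdaptedChart.legendreCovector]

theorem AdaptedChart.legendreCovector_verticalInclusion (e : AdaptedChart π) (hk : 1 ≤ k)
    (L : Jet π k → ℝ) (y : Jet π (2 * k - 1)) (r : Fin (k - 1 + 1)) :
    (e.legendreCovector hk L y).comp (verticalInclusion n r) = e.momentum L r y := by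
  ext x
  rw [ContinuousLinearMap.comp_apply, e.legendreCovector_apply]
  simp only [verticalInclusion, ContinuousLinearMap.comp_apply, ContinuousLinearMap.inr_apply,
    ContinuousLinearMap.single_apply, mul_zero, zero_add]
  rw [Finset.sum_eq_single r]
  · simp
  · intro b _ hb
    simp [Pi.single_eq_of_ne hb]
  · simp

theorem AdaptedChart.contDiffOn_legendreCovector (e : AdaptedChart π) (hk : 1 ≤ k)
    (hL : ContMDiff 𝓘(ℝ, JetModel n k) 𝓘(ℝ, ℝ) ∞ L) :
    ContDiffOn ℝ ∞ (fun p => e.legendreCovector hk L ((e.jetChart (2 * k - 1)).symm p))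
      (e.jetChart (2 * k - 1)).target := by
  have hLag : ContDiffOn ℝ ∞ (fun p => L (jetProj π (show k ≤ 2 * k - 1 by omega)
      ((e.jetChart (2 * k - 1)).symm p))) (e.jetChart (2 * k - 1)).target :=
    contMDiffOn_iff_contDiffOn.1 ((hL.comp (jetProj π _).contMDiff).comp_contMDiffOn
      (contMDiffOn_symm_of_mem_maximalAtlas (e.jetHomeo_mem (2 * k - 1))))
  have hen : ContDiffOn ℝ ∞ (fun p => e.energyMomentum hk L ((e.jetChart (2 * k - 1)).symm p))
      (e.jetChart (2 * k - 1)).target := by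
    unfold AdaptedChart.energyMomentum
    refine hLag.sub (ContDiffOn.sum fun r _ => (e.contDiffOn_momentum hL r).clm_apply ?_)
    refine ContDiffOn.congr (f := fun p : JetModel n (2 * k - 1) => p.2 ⟨r + 1, by omega⟩) ?_ ?_
    · fun_prop
    · intro p hp
      rw [(e.jetChart (2 * k - 1)).right_inv hp]
  unfold AdaptedChart.legendreCovector
  exact (hen.smul contDiffOn_const).add
    (ContDiffOn.sum fun r _ => (e.contDiffOn_momentum hL r).clm_comp contDiffOn_const)

/-- Along a prolongation, the Legendre covector evaluated on the velocity is the Lagrangian. -/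
theorem AdaptedChart.legendreCovector_velocityJet (hk : 1 ≤ k) (hs : s ∈ e.times φ) :
    e.legendreCovector hk L (φ.prolong (2 * k - 1) s) (velocityJet (k - 1) (e.curve φ) s) =
      L (φ.prolong k s) := by
  rw [e.legendreCovector_apply, AdaptedChart.energyMomentum, e.jetChart_prolong _ hs]
  simp only [velocityJet, mul_one, curveJet, sub_add_cancel]
  exact congrArg L (φ.truncate_prolong (show k ≤ 2 * k - 1 by omega) hs.1)

/-- The first variation formula along the prolongation of a section. -/
theorem AdaptedChart.hasDerivAt_legendreCovector_verticalJet (hk : 1 ≤ k)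
    (hL : ContMDiff 𝓘(ℝ, JetModel n k) 𝓘(ℝ, ℝ) ∞ L) (hs : s ∈ e.times φ)
    {v : ℝ → FibreModel n} (hv : ContDiffAt ℝ ∞ v s) :
    HasDerivAt (fun σ => e.legendreCovector hk L (φ.prolong (2 * k - 1) σ)
        (verticalJet (k - 1) v σ))
      (∑ r ∈ Finset.range (k + 1), e.partialAlong L φ r s (iteratedDeriv r v s) -
        (e.partialAlong L φ 0 s - deriv (ostrogradskySum (e.partialAlong L φ) k 0) s) (v s)) s := by
  refine (hasDerivAt_ostrogradsky_pairing (fun j _ => e.contDiffAt_partialAlong hL hs j)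
    hv).congr_of_eventuallyEq ?_
  filter_upwards [(e.isOpen_times φ).mem_nhds hs] with σ hσ
  rw [e.legendreCovector_apply]
  obtain ⟨l, rfl⟩ : ∃ l, k = l + 1 := ⟨k - 1, by omega⟩
  simp only [verticalJet, mul_zero, zero_add, Finset.sum_range]
  exact Finset.sum_congr rfl fun r _ => by rw [e.momentum_prolong hk hL hσ]

/-- The differential of the Lagrangian on a prolonged vertical variation does not depend on the
adapted chart. -/
theorem AdaptedChart.sum_partialAlong_eq (hL : ContMDiff 𝓘(ℝ, JetModel n k) 𝓘(ℝ, ℝ) ∞ L)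
    (h : s ∈ e.times φ) (h' : s ∈ e'.times φ) {v : ℝ → FibreModel n} (hv : ContDiff ℝ ∞ v) :
    ∑ r ∈ Finset.range (k + 1), e.partialAlong L φ r s (iteratedDeriv r v s) =
      ∑ r ∈ Finset.range (k + 1), e'.partialAlong L φ r s
        (iteratedDeriv r (e.transportVariation e' φ v) s) := by
  rw [← e.fderiv_lagrangian_vertical h fun r => iteratedDeriv r v s,
    ← e'.fderiv_lagrangian_vertical h' fun r => iteratedDeriv r (e.transportVariation e' φ v) s]
  have hv' := e.fderiv_jetTransition_verticalJet k hv h h'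
  have hc : HasFDerivAt (fun p => L ((e'.jetChart k).symm p))
      (fderiv ℝ (fun p => L ((e'.jetChart k).symm p)) (curveJet k (e'.curve φ) s))
      (e.jetTransition e' k (curveJet k (e.curve φ) s)) := by
    rw [e.jetTransition_curveJet k h h']
    exact (((e'.contDiffOn_lagrangian hL).contDiffAt ((e'.isOpen_jetChart_target k).mem_nhds
      (e'.curveJet_mem_target k h'))).differentiableAt (by simp)).hasFDerivAt
  -- Near the jet, `L` in the chart `e` is `L` in the chart `e'` composed with the transition map.
  -- The chain rule and the naturality of prolonged variations then give the equality.
  have h1 := hc.comp _ ((e.contDiffAt_jetTransition k h h').differentiableAt (by simp)).hasFDerivAt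
  have heq : (fun p => L ((e.jetChart k).symm p)) =ᶠ[𝓝 (curveJet k (e.curve φ) s)]
      (fun p => L ((e'.jetChart k).symm p)) ∘ e.jetTransition e' k := by
    filter_upwards [(e.isOpen_jetTransition_source e' k).mem_nhds
      (e.curveJet_mem_jetTransition k h h')] with p hp
    have hp' : (e.jetChart k).symm p ∈ (e'.jetChart k).source := by
      simp at hp; exact hp.2
    simp only [Function.comp_apply, AdaptedChart.jetTransition, (e'.jetChart k).left_inv hp']
  show fderiv ℝ (fun p => L ((e.jetChart k).symm p)) (curveJet k (e.curve φ) s)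
    (verticalJet k v s) = fderiv ℝ (fun p => L ((e'.jetChart k).symm p))
      (curveJet k (e'.curve φ) s) (verticalJet k (e.transportVariation e' φ v) s)
  rw [(h1.congr_of_eventuallyEq heq).fderiv, ← hv']
  rfl

/-- The Legendre covectors in two adapted charts are related by the change of coordinates. -/
theorem AdaptedChart.legendreCovector_jetTransition (hk : 1 ≤ k)
    (hL : ContMDiff 𝓘(ℝ, JetModel n k) 𝓘(ℝ, ℝ) ∞ L) (h : t ∈ e.times φ) (h' : t ∈ e'.times φ) :
    e.legendreCovector hk L (φ.prolong (2 * k - 1) t) =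
      (e'.legendreCovector hk L (φ.prolong (2 * k - 1) t)).comp
        (fderiv ℝ (e.jetTransition e' (k - 1)) (curveJet (k - 1) (e.curve φ) t)) := by
  -- The covectors of `e'` pulled back to `e`. They satisfy the first variation formula in `e` up to
  -- order zero, so uniqueness identifies their vertical components with the momenta of `e`.
  set p : ℝ → JetModel n (k - 1) →L[ℝ] ℝ := fun s =>
    (e'.legendreCovector hk L (φ.prolong (2 * k - 1) s)).comp
      (fderiv ℝ (e.jetTransition e' (k - 1)) (curveJet (k - 1) (e.curve φ) s)) with hp_def
  have hp : ContDiffAt ℝ ∞ p t := by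
    refine ContDiffAt.clm_comp
      (e'.contDiffAt_apply_prolong (e'.contDiffOn_legendreCovector hk hL) h') ?_
    exact ContDiffAt.comp t
      ((e.contDiffAt_jetTransition (k - 1) h h').fderiv_right (m := ∞) (by simp))
      (contDiffAt_curveJet (k - 1) (e.contDiffAt_curve h))
  have hvert : ∀ r : Fin (k - 1 + 1), (p t).comp (verticalInclusion n r) =
      e.momentum L r (φ.prolong (2 * k - 1) t) := by
    intro r
    rw [e.momentum_prolong hk hL h]
    -- The order-zero term is the Euler-Lagrange covector in `e'`, composed with the fibre
    -- derivative of the transition map.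
    refine e.verticalInclusion_eq_ostrogradskySum hk hL h hp (fun s =>
      (e'.partialAlong L φ 0 s - deriv (ostrogradskySum (e'.partialAlong L φ) k 0) s).comp
        ((fderiv ℝ (e.fibreTransition e') (s, e.curve φ s)).comp
          (ContinuousLinearMap.inr ℝ ℝ (FibreModel n)))) ?_ r
    filter_upwards [(e.isOpen_times φ).mem_nhds h, (e'.isOpen_times φ).mem_nhds h'] with s hs hs' v
    have hv := contDiff_taylorCurve_right s v
    have hd := e'.hasDerivAt_legendreCovector_verticalJet hk hL hs'
      (e.contDiffAt_transportVariation hv.contDiffAt hs hs')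
    have heq : (fun σ => p σ (verticalJet (k - 1) (taylorCurve s v) σ)) =ᶠ[𝓝 s]
        fun σ => e'.legendreCovector hk L (φ.prolong (2 * k - 1) σ)
          (verticalJet (k - 1) (e.transportVariation e' φ (taylorCurve s v)) σ) := by
      filter_upwards [(e.isOpen_times φ).mem_nhds hs, (e'.isOpen_times φ).mem_nhds hs']
        with σ hσ hσ'
      simp only [hp_def, ContinuousLinearMap.comp_apply,
        e.fderiv_jetTransition_verticalJet (k - 1) hv hσ hσ']
    rw [heq.deriv_eq, hd.deriv, e.sum_partialAlong_eq hL hs hs' hv]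
    simp only [ContinuousLinearMap.comp_apply, ContinuousLinearMap.inr_apply,
      AdaptedChart.transportVariation, taylorCurve_self]
  -- The remaining time component is settled by the velocity, on which both covectors take the value
  -- of `L`.
  have hvel : p t (velocityJet (k - 1) (e.curve φ) t) = L (φ.prolong k t) := by
    simp only [hp_def, ContinuousLinearMap.comp_apply, e.fderiv_jetTransition_velocity _ h h',
      e'.legendreCovector_velocityJet hk h']
  exact covector_ext ((e.legendreCovector_velocityJet hk h).trans hvel.symm) fun r =>
    (e.legendreCovector_verticalInclusion hk L _ r).trans (hvert r).symm

end LegendreCovectors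

/-! ### Natural coordinates as charts of the jet and cotangent bundles -/

section CoordinatesOnBundles

section General

variable {F : Type*} [NormedAddCommGroup F] [NormedSpace ℝ F] {H : Type*} [TopologicalSpace H]
  {F' : Type*} [NormedAddCommGroup F'] [NormedSpace ℝ F'] {H' : Type*} [TopologicalSpace H']
  {I : ModelWithCorners ℝ F H} {I' : ModelWithCorners ℝ F' H'}
  {M : Type*} [TopologicalSpace M] [ChartedSpace H M]
  {M' : Type*} [TopologicalSpace M'] [ChartedSpace H' M']

/-- The derivative of a map at a point is the derivative of its expression in the preferred charts
there. -/
theorem hasMFDerivAt_of_eventually_chart [I.Boundaryless] {f : M → M'} {x : M} {g : F → F'}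
    {g' : F →L[ℝ] F'} (hf : ContinuousAt f x) (hg : HasFDerivAt g g' (extChartAt I x x))
    (h : ∀ᶠ x' in 𝓝 x, extChartAt I' (f x) (f x') = g (extChartAt I x x')) :
    HasMFDerivAt I I' f x g' := by
  refine ⟨hf, HasFDerivAt.hasFDerivWithinAt (hg.congr_of_eventuallyEq ?_)⟩
  have hs : Tendsto (extChartAt I x).symm (𝓝 (extChartAt I x x)) (𝓝 x) := by
    have := continuousAt_extChartAt_symm (I := I) x
    rwa [ContinuousAt, extChartAt_to_inv] at this
  filter_upwards [hs.eventually h, extChartAt_target_mem_nhds (I := I) x] with z hz hzt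
  rw [writtenInExtChartAt, Function.comp_apply, Function.comp_apply, hz,
    (extChartAt I x).right_inv hzt]

end General

variable {n : ℕ} {E : Type*} [TopologicalSpace E]
  [ChartedSpace (EuclideanSpace ℝ (Fin (n + 1))) E] [IsManifold (𝓡 (n + 1)) ∞ E]
  {π : FibredManifold n E} {m : ℕ}

section JetCharts

theorem coe_extChartAt_jet (j : Jet π m) :
    (extChartAt 𝓘(ℝ, JetModel n m) j : Jet π m → JetModel n m) =
      (π.adaptedChartAt j.base).jetChart m := rfl

theorem mem_chartAt_source_jet {j₀ j : Jet π m} :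
    j ∈ (chartAt (JetModel n m) j₀).source ↔ j.base ∈ (π.adaptedChartAt j₀.base).toChart.source :=
  Iff.rfl

theorem AdaptedChart.mdifferentiableAt_jetChart_symm (e : AdaptedChart π) {x : JetModel n m}
    (hx : x ∈ (e.jetChart m).target) :
    MDifferentiableAt 𝓘(ℝ, JetModel n m) 𝓘(ℝ, JetModel n m) (e.jetChart m).symm x :=
  ((contMDiffOn_symm_of_mem_maximalAtlas (e.jetHomeo_mem m)).contMDiffAt
    ((e.isOpen_jetChart_target m).mem_nhds hx)).mdifferentiableAt (by simp)

theorem AdaptedChart.isOpen_jetChart_source (e : AdaptedChart π) (m : ℕ) :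
    IsOpen (e.jetChart m).source :=
  (e.jetHomeo m).open_source

theorem AdaptedChart.contMDiffOn_jetChart (e : AdaptedChart π) (m : ℕ) :
    ContMDiffOn 𝓘(ℝ, JetModel n m) 𝓘(ℝ, JetModel n m) ∞ (e.jetChart m) (e.jetChart m).source :=
  contMDiffOn_of_mem_maximalAtlas (e.jetHomeo_mem m)

/-- Allows bump functions on `E` to be pulled back to jet bundles and to the unified bundle. -/
theorem Jet.contMDiff_base : ContMDiff 𝓘(ℝ, JetModel n m) (𝓡 (n + 1)) ∞
    (Jet.base : Jet π m → E) := by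
  intro j
  let e := π.adaptedChartAt j.base
  have hj : j ∈ (e.jetChart m).source := π.mem_adaptedChartAt j.base
  have h1 : ContMDiffOn 𝓘(ℝ, JetModel n m) 𝓘(ℝ, ℝ × FibreModel n) ∞
      (fun y => ((e.jetChart m y).1, (e.jetChart m y).2 0)) (e.jetChart m).source :=
    (show ContDiff ℝ ∞ fun p : JetModel n m => (p.1, p.2 0) by fun_prop).contMDiff.comp_contMDiffOn
      (e.contMDiffOn_jetChart m)
  refine ((e.smooth_symm.comp h1 fun y hy => (e.jetChart m).map_source hy).congr
    fun y hy => ?_).contMDiffAt ((e.isOpen_jetChart_source m).mem_nhds hj)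
  conv_lhs => rw [← (e.jetChart m).left_inv hy]
  exact e.base_jetChart_symm _ ((e.jetChart m).map_source hy)

end JetCharts

section Cotangent

/-- The momentum coordinates of a covector in the natural coordinates of an adapted chart. -/
def AdaptedChart.cotangentCoord (e : AdaptedChart π) (a : JetCotangent π m) :
    JetModel n m →L[ℝ] ℝ :=
  let α : JetModel n m →L[ℝ] ℝ := a.snd
  let A : JetModel n m →L[ℝ] JetModel n m :=
    mfderiv 𝓘(ℝ, JetModel n m) 𝓘(ℝ, JetModel n m) (e.jetChart m).symm (e.jetChart m a.proj)
  α.comp A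

/-- The preferred trivialization of the cotangent bundle composes a covector with the derivative of
the inverse chart, because the tangent trivialization is the derivative of the chart and the target
line bundle is trivial. -/
theorem trivializationAt_cotangent {j₀ : Jet π m} {a : JetCotangent π m}
    (h : a.proj.base ∈ (π.adaptedChartAt j₀.base).toChart.source) :
    trivializationAt (JetModel n m →L[ℝ] ℝ) (JetCotangentSpace π m) j₀ a =
      (a.proj, (π.adaptedChartAt j₀.base).cotangentCoord a) := by
  rw [hom_trivializationAt_apply, ContinuousLinearMap.inCoordinates,
    TangentBundle.symmL_trivializationAt (mem_chartAt_source_jet.2 h)]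
  refine Prod.ext rfl (ContinuousLinearMap.ext fun u => ?_)
  simp only [modelWithCornersSelf_coe, range_id, mfderivWithin_univ, coe_extChartAt_jet,
    ContinuousLinearMap.comp_apply]
  rw [Bundle.Trivialization.continuousLinearMapAt_apply, Bundle.Trivialization.linearMapAt_apply]
  simp
  rfl

/-- Tangent vectors at a point are expressed in the preferred chart there, so that chart has the
identity as derivative at its own base point. -/
theorem AdaptedChart.cotangentCoord_self (a : JetCotangent π m) :
    (π.adaptedChartAt a.proj.base).cotangentCoord a = a.snd := by
  have h := mfderivWithin_range_extChartAt_symm (I := 𝓘(ℝ, JetModel n m)) (x := a.proj)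
  simp only [modelWithCornersSelf_coe, range_id, mfderivWithin_univ, coe_extChartAt_jet] at h
  refine ContinuousLinearMap.ext fun u => ?_
  simp only [AdaptedChart.cotangentCoord]
  exact congrArg (fun A : JetModel n m →L[ℝ] JetModel n m => (a.snd : JetModel n m →L[ℝ] ℝ) (A u)) h

/-- The chain rule for `(e.jetChart m).symm`, factored through the transition map to `e'`. -/
theorem AdaptedChart.cotangentCoord_change (e e' : AdaptedChart π) {a : JetCotangent π m}
    (h : a.proj.base ∈ e.toChart.source) (h' : a.proj.base ∈ e'.toChart.source) :
    e.cotangentCoord a = (e'.cotangentCoord a).comp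
      (fderiv ℝ (e.jetTransition e' m) (e.jetChart m a.proj)) := by
  set x := e.jetChart m a.proj with hx_def
  have hxs : x ∈ ((e.jetChart m).symm.trans (e'.jetChart m)).source := by
    have hb : (e.jetChart m).symm x = a.proj := (e.jetChart m).left_inv h
    refine ⟨(e.jetChart m).map_source h, ?_⟩
    show (e.jetChart m).symm x ∈ (e'.jetChart m).source
    rw [hb]
    exact h'
  have heq : (e.jetChart m).symm =ᶠ[𝓝 x] (e'.jetChart m).symm ∘ e.jetTransition e' m := by
    filter_upwards [(e.isOpen_jetTransition_source e' m).mem_nhds hxs] with z hz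
    exact ((e'.jetChart m).left_inv hz.2).symm
  have hτx : e.jetTransition e' m x = e'.jetChart m a.proj :=
    congrArg (e'.jetChart m) ((e.jetChart m).left_inv h)
  have hτ : DifferentiableAt ℝ (e.jetTransition e' m) x :=
    ((e.contDiffOn_jetTransition e' m).contDiffAt
      ((e.isOpen_jetTransition_source e' m).mem_nhds hxs)).differentiableAt (by simp)
  have hmd : MDifferentiableAt 𝓘(ℝ, JetModel n m) 𝓘(ℝ, JetModel n m) (e'.jetChart m).symm
      (e.jetTransition e' m x) := by
    rw [hτx]
    exact e'.mdifferentiableAt_jetChart_symm ((e'.jetChart m).map_source h')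
  have hd := heq.mfderiv_eq (I := 𝓘(ℝ, JetModel n m)) (I' := 𝓘(ℝ, JetModel n m))
  rw [mfderiv_comp x hmd hτ.mdifferentiableAt, mfderiv_eq_fderiv, hτx] at hd
  refine ContinuousLinearMap.ext fun u => ?_
  simp only [AdaptedChart.cotangentCoord]
  exact congrArg (fun A : JetModel n m →L[ℝ] JetModel n m => (a.snd : JetModel n m →L[ℝ] ℝ) (A u)) hd

theorem mem_chartAt_source_cotangent {a₀ a : JetCotangent π m} :
    a ∈ (chartAt (ModelProd (JetModel n m) (JetModel n m →L[ℝ] ℝ)) a₀).source ↔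
      a.proj.base ∈ (π.adaptedChartAt a₀.proj.base).toChart.source := by
  simp only [FiberBundle.chartedSpace_chartAt, mfld_simps]
  exact ⟨fun h => h.1.1, fun h => ⟨⟨h, mem_univ a.proj⟩, h⟩⟩

theorem extChartAt_cotangent {a₀ a : JetCotangent π m}
    (h : a.proj.base ∈ (π.adaptedChartAt a₀.proj.base).toChart.source) :
    extChartAt (cotangentModel n m) a₀ a = ((π.adaptedChartAt a₀.proj.base).jetChart m a.proj,
      (π.adaptedChartAt a₀.proj.base).cotangentCoord a) := by
  rw [FiberBundle.extChartAt]
  have := trivializationAt_cotangent h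
  show Prod.map _ _ (trivializationAt (JetModel n m →L[ℝ] ℝ) (JetCotangentSpace π m) a₀.proj a) = _
  rw [this]
  rfl

end Cotangent

end CoordinatesOnBundles

/-! ### The canonical symplectic form in coordinates -/

section SymplecticForm

section General

variable {F : Type*} [NormedAddCommGroup F] [NormedSpace ℝ F] {H : Type*} [TopologicalSpace H]
  {I : ModelWithCorners ℝ F H} {M : Type*} [TopologicalSpace M] [ChartedSpace H M]
  [IsManifold I 1 M]

/-- A form with linear coefficients has constant derivative `B`, and the derivative of the preferred
chart at its own base point is the identity. -/
theorem OneForm.extDeriv_apply_of_inChart_eq {θ : OneForm I M} {x : M} {B : F →L[ℝ] F →L[ℝ] ℝ}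
    (h : θ.inChart x =ᶠ[𝓝 (extChartAt I x x)] B) (X X' : F) :
    θ.extDeriv x X X' = B X X' - B X' X := by
  have hA := mfderiv_extChartAt_self (I := I) (x := x)
  have hD : fderiv ℝ (θ.inChart x) (extChartAt I x x) = B :=
    (B.hasFDerivAt.congr_of_eventuallyEq h).fderiv
  simp only [OneForm.extDeriv, hD, hA]
  rfl

/-- The bilinear map `((x, p), (u, v)) ↦ p(u)`. -/
def tautologicalPairing (F : Type*) [NormedAddCommGroup F] [NormedSpace ℝ F] :
    (F × (F →L[ℝ] ℝ)) →L[ℝ] (F × (F →L[ℝ] ℝ)) →L[ℝ] ℝ :=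
  ((ContinuousLinearMap.compL ℝ (F × (F →L[ℝ] ℝ)) F ℝ).flip
    (ContinuousLinearMap.fst ℝ _ _)).comp (ContinuousLinearMap.snd ℝ _ _)

theorem tautologicalPairing_apply (X X' : F × (F →L[ℝ] ℝ)) :
    tautologicalPairing F X X' = X.2 X'.1 := rfl

end General

variable {n : ℕ} {E : Type*} [TopologicalSpace E]
  [ChartedSpace (EuclideanSpace ℝ (Fin (n + 1))) E] [IsManifold (𝓡 (n + 1)) ∞ E]
  {π : FibredManifold n E} {m : ℕ}

/-- The model space of `T^*(J^m π)`. -/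
abbrev CotangentModelSpace (n m : ℕ) : Type := JetModel n m × (JetModel n m →L[ℝ] ℝ)

theorem proj_extChartAt_cotangent_symm_mem {a : JetCotangent π m} {z : CotangentModelSpace n m}
    (hz : z ∈ (extChartAt (cotangentModel n m) a).target) :
    ((extChartAt (cotangentModel n m) a).symm z).proj ∈
      ((π.adaptedChartAt a.proj.base).jetChart m).source := by
  refine mem_chartAt_source_cotangent.1 ?_
  have := (extChartAt (cotangentModel n m) a).map_target hz
  rwa [extChartAt_source] at this

theorem coord_extChartAt_cotangent_symm {a : JetCotangent π m} {z : CotangentModelSpace n m}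
    (hz : z ∈ (extChartAt (cotangentModel n m) a).target) :
    ((π.adaptedChartAt a.proj.base).jetChart m ((extChartAt (cotangentModel n m) a).symm z).proj,
      (π.adaptedChartAt a.proj.base).cotangentCoord ((extChartAt (cotangentModel n m) a).symm z)) =
        z := by
  rw [← extChartAt_cotangent (proj_extChartAt_cotangent_symm_mem hz),
    (extChartAt (cotangentModel n m) a).right_inv hz]

theorem proj_extChartAt_cotangent_symm {a : JetCotangent π m} {z : CotangentModelSpace n m}
    (hz : z ∈ (extChartAt (cotangentModel n m) a).target) :
    ((extChartAt (cotangentModel n m) a).symm z).proj =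
      ((π.adaptedChartAt a.proj.base).jetChart m).symm z.1 := by
  rw [← congrArg Prod.fst (coord_extChartAt_cotangent_symm hz)]
  exact (((π.adaptedChartAt a.proj.base).jetChart m).left_inv
    (proj_extChartAt_cotangent_symm_mem hz)).symm

/-- In coordinates the bundle projection is `Prod.fst`, so both sides are derivatives of the same
map `(e.jetChart m).symm ∘ Prod.fst`. -/
theorem mfderiv_proj_extChartAt_cotangent_symm {a : JetCotangent π m} {z : CotangentModelSpace n m}
    (hz : z ∈ (extChartAt (cotangentModel n m) a).target) (u : CotangentModelSpace n m) :
    (mfderiv (cotangentModel n m) 𝓘(ℝ, JetModel n m)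
        (Bundle.TotalSpace.proj : JetCotangent π m → Jet π m)
        ((extChartAt (cotangentModel n m) a).symm z)
      (mfderiv 𝓘(ℝ, CotangentModelSpace n m) (cotangentModel n m)
        (extChartAt (cotangentModel n m) a).symm z u) : JetModel n m) =
      mfderiv 𝓘(ℝ, JetModel n m) 𝓘(ℝ, JetModel n m)
        ((π.adaptedChartAt a.proj.base).jetChart m).symm z.1 u.1 := by
  set e := π.adaptedChartAt a.proj.base with he
  have hxt : z.1 ∈ (e.jetChart m).target := by
    rw [← congrArg Prod.fst (coord_extChartAt_cotangent_symm hz)]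
    exact (e.jetChart m).map_source (proj_extChartAt_cotangent_symm_mem hz)
  have hsymm : MDifferentiableAt 𝓘(ℝ, CotangentModelSpace n m) (cotangentModel n m)
      (extChartAt (cotangentModel n m) a).symm z :=
    ((contMDiffOn_extChartAt_symm (n := ∞) a).contMDiffAt
      ((isOpen_extChartAt_target a).mem_nhds hz)).mdifferentiableAt (by simp)
  have hproj : MDifferentiableAt (cotangentModel n m) 𝓘(ℝ, JetModel n m)
      (Bundle.TotalSpace.proj : JetCotangent π m → Jet π m)
      ((extChartAt (cotangentModel n m) a).symm z) :=
    (Bundle.contMDiffAt_proj (n := ∞) (JetCotangentSpace π m)).mdifferentiableAt (by simp)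
  have hcomp := hproj.hasMFDerivAt.comp z hsymm.hasMFDerivAt
  have heq : (Bundle.TotalSpace.proj : JetCotangent π m → Jet π m) ∘
      (extChartAt (cotangentModel n m) a).symm =ᶠ[𝓝 z] (e.jetChart m).symm ∘ Prod.fst := by
    filter_upwards [(isOpen_extChartAt_target (I := cotangentModel n m) a).mem_nhds hz] with y hy
    exact proj_extChartAt_cotangent_symm hy
  have hfst : HasMFDerivAt 𝓘(ℝ, CotangentModelSpace n m) 𝓘(ℝ, JetModel n m)
      (Prod.fst : CotangentModelSpace n m → JetModel n m) z
      (ContinuousLinearMap.fst ℝ (JetModel n m) (JetModel n m →L[ℝ] ℝ)) :=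
    hasFDerivAt_fst.hasMFDerivAt
  have hcomp' := ((e.mdifferentiableAt_jetChart_symm hxt).hasMFDerivAt.comp z hfst)
  have h := hasMFDerivAt_unique hcomp (hcomp'.congr_of_eventuallyEq heq)
  exact congrArg (fun A : CotangentModelSpace n m →L[ℝ] JetModel n m => A u) h

/-- The coordinate expression `θ = p dq`. It holds on the whole chart target, as is needed in order
to differentiate it. -/
theorem tautologicalForm_inChart {a : JetCotangent π m} {z : CotangentModelSpace n m}
    (hz : z ∈ (extChartAt (cotangentModel n m) a).target) (u : CotangentModelSpace n m) :
    (tautologicalForm π m).inChart a z u = z.2 u.1 := by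
  have h1 := mfderiv_proj_extChartAt_cotangent_symm hz u
  have h2 := coord_extChartAt_cotangent_symm hz
  have hx := congrArg Prod.fst h2
  have hp := DFunLike.congr_fun (congrArg Prod.snd h2) u.1
  refine Eq.trans ?_ hp
  refine Eq.trans (congrArg
    (((extChartAt (cotangentModel n m) a).symm z).snd : JetModel n m →L[ℝ] ℝ) h1) ?_
  simp only at hx
  simp only [AdaptedChart.cotangentCoord]
  rw [hx]
  rfl

/-- In the preferred coordinates at a point, the canonical symplectic form is the standard one. -/
theorem symplecticForm_apply (a : JetCotangent π m) (X X' : CotangentModelSpace n m) :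
    symplecticForm π m a X X' = X'.2 X.1 - X.2 X'.1 := by
  have hB : (tautologicalForm π m).inChart a =ᶠ[𝓝 (extChartAt (cotangentModel n m) a a)]
      tautologicalPairing (JetModel n m) := by
    filter_upwards [extChartAt_target_mem_nhds (I := cotangentModel n m) a] with z hz
    exact ContinuousLinearMap.ext fun u => tautologicalForm_inChart hz u
  have h := OneForm.extDeriv_apply_of_inChart_eq hB X X'
  rw [tautologicalPairing_apply, tautologicalPairing_apply] at h
  refine (congrArg Neg.neg h).trans ?_
  exact neg_sub _ _

end SymplecticForm

/-! ### The unified bundle, the extended Legendre map and the constraint in coordinates -/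

section UnifiedCoordinates

/-- The projection `J^s π → J^r π` in natural coordinates. -/
def truncateModel (n : ℕ) {r s : ℕ} (h : r ≤ s) : JetModel n s →L[ℝ] JetModel n r :=
  (ContinuousLinearMap.fst ℝ ℝ _).prod (ContinuousLinearMap.pi fun i : Fin (r + 1) =>
    (ContinuousLinearMap.proj (R := ℝ) (φ := fun _ : Fin (s + 1) => FibreModel n)
      (Fin.castLE (by omega) i)).comp (ContinuousLinearMap.snd ℝ ℝ _))

/-- The velocity of `j^{k-1} φ` as a function of the natural coordinates of `j^{2k-1} φ`. -/
def velocityOfJet {n k : ℕ} (hk : 1 ≤ k) (x : JetModel n (2 * k - 1)) : JetModel n (k - 1) :=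
  (1, fun i => x.2 ⟨i + 1, by omega⟩)

theorem velocityOfJet_curveJet {n k : ℕ} (hk : 1 ≤ k) (q : ℝ → FibreModel n) (s : ℝ) :
    velocityOfJet hk (curveJet (2 * k - 1) q s) = velocityJet (k - 1) q s := rfl

theorem truncateModel_curveJet {n r s : ℕ} (h : r ≤ s) (q : ℝ → FibreModel n) (t : ℝ) :
    truncateModel n h (curveJet s q t) = curveJet r q t := rfl

theorem truncateModel_velocityJet {n r s : ℕ} (h : r ≤ s) (q : ℝ → FibreModel n) (t : ℝ) :
    truncateModel n h (velocityJet s q t) = velocityJet r q t := rfl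

variable {n : ℕ} {E : Type*} [TopologicalSpace E]
  [ChartedSpace (EuclideanSpace ℝ (Fin (n + 1))) E] [IsManifold (𝓡 (n + 1)) ∞ E]
  {π : FibredManifold n E} {k : ℕ} {L : Jet π k → ℝ}

theorem AdaptedChart.jetChart_jetProj (e : AdaptedChart π) {r s : ℕ} (h : r ≤ s) {j : Jet π s}
    (hj : j.base ∈ e.toChart.source) :
    e.jetChart r (jetProj π h j) = truncateModel n h (e.jetChart s j) :=
  e.jetChart_truncate h j hj

theorem base_jetProj {r s : ℕ} (h : r ≤ s) (j : Jet π s) : (jetProj π h j).base = j.base :=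
  Jet.base_truncate h j

section Unified

/-- The model space of the unified bundle. -/
abbrev UnifiedModelSpace (n k : ℕ) : Type :=
  JetModel n (2 * k - 1) × (JetModel n (k - 1) →L[ℝ] ℝ)

/-- The natural coordinates of the unified bundle induced by an adapted chart. -/
def AdaptedChart.unifiedCoord (e : AdaptedChart π) (w : Unified π k) : UnifiedModelSpace n k :=
  (e.jetChart (2 * k - 1) w.proj, e.cotangentCoord w.rho₂)

theorem base_rho₂ (w : Unified π k) : w.rho₂.proj.base = w.proj.base :=
  base_jetProj (by omega) w.proj

/-- Chart domains of `W` are inverse images of open sets of `E`; this is why cutting off on `E`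
suffices later. -/
theorem mem_chartAt_source_unified {w₀ w : Unified π k} :
    w ∈ (chartAt (ModelProd (JetModel n (2 * k - 1)) (JetModel n (k - 1) →L[ℝ] ℝ)) w₀).source ↔
      w.proj.base ∈ (π.adaptedChartAt w₀.proj.base).toChart.source := by
  simp only [FiberBundle.chartedSpace_chartAt, mfld_simps]
  constructor
  · exact fun h => h.2
  · intro h
    refine ⟨⟨?_, mem_univ _⟩, h⟩
    show w.rho₂.proj.base ∈ (π.adaptedChartAt w₀.rho₂.proj.base).toChart.source
    rwa [base_rho₂, base_rho₂]

theorem extChartAt_unified {w₀ w : Unified π k}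
    (h : w.proj.base ∈ (π.adaptedChartAt w₀.proj.base).toChart.source) :
    extChartAt (unifiedModel n k) w₀ w = (π.adaptedChartAt w₀.proj.base).unifiedCoord w := by
  have h' : w.rho₂.proj.base ∈ (π.adaptedChartAt w₀.rho₂.proj.base).toChart.source := by
    rwa [base_rho₂, base_rho₂]
  have ht := congrArg Prod.snd (trivializationAt_cotangent h')
  rw [base_rho₂] at ht
  rw [FiberBundle.extChartAt]
  exact Prod.ext rfl ht

theorem continuous_rho₂ : Continuous (Unified.rho₂ : Unified π k → JetCotangent π (k - 1)) :=
  Pullback.continuous_lift _ _ _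

theorem eventually_base_unified {w₀ : Unified π k} {e : AdaptedChart π}
    (h : w₀.proj.base ∈ e.toChart.source) : ∀ᶠ w in 𝓝 w₀, w.proj.base ∈ e.toChart.source := by
  have hp : ContinuousAt (fun w : Unified π k => w.proj) w₀ :=
    (FiberBundle.continuous_proj (JetModel n (k - 1) →L[ℝ] ℝ) _).continuousAt
  exact hp.eventually ((e.isOpen_jetChart_source (2 * k - 1)).mem_nhds h)

theorem hasMFDerivAt_rho₂ (w : Unified π k) :
    HasMFDerivAt (unifiedModel n k) (cotangentModel n (k - 1)) Unified.rho₂ w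
      ((truncateModel n (show k - 1 ≤ 2 * k - 1 by omega)).prodMap
        (ContinuousLinearMap.id ℝ (JetModel n (k - 1) →L[ℝ] ℝ))) := by
  refine hasMFDerivAt_of_eventually_chart continuous_rho₂.continuousAt
    (ContinuousLinearMap.hasFDerivAt _) ?_
  filter_upwards [eventually_base_unified (π.mem_adaptedChartAt w.proj.base)] with w' hw'
  have h' : w'.rho₂.proj.base ∈ (π.adaptedChartAt w.rho₂.proj.base).toChart.source := by
    rwa [base_rho₂, base_rho₂]
  rw [extChartAt_cotangent h', extChartAt_unified hw', base_rho₂]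
  exact Prod.ext (AdaptedChart.jetChart_jetProj _ _ hw') rfl

/-- In the preferred coordinates at a point, the presymplectic form of the unified bundle is the
standard one. -/
theorem unifiedForm_apply (w : Unified π k) (X X' : UnifiedModelSpace n k) :
    unifiedForm π k w X X' = X'.2 (truncateModel n (show k - 1 ≤ 2 * k - 1 by omega) X.1) -
      X.2 (truncateModel n (show k - 1 ≤ 2 * k - 1 by omega) X'.1) := by
  have h : unifiedForm π k w X X' = symplecticForm π (k - 1) w.rho₂
      (mfderiv (unifiedModel n k) (cotangentModel n (k - 1)) Unified.rho₂ w X)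
      (mfderiv (unifiedModel n k) (cotangentModel n (k - 1)) Unified.rho₂ w X') := rfl
  rw [h, (hasMFDerivAt_rho₂ w).mfderiv]
  exact symplecticForm_apply w.rho₂ _ _

end Unified

section Legendre

variable (hk : 1 ≤ k)

/-- The map is defined with a chart that varies with the point. Chart independence of the Legendre
covector gives its expression in one fixed chart, from which it can be differentiated. -/
theorem AdaptedChart.cotangentCoord_extendedLegendre
    (hL : ContMDiff 𝓘(ℝ, JetModel n k) 𝓘(ℝ, ℝ) ∞ L) {e : AdaptedChart π} {y : Jet π (2 * k - 1)}
    (hy : y.base ∈ e.toChart.source) :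
    e.cotangentCoord (extendedLegendre hk L y) = e.legendreCovector hk L y := by
  have hb : (extendedLegendre hk L y).proj.base = y.base := base_jetProj (by omega) y
  set e₀ := π.adaptedChartAt y.base with he₀
  have hy₀ : y.base ∈ e₀.toChart.source := π.mem_adaptedChartAt y.base
  have hself : e₀.cotangentCoord (extendedLegendre hk L y) = e₀.legendreCovector hk L y := by
    have h1 := AdaptedChart.cotangentCoord_self (extendedLegendre hk L y)
    rw [hb] at h1
    have h2 := mfderiv_extChartAt_self (I := 𝓘(ℝ, JetModel n (k - 1)))
      (x := (extendedLegendre hk L y).proj)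
    rw [coe_extChartAt_jet, hb] at h2
    rw [he₀, h1]
    exact congrArg (fun A : JetModel n (k - 1) →L[ℝ] JetModel n (k - 1) =>
      (e₀.legendreCovector hk L y).comp A) h2
  -- The chart change was proved along prolongations of sections, so `y` is written as the jet of
  -- its representative.
  have ht : y.rep.prolong (2 * k - 1) y.time = y := by
    rw [← y.time_rep, PointedSection.prolong_pt, y.jet_rep]
  have hch := AdaptedChart.legendreCovector_jetTransition hk hL (e.mem_times_rep hy)
    (e₀.mem_times_rep hy₀)
  rw [ht] at hch
  rw [e.cotangentCoord_change e₀ (hb ▸ hy) (hb ▸ hy₀), hself, hch]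
  congr 2
  rw [← e.jetChart_prolong (k - 1) (e.mem_times_rep hy),
    ← PointedSection.truncate_prolong _ (show k - 1 ≤ 2 * k - 1 by omega) (e.mem_times_rep hy).1, ht]
  rfl

/-- The extended Legendre-Ostrogradsky map is smooth. -/
theorem contMDiff_extendedLegendre (hL : ContMDiff 𝓘(ℝ, JetModel n k) 𝓘(ℝ, ℝ) ∞ L) :
    ContMDiff 𝓘(ℝ, JetModel n (2 * k - 1)) (cotangentModel n (k - 1)) ∞
      (extendedLegendre hk L) := by
  intro y₀
  have hb : ∀ y, (extendedLegendre hk L y).proj.base = y.base := fun y => base_jetProj (by omega) y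
  rw [Bundle.contMDiffAt_totalSpace]
  refine ⟨(jetProj π (show k - 1 ≤ 2 * k - 1 by omega)).contMDiff y₀, ?_⟩
  set e := π.adaptedChartAt (extendedLegendre hk L y₀).proj.base with he
  have hy₀ : y₀ ∈ (e.jetChart (2 * k - 1)).source := by
    show y₀.base ∈ e.toChart.source
    rw [← hb y₀]
    exact π.mem_adaptedChartAt _
  have hsm := ((e.contDiffOn_legendreCovector hk hL).contMDiffOn.comp
    (e.contMDiffOn_jetChart (2 * k - 1)) fun y hy => (e.jetChart (2 * k - 1)).map_source hy)
  refine (hsm.congr fun y hy => ?_).contMDiffAt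
    ((e.isOpen_jetChart_source (2 * k - 1)).mem_nhds hy₀)
  have hy' : (extendedLegendre hk L y).proj.base ∈ e.toChart.source := by rw [hb]; exact hy
  rw [trivializationAt_cotangent hy']
  show e.cotangentCoord _ = _
  rw [AdaptedChart.cotangentCoord_extendedLegendre hk hL hy, Function.comp_apply,
    (e.jetChart (2 * k - 1)).left_inv hy]

theorem hasMFDerivAt_extendedLegendre (hL : ContMDiff 𝓘(ℝ, JetModel n k) 𝓘(ℝ, ℝ) ∞ L)
    (y : Jet π (2 * k - 1)) {D : JetModel n (2 * k - 1) →L[ℝ] JetModel n (k - 1) →L[ℝ] ℝ}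
    (hD : HasFDerivAt (fun x => (π.adaptedChartAt y.base).legendreCovector hk L
      (((π.adaptedChartAt y.base).jetChart (2 * k - 1)).symm x)) D
        ((π.adaptedChartAt y.base).jetChart (2 * k - 1) y)) :
    HasMFDerivAt 𝓘(ℝ, JetModel n (2 * k - 1)) (cotangentModel n (k - 1)) (extendedLegendre hk L) y
      ((truncateModel n (show k - 1 ≤ 2 * k - 1 by omega)).prod D) := by
  have hb : ∀ y, (extendedLegendre hk L y).proj.base = y.base := fun y => base_jetProj (by omega) y
  set e := π.adaptedChartAt y.base with he
  refine hasMFDerivAt_of_eventually_chart (contMDiff_extendedLegendre hk hL).continuous.continuousAt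
    (g := fun x => (truncateModel n (show k - 1 ≤ 2 * k - 1 by omega) x,
      e.legendreCovector hk L ((e.jetChart (2 * k - 1)).symm x)))
    ((ContinuousLinearMap.hasFDerivAt _).prodMk hD) ?_
  filter_upwards [(e.isOpen_jetChart_source (2 * k - 1)).mem_nhds (π.mem_adaptedChartAt y.base)]
    with y' hy'
  have h' : (extendedLegendre hk L y').proj.base ∈
      (π.adaptedChartAt (extendedLegendre hk L y).proj.base).toChart.source := by
    rw [hb, hb]; exact hy'
  rw [extChartAt_cotangent h', hb, coe_extChartAt_jet, ← he]
  refine Prod.ext (e.jetChart_jetProj _ hy') ?_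
  rw [AdaptedChart.cotangentCoord_extendedLegendre hk hL hy', (e.jetChart (2 * k - 1)).left_inv hy']

/-- The Poincaré-Cartan form in the preferred coordinates at a point. -/
theorem poincareCartanForm_apply (hL : ContMDiff 𝓘(ℝ, JetModel n k) 𝓘(ℝ, ℝ) ∞ L)
    (y : Jet π (2 * k - 1)) {D : JetModel n (2 * k - 1) →L[ℝ] JetModel n (k - 1) →L[ℝ] ℝ}
    (hD : HasFDerivAt (fun x => (π.adaptedChartAt y.base).legendreCovector hk L
      (((π.adaptedChartAt y.base).jetChart (2 * k - 1)).symm x)) D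
        ((π.adaptedChartAt y.base).jetChart (2 * k - 1) y)) (Y Z : JetModel n (2 * k - 1)) :
    poincareCartanForm hk L y Y Z =
      D Z (truncateModel n (show k - 1 ≤ 2 * k - 1 by omega) Y) -
        D Y (truncateModel n (show k - 1 ≤ 2 * k - 1 by omega) Z) := by
  have h : poincareCartanForm hk L y Y Z = symplecticForm π (k - 1) (extendedLegendre hk L y)
      (mfderiv 𝓘(ℝ, JetModel n (2 * k - 1)) (cotangentModel n (k - 1)) (extendedLegendre hk L) y Y)
      (mfderiv 𝓘(ℝ, JetModel n (2 * k - 1)) (cotangentModel n (k - 1)) (extendedLegendre hk L) y Z)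
      := rfl
  rw [h, (hasMFDerivAt_extendedLegendre hk hL y hD).mfderiv]
  exact symplecticForm_apply (extendedLegendre hk L y) _ _

end Legendre

section Constraint

variable (hk : 1 ≤ k)

/-- In coordinates the velocity of `j^{k-1} φ` is `(1, q_1, …, q_k)`. These are coordinates of the
`(2k-1)`-jet because `k ≤ 2k - 1`, so the chosen representative plays no role. -/
theorem AdaptedChart.couplingFunction_eq {e : AdaptedChart π} {w : Unified π k}
    (hw : w.proj.base ∈ e.toChart.source) :
    couplingFunction w = e.cotangentCoord w.rho₂
      (velocityOfJet hk (e.jetChart (2 * k - 1) w.proj)) := by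
  set φ := w.rho₁.rep with hφ
  set t := w.rho₁.time with ht_def
  have ht : t ∈ e.times φ := e.mem_times_rep (y := w.rho₁) hw
  have hwt : φ.prolong (2 * k - 1) t = w.proj := by
    rw [ht_def, ← Jet.time_rep, PointedSection.prolong_pt, Jet.jet_rep]
    rfl
  have hx : e.jetChart (k - 1) w.rho₂.proj = curveJet (k - 1) (e.curve φ) t := by
    refine (e.jetChart_jetProj _ hw).trans ?_
    rw [← hwt, e.jetChart_prolong _ ht, truncateModel_curveJet]
  have hcurve : HasMFDerivAt 𝓘(ℝ, ℝ) 𝓘(ℝ, JetModel n (k - 1)) (curveJet (k - 1) (e.curve φ)) t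
      (ContinuousLinearMap.toSpanSingleton ℝ (velocityJet (k - 1) (e.curve φ) t)) :=
    (hasDerivAt_curveJet (k - 1) (e.contDiffAt_curve ht)).hasFDerivAt.hasMFDerivAt
  have hcomp := ((e.mdifferentiableAt_jetChart_symm
    (e.curveJet_mem_target (k - 1) ht)).hasMFDerivAt.comp t hcurve)
  have heq : φ.prolong (k - 1) =ᶠ[𝓝 t] (e.jetChart (k - 1)).symm ∘ curveJet (k - 1) (e.curve φ) := by
    filter_upwards [(e.isOpen_times φ).mem_nhds ht] with s hs
    exact (e.jetChart_symm_curveJet (k - 1) hs).symm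
  have hd := (hcomp.congr_of_eventuallyEq heq).mfderiv
  let α : JetModel n (k - 1) →L[ℝ] ℝ := w.snd
  have h1 : couplingFunction w = α (mfderiv 𝓘(ℝ, JetModel n (k - 1)) 𝓘(ℝ, JetModel n (k - 1))
      (e.jetChart (k - 1)).symm (curveJet (k - 1) (e.curve φ) t)
        (velocityJet (k - 1) (e.curve φ) t)) := by
    refine congrArg α ?_
    refine (congrArg (fun A : ℝ →L[ℝ] JetModel n (k - 1) => A 1) hd).trans ?_
    show (mfderiv 𝓘(ℝ, JetModel n (k - 1)) 𝓘(ℝ, JetModel n (k - 1)) (e.jetChart (k - 1)).symm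
        (curveJet (k - 1) (e.curve φ) t)) ((1 : ℝ) • velocityJet (k - 1) (e.curve φ) t) = _
    rw [one_smul]
  rw [h1, ← hx, ← velocityOfJet_curveJet hk, ← e.jetChart_prolong _ ht, hwt]
  rfl

/-- The constraint function in natural coordinates. -/
def AdaptedChart.localConstraint (e : AdaptedChart π) (L : Jet π k → ℝ)
    (z : UnifiedModelSpace n k) : ℝ :=
  z.2 (velocityOfJet hk z.1) -
    L ((e.jetChart k).symm (truncateModel n (show k ≤ 2 * k - 1 by omega) z.1))

theorem AdaptedChart.constraint_eq {e : AdaptedChart π} {w : Unified π k}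
    (hw : w.proj.base ∈ e.toChart.source) :
    constraint hk L w = e.localConstraint hk L (e.unifiedCoord w) := by
  have hw' : (jetProj π (show k ≤ 2 * k - 1 by omega) w.proj) ∈ (e.jetChart k).source := by
    show (jetProj π (show k ≤ 2 * k - 1 by omega) w.proj).base ∈ e.toChart.source
    rwa [base_jetProj]
  rw [constraint, e.couplingFunction_eq hk hw, AdaptedChart.localConstraint,
    AdaptedChart.unifiedCoord, ← e.jetChart_jetProj (show k ≤ 2 * k - 1 by omega) hw,
    (e.jetChart k).left_inv hw']
  rfl

theorem AdaptedChart.contDiffOn_localConstraint (e : AdaptedChart π)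
    (hL : ContMDiff 𝓘(ℝ, JetModel n k) 𝓘(ℝ, ℝ) ∞ L) :
    ContDiffOn ℝ ∞ (e.localConstraint hk L) ((e.jetChart (2 * k - 1)).target ×ˢ univ) := by
  have hv : ContDiff ℝ ∞ fun z : UnifiedModelSpace n k => velocityOfJet hk z.1 := by
    unfold velocityOfJet
    fun_prop
  refine (contDiff_snd.clm_apply hv).contDiffOn.sub ?_
  exact (e.contDiffOn_lagrangian hL).comp
    (((truncateModel n _).contDiff.comp contDiff_fst).contDiffOn) fun z hz => hz.1

end Constraint

end UnifiedCoordinates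

/-! ### Extending tangent vectors of the Hamiltonian submanifold to vector fields -/

section TangentFields

section General

variable {F : Type*} [NormedAddCommGroup F] [NormedSpace ℝ F] {H : Type*} [TopologicalSpace H]
  {I : ModelWithCorners ℝ F H} {M : Type*} [TopologicalSpace M] [ChartedSpace H M]
  [IsManifold I 1 M]

/-- The vector field with the given expression in the preferred chart at `x₀`, cut off by a
function. -/
def cutoffField (x₀ : M) (χ : M → ℝ) (Y : F → F) (x : M) : TangentSpace I x :=
  χ x • (trivializationAt F (TangentSpace I) x₀).symmL ℝ x (Y (extChartAt I x₀ x))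

theorem continuousLinearMapAt_cutoffField {x₀ x : M} (χ : M → ℝ) (Y : F → F)
    (hx : x ∈ (chartAt H x₀).source) :
    (trivializationAt F (TangentSpace I) x₀).continuousLinearMapAt ℝ x (cutoffField x₀ χ Y x) =
      χ x • Y (extChartAt I x₀ x) := by
  rw [cutoffField, map_smul, Bundle.Trivialization.continuousLinearMapAt_symmL]
  exact hx

theorem mfderiv_extChartAt_cutoffField {x₀ x : M} (χ : M → ℝ) (Y : F → F)
    (hx : x ∈ (chartAt H x₀).source) :
    mfderiv I 𝓘(ℝ, F) (extChartAt I x₀) x (cutoffField x₀ χ Y x) =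
      χ x • Y (extChartAt I x₀ x) :=
  (congrArg (fun A : TangentSpace I x →L[ℝ] F => A (cutoffField x₀ χ Y x))
    (TangentBundle.continuousLinearMapAt_trivializationAt hx)).symm.trans
      (continuousLinearMapAt_cutoffField χ Y hx)

theorem cutoffField_eq_zero {x₀ x : M} {χ : M → ℝ} (Y : F → F) (hx : χ x = 0) :
    cutoffField (I := I) x₀ χ Y x = 0 := by
  rw [cutoffField, hx, zero_smul]

theorem cutoffField_self {x₀ : M} {χ : M → ℝ} (Y : F → F) (hx : χ x₀ = 1) :
    cutoffField (I := I) x₀ χ Y x₀ = Y (extChartAt I x₀ x₀) := by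
  have h := mfderiv_extChartAt_cutoffField (I := I) χ Y (mem_chart_source H x₀)
  rw [mfderiv_extChartAt_self, hx, one_smul] at h
  exact h

/-- On the chart domain the field is smooth in the trivialization; off that domain the complement of
`C` is a neighbourhood on which the field is zero. -/
theorem contMDiff_cutoffField [IsManifold I ∞ M] {x₀ : M} {χ : M → ℝ}
    (hχ : ContMDiff I 𝓘(ℝ, ℝ) ∞ χ) {C : Set M} (hC : IsClosed C)
    (hCs : C ⊆ (chartAt H x₀).source) (hχC : ∀ x ∉ C, χ x = 0) {Y : F → F}
    (hY : ContDiffOn ℝ ∞ Y (extChartAt I x₀).target) :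
    ContMDiff I I.tangent ∞
      (fun x => (⟨x, cutoffField x₀ χ Y x⟩ : TangentBundle I M)) := by
  have hfield : ContMDiffOn I 𝓘(ℝ, F) ∞ (fun x => χ x • Y (extChartAt I x₀ x))
      (chartAt H x₀).source := by
    refine hχ.contMDiffOn.smul (hY.contMDiffOn.comp (contMDiffOn_extChartAt (I := I)) ?_)
    intro x hx
    exact (extChartAt I x₀).map_source (by rwa [extChartAt_source])
  intro x
  by_cases hx : x ∈ (chartAt H x₀).source
  · have hxb : x ∈ (trivializationAt F (TangentSpace I : M → Type _) x₀).baseSet := hx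
    refine ((trivializationAt F (TangentSpace I : M → Type _) x₀).contMDiffAt_section_iff hxb).2 ?_
    refine (hfield.contMDiffAt ((chartAt H x₀).open_source.mem_nhds hx)).congr_of_eventuallyEq ?_
    filter_upwards [(chartAt H x₀).open_source.mem_nhds hx] with x' hx'
    rw [← continuousLinearMapAt_cutoffField χ Y hx',
      Bundle.Trivialization.continuousLinearMapAt_apply,
      Bundle.Trivialization.coe_linearMapAt_of_mem _ (show x' ∈ _ from hx')]
  · have hxC : x ∉ C := fun h => hx (hCs h)
    refine ((Bundle.contMDiff_zeroSection ℝ (TangentSpace I : M → Type _)) x).congr_of_eventuallyEq ?_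
    filter_upwards [hC.isOpen_compl.mem_nhds hxC] with x' hx'
    show (⟨x', cutoffField x₀ χ Y x'⟩ : TangentBundle I M) = ⟨x', 0⟩
    rw [cutoffField, hχC x' hx', zero_smul]

omit [IsManifold I 1 M] in
theorem fderiv_apply_eq_one_of_line {c : F → ℝ} {z v : F} (hc : DifferentiableAt ℝ c z)
    (h : ∀ s : ℝ, c (z + s • v) = s + c z) : fderiv ℝ c z v = 1 := by
  have h1 : HasDerivAt (fun s : ℝ => z + s • v) v 0 := by
    simpa using ((hasDerivAt_id (0 : ℝ)).smul_const v).const_add z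
  have hz : HasFDerivAt c (fderiv ℝ c z) (z + (0 : ℝ) • v) := by
    rw [zero_smul, add_zero]
    exact hc.hasFDerivAt
  have h2 : HasDerivAt (fun s : ℝ => c (z + s • v)) 1 0 := by
    simp only [h]
    exact (hasDerivAt_id (0 : ℝ)).add_const _
  exact (hz.comp_hasDerivAt (0 : ℝ) h1).unique h2

/-- Subtracting a multiple of a transverse direction makes a field tangent to a level set. -/
theorem mfderiv_cutoffField_eq_zero {g : M → ℝ} {c : F → ℝ} {x₀ x : M} (χ : M → ℝ)
    (hx : x ∈ (chartAt H x₀).source)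
    (hg : ∀ X : TangentSpace I x, (mfderiv I 𝓘(ℝ, ℝ) g x X : ℝ) =
      fderiv ℝ c (extChartAt I x₀ x) (mfderiv I 𝓘(ℝ, F) (extChartAt I x₀) x X)) {v : F}
    (hv : fderiv ℝ c (extChartAt I x₀ x) v = 1) (X : F) :
    (mfderiv I 𝓘(ℝ, ℝ) g x
      (cutoffField x₀ χ (fun z => X - fderiv ℝ c z X • v) x) : ℝ) = 0 := by
  refine (hg _).trans ((congrArg (fderiv ℝ c (extChartAt I x₀ x))
    (mfderiv_extChartAt_cutoffField χ _ hx)).trans ?_)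
  simp only [map_smul, map_sub, hv, smul_eq_mul, mul_one, sub_self, mul_zero]
  rfl

end General

variable {n : ℕ} {E : Type*} [TopologicalSpace E]
  [ChartedSpace (EuclideanSpace ℝ (Fin (n + 1))) E] [IsManifold (𝓡 (n + 1)) ∞ E]
  {π : FibredManifold n E} {k : ℕ} {L : Jet π k → ℝ} (hk : 1 ≤ k)

section VectorFields

/-- The covector `dt`, as a vertical tangent vector of the unified bundle. -/
def momentumDirection (n k : ℕ) : UnifiedModelSpace n k :=
  (0, ContinuousLinearMap.fst ℝ ℝ (Fin (k - 1 + 1) → FibreModel n))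

/-- The constraint is affine in the covector, and `dt` takes the value `1` on the velocity `(1, q_1,
…, q_k)`. This is the transversality of `∂/∂p` to `W_o`. -/
theorem AdaptedChart.fderiv_localConstraint_momentumDirection (e : AdaptedChart π)
    {z : UnifiedModelSpace n k} (hz : DifferentiableAt ℝ (e.localConstraint hk L) z) :
    fderiv ℝ (e.localConstraint hk L) z (momentumDirection n k) = 1 := by
  refine fderiv_apply_eq_one_of_line hz fun s => ?_
  simp only [AdaptedChart.localConstraint, momentumDirection, velocityOfJet, Prod.smul_mk,
    smul_zero, Prod.fst_add, Prod.snd_add, add_zero, add_apply, smul_apply,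
    ContinuousLinearMap.coe_fst', smul_eq_mul, mul_one]
  ring

theorem AdaptedChart.differentiableAt_localConstraint {e : AdaptedChart π}
    (hL : ContMDiff 𝓘(ℝ, JetModel n k) 𝓘(ℝ, ℝ) ∞ L) {w : Unified π k}
    (hw : w.proj.base ∈ e.toChart.source) :
    DifferentiableAt ℝ (e.localConstraint hk L) (e.unifiedCoord w) :=
  ((e.contDiffOn_localConstraint hk hL).contDiffAt
    (((e.isOpen_jetChart_target (2 * k - 1)).prod isOpen_univ).mem_nhds
      ⟨(e.jetChart (2 * k - 1)).map_source hw, mem_univ _⟩)).differentiableAt (by simp)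

theorem mfderiv_constraint (hL : ContMDiff 𝓘(ℝ, JetModel n k) 𝓘(ℝ, ℝ) ∞ L) {w₀ w : Unified π k}
    (hw : w.proj.base ∈ (π.adaptedChartAt w₀.proj.base).toChart.source)
    (X : TangentSpace (unifiedModel n k) w) :
    (mfderiv (unifiedModel n k) 𝓘(ℝ, ℝ) (constraint hk L) w X : ℝ) =
      fderiv ℝ ((π.adaptedChartAt w₀.proj.base).localConstraint hk L)
        (extChartAt (unifiedModel n k) w₀ w)
        (mfderiv (unifiedModel n k) 𝓘(ℝ, UnifiedModelSpace n k)
          (extChartAt (unifiedModel n k) w₀) w X) := by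
  set e := π.adaptedChartAt w₀.proj.base
  have heq : constraint hk L =ᶠ[𝓝 w]
      e.localConstraint hk L ∘ extChartAt (unifiedModel n k) w₀ := by
    filter_upwards [eventually_base_unified hw] with w' hw'
    rw [Function.comp_apply, extChartAt_unified hw', e.constraint_eq hk hw']
  have hd : HasFDerivAt (e.localConstraint hk L)
      (fderiv ℝ (e.localConstraint hk L) (extChartAt (unifiedModel n k) w₀ w))
      (extChartAt (unifiedModel n k) w₀ w) := by
    rw [extChartAt_unified hw]
    exact (AdaptedChart.differentiableAt_localConstraint hk hL hw).hasFDerivAt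
  have hc := hd.hasMFDerivAt.comp w
    (mdifferentiableAt_extChartAt (I := unifiedModel n k)
      (mem_chartAt_source_unified.2 hw)).hasMFDerivAt
  rw [(hc.congr_of_eventuallyEq heq).mfderiv]
  rfl

/-- A vector field on the unified bundle tangent to the Hamiltonian submanifold, extending the
tangent vector `X` at `w₀`. -/
def hamiltonianField (L : Jet π k → ℝ) (w₀ : Unified π k) (χ : Unified π k → ℝ)
    (X : UnifiedModelSpace n k) (w : Unified π k) : TangentSpace (unifiedModel n k) w :=
  cutoffField (I := unifiedModel n k) w₀ χ (fun z => X -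
    fderiv ℝ ((π.adaptedChartAt w₀.proj.base).localConstraint hk L) z X • momentumDirection n k) w

/-- The correction along `∂/∂p` is made at every point of the chart, so the field is tangent to all
level sets of the constraint there, and multiplying by the cutoff preserves this. -/
theorem mfderiv_constraint_hamiltonianField (hL : ContMDiff 𝓘(ℝ, JetModel n k) 𝓘(ℝ, ℝ) ∞ L)
    {w₀ : Unified π k} {χ : Unified π k → ℝ}
    (hχ : ∀ w, w.proj.base ∉ (π.adaptedChartAt w₀.proj.base).toChart.source → χ w = 0)
    (X : UnifiedModelSpace n k) (w : Unified π k) :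
    mfderiv (unifiedModel n k) 𝓘(ℝ, ℝ) (constraint hk L) w
      (hamiltonianField hk L w₀ χ X w) = 0 := by
  by_cases hw : w.proj.base ∈ (π.adaptedChartAt w₀.proj.base).toChart.source
  · have hv := AdaptedChart.fderiv_localConstraint_momentumDirection hk _
      (AdaptedChart.differentiableAt_localConstraint hk hL hw)
    rw [← extChartAt_unified hw] at hv
    exact mfderiv_cutoffField_eq_zero χ (mem_chartAt_source_unified.2 hw)
      (mfderiv_constraint hk hL hw) hv X
  · have h0 : hamiltonianField hk L w₀ χ X w = 0 := cutoffField_eq_zero _ (hχ w hw)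
    rw [h0]
    exact map_zero _

theorem extChartAt_unified_target_subset (w₀ : Unified π k) :
    (extChartAt (unifiedModel n k) w₀).target ⊆
      ((π.adaptedChartAt w₀.proj.base).jetChart (2 * k - 1)).target ×ˢ univ := by
  intro z hz
  refine ⟨?_, mem_univ _⟩
  have h1 := (extChartAt (unifiedModel n k) w₀).map_target hz
  rw [extChartAt_source, mem_chartAt_source_unified] at h1
  have h2 := extChartAt_unified h1
  rw [(extChartAt (unifiedModel n k) w₀).right_inv hz] at h2
  rw [h2]
  exact ((π.adaptedChartAt w₀.proj.base).jetChart (2 * k - 1)).map_source h1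

theorem contMDiff_hamiltonianField (hL : ContMDiff 𝓘(ℝ, JetModel n k) 𝓘(ℝ, ℝ) ∞ L)
    {w₀ : Unified π k} {χ : Unified π k → ℝ} (hχ : ContMDiff (unifiedModel n k) 𝓘(ℝ, ℝ) ∞ χ)
    {C : Set (Unified π k)} (hC : IsClosed C)
    (hCs : ∀ w ∈ C, w.proj.base ∈ (π.adaptedChartAt w₀.proj.base).toChart.source)
    (hχC : ∀ w ∉ C, χ w = 0) (X : UnifiedModelSpace n k) :
    ContMDiff (unifiedModel n k) (unifiedModel n k).tangent ∞
      (fun w => (⟨w, hamiltonianField hk L w₀ χ X w⟩ :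
        TangentBundle (unifiedModel n k) (Unified π k))) := by
  refine contMDiff_cutoffField hχ hC (fun w hw => mem_chartAt_source_unified.2 (hCs w hw)) hχC ?_
  refine ContDiffOn.mono ?_ (extChartAt_unified_target_subset w₀)
  have h1 := (((π.adaptedChartAt w₀.proj.base).contDiffOn_localConstraint hk hL).fderiv_of_isOpen
    (m := ∞) (((π.adaptedChartAt w₀.proj.base).isOpen_jetChart_target (2 * k - 1)).prod isOpen_univ)
      (by simp)).clm_apply (contDiffOn_const (c := X))
  exact contDiffOn_const.sub (h1.smul contDiffOn_const)

theorem hamiltonianField_self {w₀ : Unified π k} {χ : Unified π k → ℝ} (hχ : χ w₀ = 1)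
    {X : UnifiedModelSpace n k}
    (hX : fderiv ℝ ((π.adaptedChartAt w₀.proj.base).localConstraint hk L)
      (extChartAt (unifiedModel n k) w₀ w₀) X = 0) :
    hamiltonianField hk L w₀ χ X w₀ = X := by
  refine (cutoffField_self _ hχ).trans ?_
  simp only [hX, zero_smul, sub_zero]
  rfl

/-- Every tangent vector of the Hamiltonian submanifold extends to a vector field on it. -/
theorem exists_isVectorFieldOnHamiltonian [T2Space E]
    (hL : ContMDiff 𝓘(ℝ, JetModel n k) 𝓘(ℝ, ℝ) ∞ L) (w₀ : Unified π k)
    (X : UnifiedModelSpace n k)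
    (hX : fderiv ℝ ((π.adaptedChartAt w₀.proj.base).localConstraint hk L)
      (extChartAt (unifiedModel n k) w₀ w₀) X = 0) :
    ∃ Y : ∀ w : Unified π k, TangentSpace (unifiedModel n k) w,
      IsVectorFieldOnHamiltonian hk L Y ∧ Y w₀ = X := by
  -- The bump function lives on `E`: Hausdorffness makes it smooth on `E`, and its pullback to `W`
  -- is supported in the chart domain.
  obtain ⟨f, -, hf⟩ := (SmoothBumpFunction.nhds_basis_tsupport (I := 𝓡 (n + 1))
    w₀.proj.base).mem_iff.1 ((π.adaptedChartAt w₀.proj.base).toChart.open_source.mem_nhds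
      (π.mem_adaptedChartAt w₀.proj.base))
  have hbase : ContMDiff (unifiedModel n k) (𝓡 (n + 1)) ∞ fun w : Unified π k => w.proj.base :=
    Jet.contMDiff_base.comp (Bundle.contMDiff_proj _)
  have hχ0 : ∀ w : Unified π k, w.proj.base ∉ tsupport f → f w.proj.base = 0 := fun w hw =>
    image_eq_zero_of_notMem_tsupport (f := f) hw
  refine ⟨hamiltonianField hk L w₀ (fun w => f w.proj.base) X, ⟨?_, fun w _ => ?_⟩, ?_⟩
  · exact (contMDiff_hamiltonianField hk hL (f.contMDiff.comp hbase)
      ((isClosed_tsupport f).preimage hbase.continuous) (fun w hw => hf hw) hχ0 X).contMDiffOn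
  · exact mfderiv_constraint_hamiltonianField hk hL (fun w hw => hχ0 w fun h => hw (hf h)) X w
  · exact hamiltonianField_self hk f.eq_one hX

end VectorFields

end TangentFields

/-! ### Hamilton's equations along a holonomic solution -/

section HamiltonEquations

variable {n : ℕ}

/-- The shift `(t, q_0, …, q_{2k-1}) ↦ (0, q_1, …, q_k)`. -/
def shiftModel (n : ℕ) {k : ℕ} (hk : 1 ≤ k) : JetModel n (2 * k - 1) →L[ℝ] JetModel n (k - 1) :=
  (0 : JetModel n (2 * k - 1) →L[ℝ] ℝ).prod (ContinuousLinearMap.pi fun i : Fin (k - 1 + 1) =>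
    (ContinuousLinearMap.proj (R := ℝ) (φ := fun _ : Fin (2 * k - 1 + 1) => FibreModel n)
      ⟨i + 1, by omega⟩).comp (ContinuousLinearMap.snd ℝ ℝ _))

theorem velocityOfJet_eq {k : ℕ} (hk : 1 ≤ k) (x : JetModel n (2 * k - 1)) :
    velocityOfJet hk x = shiftModel n hk x + (1, 0) :=
  Prod.ext (zero_add 1).symm (add_zero _).symm

variable {E : Type*} [TopologicalSpace E]
  [ChartedSpace (EuclideanSpace ℝ (Fin (n + 1))) E] [IsManifold (𝓡 (n + 1)) ∞ E]
  {π : FibredManifold n E} {k : ℕ} {L : Jet π k → ℝ} (hk : 1 ≤ k)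

theorem hasFDerivAt_comp_prodMk_left {F G : Type*} [NormedAddCommGroup F] [NormedSpace ℝ F]
    [NormedAddCommGroup G] [NormedSpace ℝ G] {c : F × G → ℝ} {x : F} {p : G}
    (hc : DifferentiableAt ℝ c (x, p)) :
    HasFDerivAt (fun x' => c (x', p))
      ((fderiv ℝ c (x, p)).comp (ContinuousLinearMap.inl ℝ F G)) x :=
  hc.hasFDerivAt.comp x (hasFDerivAt_prodMk_left x p)

/-- With the covector fixed, the velocity is affine in the jet coordinates, with linear part the
shift `q_i ↦ q_{i+1}`. -/
theorem AdaptedChart.fderiv_localConstraint_horizontal {e : AdaptedChart π}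
    (hL : ContMDiff 𝓘(ℝ, JetModel n k) 𝓘(ℝ, ℝ) ∞ L) {w : Unified π k}
    (hw : w.proj.base ∈ e.toChart.source) (u : JetModel n (2 * k - 1)) :
    fderiv ℝ (e.localConstraint hk L) (e.unifiedCoord w) (u, 0) =
      e.cotangentCoord w.rho₂ (shiftModel n hk u) -
        fderiv ℝ (fun p => L ((e.jetChart k).symm p))
          (truncateModel n (show k ≤ 2 * k - 1 by omega) (e.jetChart (2 * k - 1) w.proj))
          (truncateModel n (show k ≤ 2 * k - 1 by omega) u) := by
  set x := e.jetChart (2 * k - 1) w.proj with hx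
  set p := e.cotangentCoord w.rho₂ with hp
  set T := truncateModel n (show k ≤ 2 * k - 1 by omega)
  have h1 : HasFDerivAt (fun x' => e.localConstraint hk L (x', p))
      ((fderiv ℝ (e.localConstraint hk L) (e.unifiedCoord w)).comp
        (ContinuousLinearMap.inl ℝ _ _)) x :=
    hasFDerivAt_comp_prodMk_left (AdaptedChart.differentiableAt_localConstraint hk hL hw)
  have hTx : T x ∈ (e.jetChart k).target := (e.jetChart (2 * k - 1)).map_source hw
  have hlag : HasFDerivAt (fun p => L ((e.jetChart k).symm p))
      (fderiv ℝ (fun p => L ((e.jetChart k).symm p)) (T x)) (T x) :=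
    (((e.contDiffOn_lagrangian hL).contDiffAt
      ((e.isOpen_jetChart_target k).mem_nhds hTx)).differentiableAt (by simp)).hasFDerivAt
  have hvel : HasFDerivAt (fun x' => p (velocityOfJet hk x')) (p.comp (shiftModel n hk)) x := by
    simp only [velocityOfJet_eq, map_add]
    exact (p.comp (shiftModel n hk)).hasFDerivAt.add_const _
  have h2 := hvel.sub (hlag.comp x T.hasFDerivAt)
  exact DFunLike.congr_fun (h1.unique h2) u

section Sections

/-- The momentum coordinates along a curve in the unified bundle. -/
def AdaptedChart.momentumAlong (e : AdaptedChart π) (ψ : ℝ → Unified π k) (s : ℝ) :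
    JetModel n (k - 1) →L[ℝ] ℝ :=
  e.cotangentCoord (ψ s).rho₂

variable {ψ : ℝ → Unified π k} {φ : PointedSection π} {e : AdaptedChart π} {s t : ℝ}

theorem AdaptedChart.mem_times_iff (hφ : φ.dom = univ)
    (hψφ : ∀ t, φ.prolong (2 * k - 1) t = (ψ t).rho₁) :
    s ∈ e.times φ ↔ (ψ s).proj.base ∈ e.toChart.source := by
  have hs : s ∈ φ.dom := hφ ▸ mem_univ s
  have hb : (ψ s).proj.base = φ.toFun s := by
    rw [← φ.base_prolong (2 * k - 1) hs, hψφ]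
    rfl
  rw [hb]
  exact and_iff_right hs

theorem AdaptedChart.unifiedCoord_along (hψφ : ∀ t, φ.prolong (2 * k - 1) t = (ψ t).rho₁)
    (hs : s ∈ e.times φ) :
    e.unifiedCoord (ψ s) = (curveJet (2 * k - 1) (e.curve φ) s, e.momentumAlong ψ s) := by
  refine Prod.ext ?_ rfl
  rw [← e.jetChart_prolong (2 * k - 1) hs, hψφ]
  rfl

theorem AdaptedChart.momentumAlong_change {e' : AdaptedChart π} (hφ : φ.dom = univ)
    (hψφ : ∀ t, φ.prolong (2 * k - 1) t = (ψ t).rho₁) (h : s ∈ e.times φ) (h' : s ∈ e'.times φ) :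
    e.momentumAlong ψ s = (e'.momentumAlong ψ s).comp
      (fderiv ℝ (e.jetTransition e' (k - 1)) (curveJet (k - 1) (e.curve φ) s)) := by
  have hb : (ψ s).rho₂.proj.base ∈ e.toChart.source := by
    rw [base_rho₂]; exact (AdaptedChart.mem_times_iff hφ hψφ).1 h
  have hb' : (ψ s).rho₂.proj.base ∈ e'.toChart.source := by
    rw [base_rho₂]; exact (AdaptedChart.mem_times_iff hφ hψφ).1 h'
  have hx : e.jetChart (k - 1) (ψ s).rho₂.proj = curveJet (k - 1) (e.curve φ) s := by
    rw [← e.jetChart_prolong (k - 1) h,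
      ← φ.truncate_prolong (show k - 1 ≤ 2 * k - 1 by omega) h.1, hψφ]
    rfl
  rw [AdaptedChart.momentumAlong, e.cotangentCoord_change e' hb hb', hx]
  rfl

/-- Smoothness of the section gives smooth momenta in the preferred chart at each point; the
transformation law carries this to an arbitrary adapted chart. -/
theorem AdaptedChart.contDiffAt_momentumAlong
    (hψ : ContMDiff 𝓘(ℝ, ℝ) (unifiedModel n k) ∞ ψ) (hφ : φ.dom = univ)
    (hψφ : ∀ t, φ.prolong (2 * k - 1) t = (ψ t).rho₁) (hs : s ∈ e.times φ) :
    ContDiffAt ℝ ∞ (e.momentumAlong ψ) s := by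
  set e' := π.adaptedChartAt (ψ s).proj.base with he'
  have hs' : s ∈ e'.times φ :=
    (AdaptedChart.mem_times_iff hφ hψφ).2 (π.mem_adaptedChartAt _)
  have h1 : ContDiffAt ℝ ∞ (fun σ => extChartAt (unifiedModel n k) (ψ s) (ψ σ)) s :=
    contMDiffAt_iff_contDiffAt.1 ((contMDiffAt_extChartAt (I := unifiedModel n k)
      (x := ψ s)).comp s (hψ s))
  have h2 : ContDiffAt ℝ ∞ (e'.momentumAlong ψ) s := by
    refine (contDiffAt_snd.comp s h1).congr_of_eventuallyEq ?_
    filter_upwards [(e'.isOpen_times φ).mem_nhds hs'] with σ hσ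
    rw [Function.comp_apply, extChartAt_unified ((AdaptedChart.mem_times_iff hφ hψφ).1 hσ)]
    rfl
  have h3 : ContDiffAt ℝ ∞ (fun σ => fderiv ℝ (e.jetTransition e' (k - 1))
      (curveJet (k - 1) (e.curve φ) σ)) s :=
    ContDiffAt.comp s ((e.contDiffAt_jetTransition (k - 1) hs hs').fderiv_right (m := ∞) (by simp))
      (contDiffAt_curveJet (k - 1) (e.contDiffAt_curve hs))
  refine (h2.clm_comp h3).congr_of_eventuallyEq ?_
  filter_upwards [(e.isOpen_times φ).mem_nhds hs, (e'.isOpen_times φ).mem_nhds hs'] with σ hσ hσ'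
  exact AdaptedChart.momentumAlong_change hφ hψφ hσ hσ'

theorem mfderiv_section_unified (hψ : ContMDiff 𝓘(ℝ, ℝ) (unifiedModel n k) ∞ ψ)
    (hφ : φ.dom = univ) (hψφ : ∀ t, φ.prolong (2 * k - 1) t = (ψ t).rho₁) (s : ℝ) :
    mfderiv 𝓘(ℝ, ℝ) (unifiedModel n k) ψ s (1 : ℝ) =
      ((velocityJet (2 * k - 1) ((π.adaptedChartAt (ψ s).proj.base).curve φ) s,
        deriv ((π.adaptedChartAt (ψ s).proj.base).momentumAlong ψ) s) : UnifiedModelSpace n k) := by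
  set e := π.adaptedChartAt (ψ s).proj.base with he
  have hs : s ∈ e.times φ := (AdaptedChart.mem_times_iff hφ hψφ).2 (π.mem_adaptedChartAt _)
  have h1 := (hasDerivAt_curveJet (2 * k - 1) (e.contDiffAt_curve hs)).prodMk
    ((AdaptedChart.contDiffAt_momentumAlong hψ hφ hψφ hs).differentiableAt (by simp)).hasDerivAt
  have h2 := hasMFDerivAt_of_eventually_chart (I := 𝓘(ℝ, ℝ)) (I' := unifiedModel n k) (f := ψ)
    (x := s) hψ.continuous.continuousAt h1.hasFDerivAt ?_
  · rw [h2.mfderiv]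
    exact one_smul ℝ _
  · filter_upwards [(e.isOpen_times φ).mem_nhds hs] with σ hσ
    rw [extChartAt_unified ((AdaptedChart.mem_times_iff hφ hψφ).1 hσ)]
    exact AdaptedChart.unifiedCoord_along hψφ hσ

/-- Hamilton's equations: along a solution, the differential of the constraint function is the
contraction of the velocity with the presymplectic form. -/
theorem SolvesUnifiedEquation.fderiv_localConstraint [T2Space E]
    (hL : ContMDiff 𝓘(ℝ, JetModel n k) 𝓘(ℝ, ℝ) ∞ L)
    (hψ : ContMDiff 𝓘(ℝ, ℝ) (unifiedModel n k) ∞ ψ) (hφ : φ.dom = univ)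
    (hψφ : ∀ t, φ.prolong (2 * k - 1) t = (ψ t).rho₁) (hsol : SolvesUnifiedEquation hk L ψ) (s : ℝ)
    (X : UnifiedModelSpace n k) :
    fderiv ℝ ((π.adaptedChartAt (ψ s).proj.base).localConstraint hk L)
        ((π.adaptedChartAt (ψ s).proj.base).unifiedCoord (ψ s)) X =
      X.2 (velocityJet (k - 1) ((π.adaptedChartAt (ψ s).proj.base).curve φ) s) -
        deriv ((π.adaptedChartAt (ψ s).proj.base).momentumAlong ψ) s
          (truncateModel n (show k - 1 ≤ 2 * k - 1 by omega) X.1) := by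
  set e := π.adaptedChartAt (ψ s).proj.base with he
  have hw : (ψ s).proj.base ∈ e.toChart.source := π.mem_adaptedChartAt _
  have hdt := e.fderiv_localConstraint_momentumDirection hk
    (AdaptedChart.differentiableAt_localConstraint hk hL hw)
  set A := fderiv ℝ (e.localConstraint hk L) (e.unifiedCoord (ψ s)) with hA
  -- The projection of `X` onto the tangent space of `W_o` along `∂/∂p`.
  set X' : UnifiedModelSpace n k := X - A X • momentumDirection n k with hX'
  have hker : fderiv ℝ (e.localConstraint hk L) (extChartAt (unifiedModel n k) (ψ s) (ψ s)) X' =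
      0 := by
    rw [extChartAt_unified hw, ← hA, hX', map_sub, map_smul, hdt, smul_eq_mul, mul_one, sub_self]
  obtain ⟨Y, hY, hYs⟩ := exists_isVectorFieldOnHamiltonian hk hL (ψ s) X' hker
  have h1 := congrFun (hsol Y hY) s
  have h2 : unifiedForm π k (ψ s) (Y (ψ s)) (mfderiv 𝓘(ℝ, ℝ) (unifiedModel n k) ψ s (1 : ℝ)) = 0 :=
    DFunLike.congr_fun h1 (1 : ℝ)
  rw [hYs, mfderiv_section_unified hψ hφ hψφ s] at h2
  have h3 := (unifiedForm_apply (ψ s) _ _).symm.trans h2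
  simp only [truncateModel_velocityJet, hX', momentumDirection, Prod.fst_sub, Prod.snd_sub,
    Prod.smul_fst, Prod.smul_snd, smul_zero, sub_zero, sub_apply, smul_apply, smul_eq_mul] at h3
  -- The value `1` of `dt` on the velocity makes the correction contribute exactly `dc(X)` to the
  -- contraction.
  have h4 : (ContinuousLinearMap.fst ℝ ℝ (Fin (k - 1 + 1) → FibreModel n))
      (velocityJet (k - 1) (e.curve φ) s) = 1 := rfl
  rw [h4] at h3
  linarith

end Sections

end HamiltonEquations

/-! ### From Hamilton's equations to the Lagrangian equation -/

section LagrangianEquation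

variable {n : ℕ} {E : Type*} [TopologicalSpace E]
  [ChartedSpace (EuclideanSpace ℝ (Fin (n + 1))) E] [IsManifold (𝓡 (n + 1)) ∞ E]
  {π : FibredManifold n E} {k : ℕ} {L : Jet π k → ℝ}
  {ψ : ℝ → Unified π k} {φ : PointedSection π} {e : AdaptedChart π} {s t : ℝ}

theorem hasDerivAt_verticalJet (m : ℕ) {v : ℝ → FibreModel n} (hv : ContDiffAt ℝ ∞ v s) :
    HasDerivAt (verticalJet m v) ((0, fun i => iteratedDeriv (i + 1) v s) : JetModel n m) s :=
  (hasDerivAt_const s 0).prodMk (hasDerivAt_pi.2 fun i => hasDerivAt_iteratedDeriv i hv)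

theorem AdaptedChart.truncateModel_jetChart_prolong {r m : ℕ} (h : r ≤ m) (hs : s ∈ e.times φ) :
    truncateModel n h (e.jetChart m (φ.prolong m s)) = curveJet r (e.curve φ) s := by
  rw [e.jetChart_prolong m hs]
  rfl

section Solution

variable (hk : 1 ≤ k)

/-- The first variation formula for the momenta of a solution, in the preferred coordinates. -/
theorem SolvesUnifiedEquation.hasDerivAt_momentumAlong_self [T2Space E]
    (hL : ContMDiff 𝓘(ℝ, JetModel n k) 𝓘(ℝ, ℝ) ∞ L)
    (hψ : ContMDiff 𝓘(ℝ, ℝ) (unifiedModel n k) ∞ ψ) (hφ : φ.dom = univ)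
    (hψφ : ∀ t, φ.prolong (2 * k - 1) t = (ψ t).rho₁) (hsol : SolvesUnifiedEquation hk L ψ)
    {v : ℝ → FibreModel n} (hv : ContDiffAt ℝ ∞ v s) :
    HasDerivAt (fun σ => (π.adaptedChartAt (ψ s).proj.base).momentumAlong ψ σ
        (verticalJet (k - 1) v σ))
      (∑ r ∈ Finset.range (k + 1), (π.adaptedChartAt (ψ s).proj.base).partialAlong L φ r s
        (iteratedDeriv r v s)) s := by
  -- The test vector is a prolonged vertical variation with zero momentum component.
  have hH := SolvesUnifiedEquation.fderiv_localConstraint hk hL hψ hφ hψφ hsol s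
    (verticalJet (2 * k - 1) v s, 0)
  set e := π.adaptedChartAt (ψ s).proj.base
  have hw : (ψ s).proj.base ∈ e.toChart.source := π.mem_adaptedChartAt _
  have hs : s ∈ e.times φ := (AdaptedChart.mem_times_iff hφ hψφ).2 hw
  rw [AdaptedChart.fderiv_localConstraint_horizontal hk hL hw] at hH
  have hx : truncateModel n (show k ≤ 2 * k - 1 by omega) (e.jetChart (2 * k - 1) (ψ s).proj) =
      curveJet k (e.curve φ) s := by
    rw [← e.truncateModel_jetChart_prolong (show k ≤ 2 * k - 1 by omega) hs, hψφ]
    rfl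
  have hlag := e.fderiv_lagrangian_vertical (L := L) hs fun r => iteratedDeriv r v s
  rw [hx] at hH
  refine ((((AdaptedChart.contDiffAt_momentumAlong hψ hφ hψφ hs).differentiableAt
    (by simp)).hasDerivAt).clm_apply (hasDerivAt_verticalJet (k - 1) hv)).congr_deriv ?_
  rw [← hlag]
  -- The shift of the prolonged variation is the time derivative of that variation, so the two
  -- momentum terms are the Leibniz expansion of the derivative of the pairing.
  have hH' : e.momentumAlong ψ s ((0, fun i => iteratedDeriv (i + 1) v s) : JetModel n (k - 1)) -
      fderiv ℝ (fun p => L ((e.jetChart k).symm p)) (curveJet k (e.curve φ) s)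
        (0, fun i => iteratedDeriv i v s) =
      0 - deriv (e.momentumAlong ψ) s (verticalJet (k - 1) v s) := hH
  linarith

/-- The first variation formula for the momenta of a solution, in any adapted chart. -/
theorem SolvesUnifiedEquation.deriv_momentumAlong [T2Space E]
    (hL : ContMDiff 𝓘(ℝ, JetModel n k) 𝓘(ℝ, ℝ) ∞ L)
    (hψ : ContMDiff 𝓘(ℝ, ℝ) (unifiedModel n k) ∞ ψ) (hφ : φ.dom = univ)
    (hψφ : ∀ t, φ.prolong (2 * k - 1) t = (ψ t).rho₁) (hsol : SolvesUnifiedEquation hk L ψ)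
    (hs : s ∈ e.times φ) {v : ℝ → FibreModel n} (hv : ContDiff ℝ ∞ v) :
    deriv (fun σ => e.momentumAlong ψ σ (verticalJet (k - 1) v σ)) s =
      ∑ r ∈ Finset.range (k + 1), e.partialAlong L φ r s (iteratedDeriv r v s) := by
  set e' := π.adaptedChartAt (ψ s).proj.base with he'
  have hs' : s ∈ e'.times φ := (AdaptedChart.mem_times_iff hφ hψφ).2 (π.mem_adaptedChartAt _)
  -- The formula holds at `s` in the preferred chart at `ψ s`. It is applied there to the
  -- transported variation; both sides of it are invariant under the change of chart.
  have h := SolvesUnifiedEquation.hasDerivAt_momentumAlong_self hk hL hψ hφ hψφ hsol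
    (e.contDiffAt_transportVariation hv.contDiffAt hs hs')
  rw [e.sum_partialAlong_eq hL hs hs' hv, ← h.deriv]
  refine Filter.EventuallyEq.deriv_eq ?_
  filter_upwards [(e.isOpen_times φ).mem_nhds hs, (e'.isOpen_times φ).mem_nhds hs'] with σ hσ hσ'
  rw [AdaptedChart.momentumAlong_change hφ hψφ hσ hσ', ContinuousLinearMap.comp_apply,
    e.fderiv_jetTransition_verticalJet (k - 1) hv hσ hσ']

/-- A holonomic solution of the unified equation lies in the graph of the extended
Legendre-Ostrogradsky map. -/
theorem SolvesUnifiedEquation.momentumAlong_eq_legendreCovector [T2Space E]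
    (hL : ContMDiff 𝓘(ℝ, JetModel n k) 𝓘(ℝ, ℝ) ∞ L)
    (hψ : IsHamiltonianSection hk L ψ) (hφ : φ.dom = univ)
    (hψφ : ∀ t, φ.prolong (2 * k - 1) t = (ψ t).rho₁) (hsol : SolvesUnifiedEquation hk L ψ)
    (ht : t ∈ e.times φ) :
    e.momentumAlong ψ t = e.legendreCovector hk L (φ.prolong (2 * k - 1) t) := by
  refine covector_ext (q := e.curve φ) (t := t) ?_ fun r => ?_
  -- On the velocity, the constraint says that the momentum of the solution takes the value of `L`,
  -- as the Legendre covector does.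
  · have hw := (AdaptedChart.mem_times_iff hφ hψφ).1 ht
    have h0 : constraint hk L (ψ t) = 0 := hψ.2.1 t
    rw [AdaptedChart.constraint_eq hk hw, AdaptedChart.unifiedCoord_along hψφ ht,
      AdaptedChart.localConstraint, velocityOfJet_curveJet, truncateModel_curveJet,
      e.jetChart_symm_curveJet k ht] at h0
    rw [e.legendreCovector_velocityJet hk ht]
    exact sub_eq_zero.1 h0
  · rw [e.legendreCovector_verticalInclusion, e.momentum_prolong hk hL ht]
    -- On vertical vectors the first variation formula for a solution is exact, so the order-zero
    -- term is `0`.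
    refine e.verticalInclusion_eq_ostrogradskySum hk hL ht
      (AdaptedChart.contDiffAt_momentumAlong hψ.1 hφ hψφ ht) (fun _ => 0) ?_ r
    filter_upwards [(e.isOpen_times φ).mem_nhds ht] with s hs v
    rw [SolvesUnifiedEquation.deriv_momentumAlong hk hL hψ.1 hφ hψφ hsol hs
      (contDiff_taylorCurve_right s v)]
    simp

end Solution

theorem HasFDerivAt.fderiv_graph_eq_zero {F G : Type*} [NormedAddCommGroup F] [NormedSpace ℝ F]
    [NormedAddCommGroup G] [NormedSpace ℝ G] {c : F × G → ℝ} {x : F} {Λ : F → G} {D : F →L[ℝ] G}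
    (hD : HasFDerivAt Λ D x) (hc : DifferentiableAt ℝ c (x, Λ x))
    (h : ∀ᶠ y in 𝓝 x, c (y, Λ y) = 0) (Y : F) : fderiv ℝ c (x, Λ x) (Y, D Y) = 0 := by
  have h1 : HasFDerivAt (fun y => c (y, Λ y))
      ((fderiv ℝ c (x, Λ x)).comp ((ContinuousLinearMap.id ℝ F).prod D)) x :=
    hc.hasFDerivAt.comp x ((hasFDerivAt_id x).prodMk hD)
  have h2 : HasFDerivAt (fun y => c (y, Λ y)) (0 : F →L[ℝ] ℝ) x :=
    (hasFDerivAt_const 0 x).congr_of_eventuallyEq h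
  exact DFunLike.congr_fun (h1.unique h2) Y

/-- The graph of the extended Legendre-Ostrogradsky map lies in the Hamiltonian submanifold. -/
theorem AdaptedChart.localConstraint_legendreCovector (hk : 1 ≤ k) {x : JetModel n (2 * k - 1)}
    (hx : x ∈ (e.jetChart (2 * k - 1)).target) :
    e.localConstraint hk L
      (x, e.legendreCovector hk L ((e.jetChart (2 * k - 1)).symm x)) = 0 := by
  set y := (e.jetChart (2 * k - 1)).symm x with hy
  have hyx : e.jetChart (2 * k - 1) y = x := (e.jetChart (2 * k - 1)).right_inv hx
  have hyb : y.base ∈ e.toChart.source := (e.jetChart (2 * k - 1)).map_target hx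
  have ht := e.mem_times_rep hyb
  have hp : y.rep.prolong (2 * k - 1) y.time = y := by
    rw [← Jet.time_rep, PointedSection.prolong_pt, Jet.jet_rep]
  have h := e.legendreCovector_velocityJet (L := L) hk ht
  have hc : x = curveJet (2 * k - 1) (e.curve y.rep) y.time := by
    rw [← e.jetChart_prolong _ ht, hp, hyx]
  rw [hp] at h
  rw [AdaptedChart.localConstraint, hc, velocityOfJet_curveJet, truncateModel_curveJet,
    e.jetChart_symm_curveJet k ht, h, sub_self]

theorem mfderiv_prolong {m : ℕ} {ψ : ℝ → Jet π m} (hc : Continuous ψ) (hφ : φ.dom = univ)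
    (hψφ : ∀ t, φ.prolong m t = ψ t) (t : ℝ) :
    mfderiv 𝓘(ℝ, ℝ) 𝓘(ℝ, JetModel n m) ψ t (1 : ℝ) =
      velocityJet m ((π.adaptedChartAt (ψ t).base).curve φ) t := by
  set e := π.adaptedChartAt (ψ t).base with he
  have ht : t ∈ e.times φ := by
    refine ⟨hφ ▸ mem_univ t, ?_⟩
    have hb := φ.base_prolong m (hφ ▸ mem_univ t)
    rw [hψφ] at hb
    rw [mem_preimage, ← hb]
    exact π.mem_adaptedChartAt _
  have h2 := hasMFDerivAt_of_eventually_chart (I := 𝓘(ℝ, ℝ)) (I' := 𝓘(ℝ, JetModel n m)) (f := ψ)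
    (x := t) hc.continuousAt (hasDerivAt_curveJet m (e.contDiffAt_curve ht)).hasFDerivAt ?_
  · rw [h2.mfderiv]
    exact one_smul ℝ _
  · filter_upwards [(e.isOpen_times φ).mem_nhds ht] with σ hσ
    rw [coe_extChartAt_jet, ← hψφ σ]
    exact e.jetChart_prolong m hσ

/-- A holonomic solution of the unified equation projects to a solution of the Lagrangian
equation. -/
theorem SolvesUnifiedEquation.solvesLagrangianEquation [T2Space E] (hk : 1 ≤ k)
    (hL : ContMDiff 𝓘(ℝ, JetModel n k) 𝓘(ℝ, ℝ) ∞ L)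
    (hψ : IsHamiltonianSection hk L ψ) (hc : Continuous fun t => (ψ t).rho₁) (hφ : φ.dom = univ)
    (hψφ : ∀ t, φ.prolong (2 * k - 1) t = (ψ t).rho₁) (hsol : SolvesUnifiedEquation hk L ψ) :
    SolvesLagrangianEquation hk L fun t => (ψ t).rho₁ := by
  intro Y _
  funext t
  refine ContinuousLinearMap.ext_ring ?_
  show poincareCartanForm hk L (ψ t).rho₁ (Y (ψ t).rho₁)
    (mfderiv 𝓘(ℝ, ℝ) 𝓘(ℝ, JetModel n (2 * k - 1)) (fun t => (ψ t).rho₁) t (1 : ℝ)) = 0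
  rw [mfderiv_prolong hc hφ hψφ t]
  set e := π.adaptedChartAt (ψ t).proj.base with he
  have hw : (ψ t).proj.base ∈ e.toChart.source := π.mem_adaptedChartAt _
  have ht : t ∈ e.times φ := (AdaptedChart.mem_times_iff hφ hψφ).2 hw
  have hx : e.jetChart (2 * k - 1) (ψ t).rho₁ = curveJet (2 * k - 1) (e.curve φ) t := by
    rw [← hψφ, e.jetChart_prolong _ ht]
  have htgt := e.curveJet_mem_target (2 * k - 1) ht
  set Λ := fun x => e.legendreCovector hk L ((e.jetChart (2 * k - 1)).symm x) with hΛ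
  set D := fderiv ℝ Λ (curveJet (2 * k - 1) (e.curve φ) t) with hD_def
  have hD : HasFDerivAt Λ D (curveJet (2 * k - 1) (e.curve φ) t) :=
    (((e.contDiffOn_legendreCovector hk hL).contDiffAt
      ((e.isOpen_jetChart_target _).mem_nhds htgt)).differentiableAt (by simp)).hasFDerivAt
  -- The graph relation holds at all times in the chart, so it can be differentiated: the velocity
  -- of the solution is `(v, D v)` for the velocity `v` of the jet curve.
  have hmom : ∀ {σ}, σ ∈ e.times φ →
      e.momentumAlong ψ σ = Λ (curveJet (2 * k - 1) (e.curve φ) σ) := fun {σ} hσ => by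
    rw [SolvesUnifiedEquation.momentumAlong_eq_legendreCovector hk hL hψ hφ hψφ hsol hσ]
    exact congrArg (e.legendreCovector hk L) (e.jetChart_symm_curveJet _ hσ).symm
  have hderiv : deriv (e.momentumAlong ψ) t = D (velocityJet (2 * k - 1) (e.curve φ) t) := by
    refine ((hD.comp_hasDerivAt t
      (hasDerivAt_curveJet _ (e.contDiffAt_curve ht))).congr_of_eventuallyEq ?_).deriv
    filter_upwards [(e.isOpen_times φ).mem_nhds ht] with σ hσ using hmom hσ
  have hcoord : e.unifiedCoord (ψ t) = (curveJet (2 * k - 1) (e.curve φ) t,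
      Λ (curveJet (2 * k - 1) (e.curve φ) t)) := by
    rw [AdaptedChart.unifiedCoord_along hψφ ht, hmom ht]
  have hD' : HasFDerivAt Λ D (e.jetChart (2 * k - 1) (ψ t).rho₁) := hx.symm ▸ hD
  let y : JetModel n (2 * k - 1) := Y (ψ t).rho₁
  have hdiff := AdaptedChart.differentiableAt_localConstraint hk hL hw
  rw [hcoord] at hdiff
  -- The graph of the Legendre map lies in the zero set of the constraint, so the lift `(y, D y)` of
  -- any jet vector is annihilated by its differential.
  have hgraph := HasFDerivAt.fderiv_graph_eq_zero hD hdiff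
    (by filter_upwards [(e.isOpen_jetChart_target _).mem_nhds htgt] with x hx
          using e.localConstraint_legendreCovector hk hx) y
  -- Hamilton's equation on the lift `(y, D y)`: its left side is zero, and its right side is, up to
  -- sign, the Poincaré-Cartan form on `y` and the velocity.
  have hH := SolvesUnifiedEquation.fderiv_localConstraint hk hL hψ.1 hφ hψφ hsol t (y, D y)
  rw [← he, hcoord, hgraph, hderiv] at hH
  refine (poincareCartanForm_apply hk hL (ψ t).rho₁ hD' y
    (velocityJet (2 * k - 1) (e.curve φ) t)).trans ?_
  have hH' : 0 = D y (velocityJet (k - 1) (e.curve φ) t) -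
    D (velocityJet (2 * k - 1) (e.curve φ) t) (truncateModel n (by omega) y) := hH
  rw [truncateModel_velocityJet]
  linarith

end LagrangianEquation

end HigherOrderMechanics

end

theorem mainTheorem10 {n : ℕ} {E : Type*} [TopologicalSpace E] [T2Space E]
    [ChartedSpace (EuclideanSpace ℝ (Fin (n + 1))) E] [IsManifold (𝓡 (n + 1)) ∞ E]
    (π : FibredManifold n E) (k : ℕ) (hk : 1 ≤ k)
    (L : Jet π k → ℝ) (hL : ContMDiff 𝓘(ℝ, JetModel n k) 𝓘(ℝ, ℝ) ∞ L)
    (ψ : ℝ → Unified π k) (hψ : IsHamiltonianSection hk L ψ)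
    (hhol : IsHolonomicInUnified ψ)
    (hsol : SolvesUnifiedEquation hk L ψ) :
    IsJetSection (fun t => (ψ t).rho₁) ∧
      IsHolonomic (fun t => (ψ t).rho₁) ∧
        SolvesLagrangianEquation hk L fun t => (ψ t).rho₁ := by
  obtain ⟨φ, hφ, hb, hψφ⟩ := hhol
  have hs : ContMDiff 𝓘(ℝ, ℝ) 𝓘(ℝ, JetModel n (2 * k - 1)) ∞ fun t => (ψ t).rho₁ :=
    (Bundle.contMDiff_proj _).comp hψ.1
  exact ⟨⟨hs, hψ.2.2⟩, ⟨φ, hφ, hb, hψφ⟩,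
    SolvesUnifiedEquation.solvesLagrangianEquation hk hL hψ hs.continuous hφ hψφ hsol⟩
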